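/- Let $d\ge 1$, let $\mathbb{R}^d_+=(0,\infty)^d$ be equipped with Lebesgue measure, and let $L_n^a$ denote the Laguerre polynomial of degree $n$ and order $a>-1$. For $\beta\in(-1,\infty)^d$ and $k\in\mathbb{N}^d$ let $$\varphi_k^\beta(x)=\prod_{i=1}^d \sqrt2\,\Big(\frac{\Gamma(k_i+1)}{\Gamma(k_i+\beta_i+1)}\Big)^{1/2}L_{k_i}^{\beta_i}(x_i^2)\,x_i^{\beta_i+1/2}e^{-x_i^2/2},\qquad x\in\mathbb{R}^d_+ ,$$ be the Laguerre functions of Hermite type. Put $\lambda_k^\beta=4|k|+2|\beta|+2d$, where $|k|=\sum_i k_i$ and $|\beta|=\sum_i\beta_i$; let $L_\beta^\varphi$ be the self-adjoint operator on $L^2(\mathbb{R}^d_+)$ with eigenfunctions $\varphi_k^\beta$ and eigenvalues $\lambda_k^\beta$, and let $$G_t^{\beta,\varphi}(x,y)=\sum_{k\in\mathbb{N}^d}e^{-t\lambda_k^\beta}\varphi_k^\beta(x)\varphi_k^\beta(y),\qquad t>0 .$$ Fix $j\in\{1,\dots,d\}$, let $e_j$ be the $j$th coordinate vector, and let $\alpha\in\mathbb{R}^d$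 satisfy $\alpha_j\ge-3/2$ and $\alpha_i\ge-1/2$ for $i\ne j$. On $L^2(\mathbb{R}^d_+)$ the modified semigroup is $$\exp\big(-t(L_{\alpha+e_j}^\varphi+2)\big)f=e^{-2t}\sum_{k\in\mathbb{N}^d}e^{-t\lambda_k^{\alpha+e_j}}\langle f,\varphi_k^{\alpha+e_j}\rangle\,\varphi_k^{\alpha+e_j},\qquad t\ge 0 .$$ Let $\widetilde T_0^{\alpha,\varphi,j}=\mathrm{Id}$ and $$\widetilde T_t^{\alpha,\varphi,j}f(x)=e^{-2t}\int_{\mathbb{R}^d_+}G_t^{\alpha+e_j,\varphi}(x,y)f(y)\,dy,\qquad t>0,\ x\in\mathbb{R}^d_+ .$$ For $t>0$ the series defining $G_t^{\alpha+e_j,\varphi}(x,y)$ and, for all $f\in L^1+L^\infty$, the integrals converge for all $x,y\in\mathbb{R}^d_+$, and $\widetilde T_t^{\alpha,\varphi,j}=\exp(-t(L_{\alpha+e_j}^\varphi+2))$ on $L^2(\mathbb{R}^d_+)$ for all $t\ge 0$. A symmetric diffusion semigroup is a family of linear operators $\{T_t\}_{t\ge0}$ from $L^1+L^\infty$ to measurable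 functions, with $T_0=\mathrm{Id}$, which are contractions and form a semigroup on each $L^p$, $1\le p\le\infty$, are self-adjoint on $L^2$, and satisfy $T_tf\to f$ in $L^2$ as $t\to0^+$ for $f\in L^2$. If in addition $T_tf\ge0$ whenever $f\ge 0$, it is called submarkovian if $T_t\mathbf 1\le\mathbf 1$ for all $t$, and Markovian if $T_t\mathbf 1=\mathbf 1$ for all $t$. A semigroup $\{S_t\}_{t\ge0}$ on $L^2$ is called $L^p$-contractive if $\|S_tf\|_p\le\|f\|_p$ for all $1\le p\le\infty$, $t\ge0$ and $f\in L^2\cap L^p$. (1) If $\alpha_j\in\{-3/2\}\cup[-1/2,\infty)$ and $\alpha_i\in\{-1/2\}\cup[1/2,\infty)$ for all $i\neq j$, then $\{\widetilde T_t^{\alpha,\varphi,j}\}$ is a submarkovian, but not Markovian, symmetric diffusion semigroup, and for all $1\le p\le\infty$ $$\|\widetilde T_t^{\alpha,\varphi,j}\|_{p\to p}\le e^{-2t}(\cosh 2t)^{-d/2},\qquad t>0 .$$ (2) If $\alpha_j\notin\{-3/2\}\cup[-1/2,\infty)$ or $\alpha_i\notin\{-1/2\}\cup[1/2,\infty)$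 for some $i\ne j$, then $\{\exp(-t(L_{\alpha+e_j}^\varphi+2))\}$ is not $L^p$-contractive, but there is a constant $c=c(\alpha)>1$ such that for all $1\le p\le\infty$ $$\|\widetilde T_t^{\alpha,\varphi,j}\|_{p\to p}\le c\,e^{-2t}(\cosh 2t)^{-d/2},\qquad t>0 .$$ -/

import Mathlib

open MeasureTheory Filter Topology Set
open scoped ENNReal ComplexOrder

noncomputable section

/-! ### Symmetric diffusion semigroups on a measure space

Operators act on functions `X → 𝕜`; all requirements are stated modulo almost everywhere equality.
The time parameter is real, and only `0 ≤ t` is used. -/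

section Diffusion

variable {X : Type*} [MeasurableSpace X] {𝕜 : Type*} [RCLike 𝕜]

/-- `f` belongs to `L¹ + L^∞`. -/
def MemL1AddLinfty (μ : Measure X) (f : X → 𝕜) : Prop :=
  ∃ g h : X → 𝕜, MemLp g 1 μ ∧ MemLp h ∞ μ ∧ f =ᵐ[μ] g + h

/-- A symmetric diffusion semigroup with domain `𝓓 = L¹ + L^∞` (which is `L¹` if `μ` is finite):
linear operators from `𝓓` to (classes of) measurable functions, with `T₀ = Id`, contractive and a
semigroup on each `L^p`, `1 ≤ p ≤ ∞`, self-adjoint on `L²`, and strongly continuous on `L²`. -/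
structure IsSymmetricDiffusionSemigroup (μ : Measure X) (T : ℝ → (X → 𝕜) → (X → 𝕜)) : Prop where
  congr_ae : ∀ t, 0 ≤ t → ∀ f g, MemL1AddLinfty μ f → f =ᵐ[μ] g → T t f =ᵐ[μ] T t g
  aestronglyMeasurable : ∀ t, 0 ≤ t → ∀ f, MemL1AddLinfty μ f → AEStronglyMeasurable (T t f) μ
  map_add : ∀ t, 0 ≤ t → ∀ f g, MemL1AddLinfty μ f → MemL1AddLinfty μ g →
    T t (f + g) =ᵐ[μ] T t f + T t g
  map_smul : ∀ t, 0 ≤ t → ∀ (c : 𝕜) (f), MemL1AddLinfty μ f → T t (c • f) =ᵐ[μ] c • T t f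
  map_zero_time : ∀ f, MemL1AddLinfty μ f → T 0 f =ᵐ[μ] f
  contraction : ∀ p : ℝ≥0∞, 1 ≤ p → ∀ t, 0 ≤ t → ∀ f, MemLp f p μ →
    eLpNorm (T t f) p μ ≤ eLpNorm f p μ
  semigroup : ∀ p : ℝ≥0∞, 1 ≤ p → ∀ s t, 0 ≤ s → 0 ≤ t → ∀ f, MemLp f p μ →
    T (s + t) f =ᵐ[μ] T s (T t f)
  selfAdjoint : ∀ t, 0 ≤ t → ∀ f g, MemLp f 2 μ → MemLp g 2 μ →
    ∫ x, inner 𝕜 (T t f x) (g x) ∂μ = ∫ x, inner 𝕜 (f x) (T t g x) ∂μ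
  continuous_zero : ∀ f, MemLp f 2 μ →
    Tendsto (fun t => eLpNorm (T t f - f) 2 μ) (𝓝[>] 0) (𝓝 0)

/-- Positive symmetric diffusion semigroup with `T_t 1 ≤ 1` for all `t`. -/
structure IsSubmarkovian (μ : Measure X) (T : ℝ → (X → 𝕜) → (X → 𝕜)) : Prop
    extends IsSymmetricDiffusionSemigroup μ T where
  positive : ∀ t, 0 ≤ t → ∀ f, MemL1AddLinfty μ f → (∀ᵐ x ∂μ, 0 ≤ f x) → ∀ᵐ x ∂μ, 0 ≤ T t f x
  map_one_le : ∀ t, 0 ≤ t → ∀ᵐ x ∂μ, T t (fun _ => 1) x ≤ 1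

/-- Positive symmetric diffusion semigroup with `T_t 1 = 1` for all `t`. -/
structure IsMarkovian (μ : Measure X) (T : ℝ → (X → 𝕜) → (X → 𝕜)) : Prop
    extends IsSymmetricDiffusionSemigroup μ T where
  positive : ∀ t, 0 ≤ t → ∀ f, MemL1AddLinfty μ f → (∀ᵐ x ∂μ, 0 ≤ f x) → ∀ᵐ x ∂μ, 0 ≤ T t f x
  map_one : ∀ t, 0 ≤ t → ∀ᵐ x ∂μ, T t (fun _ => 1) x = 1

/-- `L^p`-contractivity of a semigroup `S` of operators on `L²`: for every `1 ≤ p ≤ ∞` and every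
`t ≥ 0` one has `‖S_t f‖_p ≤ ‖f‖_p` for all `f ∈ L² ∩ L^p`. -/
def IsLpContractive (μ : Measure X) (S : ℝ → Lp 𝕜 2 μ → Lp 𝕜 2 μ) : Prop :=
  ∀ p : ℝ≥0∞, 1 ≤ p → ∀ t, 0 ≤ t → ∀ f : Lp 𝕜 2 μ, MemLp f p μ →
    eLpNorm (S t f) p μ ≤ eLpNorm f p μ

/-- The operator `A` maps `L^p` into `L^p` with `‖A‖_{p → p} ≤ C`. -/
def LpOpNormLE (μ : Measure X) (p : ℝ≥0∞) (A : (X → 𝕜) → (X → 𝕜)) (C : ℝ) : Prop :=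
  ∀ f, MemLp f p μ → MemLp (A f) p μ ∧ eLpNorm (A f) p μ ≤ ENNReal.ofReal C * eLpNorm f p μ

end Diffusion

/-! ### Laguerre functions of Hermite type -/

/-- The Laguerre polynomial `L_n^a(x)`, for `a > -1`. -/
def laguerrePoly (a : ℝ) (n : ℕ) (x : ℝ) : ℝ :=
  ∑ i ∈ Finset.range (n + 1),
    (-1) ^ i * Real.Gamma (n + a + 1) /
      (Real.Gamma (i + a + 1) * (n - i).factorial * i.factorial) * x ^ i

/-- The normalized Laguerre polynomial `(Γ(n+1) / Γ(n+a+1))^{1/2} L_n^a(x)`. -/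
def laguerrePolyNormalized (a : ℝ) (n : ℕ) (x : ℝ) : ℝ :=
  √(Real.Gamma (n + 1) / Real.Gamma (n + a + 1)) * laguerrePoly a n x

/-- The one-dimensional Laguerre function of Hermite type, for `x > 0`. -/
def hermiteFun₁ (a : ℝ) (n : ℕ) (x : ℝ) : ℝ :=
  √2 * laguerrePolyNormalized a n (x ^ 2) * x ^ (a + 1 / 2) * Real.exp (-x ^ 2 / 2)

variable {d : ℕ}

/-- The Laguerre function of Hermite type `φ_k^α(x) = ∏ φ_{k_i}^{α_i}(x_i)`. -/
def hermiteFun (α : Fin d → ℝ) (k : Fin d → ℕ) (x : Fin d → ℝ) : ℝ :=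
  ∏ i, hermiteFun₁ (α i) (k i) (x i)

/-- The open orthant `ℝ_+^d = (0, ∞)^d`. -/
def orthant (d : ℕ) : Set (Fin d → ℝ) := {x | ∀ i, 0 < x i}

/-- Lebesgue measure on `ℝ_+^d`. -/
def orthantMeasure (d : ℕ) : Measure (Fin d → ℝ) := volume.restrict (orthant d)

/-- The eigenvalue `4|k| + 2|α| + 2d` of the Hermite type Laguerre operator at `φ_k^α`. -/
def hermiteEigenvalue (α : Fin d → ℝ) (k : Fin d → ℕ) : ℝ :=
  4 * (∑ i, (k i : ℝ)) + 2 * (∑ i, α i) + 2 * d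

lemma memLp_hermiteFun₁ {a : ℝ} (ha : -1 < a) (n : ℕ) :
    MemLp (hermiteFun₁ a n) 2 (volume.restrict (Ioi 0)) := by
  have key : ∀ i : ℕ, MemLp (fun x : ℝ => (x ^ 2) ^ i * x ^ (a + 1 / 2) * Real.exp (-x ^ 2 / 2)) 2
      (volume.restrict (Ioi 0)) := by
    intro i
    rw [memLp_two_iff_integrable_sq (by fun_prop)]
    have h := integrableOn_rpow_mul_exp_neg_mul_sq (b := 1) one_pos (s := 4 * i + (2 * a + 1))
      (by have : (0 : ℝ) ≤ i := i.cast_nonneg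
          linarith)
    refine IntegrableOn.congr_fun h ?_ measurableSet_Ioi
    intro x hx
    have hx : 0 < x := hx
    have e0 : x ^ (4 * (i : ℝ)) = (x ^ 2) ^ i * (x ^ 2) ^ i := by
      rw [show (4 * (i : ℝ)) = ((4 * i : ℕ) : ℝ) by push_cast; ring, Real.rpow_natCast]
      ring
    have e1 : x ^ (4 * (i : ℝ) + (2 * a + 1)) = (x ^ 2) ^ i * (x ^ 2) ^ i *
        (x ^ (a + 1 / 2) * x ^ (a + 1 / 2)) := by
      rw [Real.rpow_add hx, e0, ← Real.rpow_add hx]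
      congr 2
      ring
    have e2 : Real.exp (-1 * x ^ 2) = Real.exp (-x ^ 2 / 2) * Real.exp (-x ^ 2 / 2) := by
      rw [← Real.exp_add]
      congr 1
      ring
    simp only [e1, e2]
    ring
  have hsum : hermiteFun₁ a n = fun x => ∑ i ∈ Finset.range (n + 1),
      (√2 * √(Real.Gamma (n + 1) / Real.Gamma (n + a + 1)) *
        ((-1) ^ i * Real.Gamma (n + a + 1) /
          (Real.Gamma (i + a + 1) * (n - i).factorial * i.factorial))) *
        ((x ^ 2) ^ i * x ^ (a + 1 / 2) * Real.exp (-x ^ 2 / 2)) := by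
    funext x
    simp only [hermiteFun₁, laguerrePolyNormalized, laguerrePoly, Finset.mul_sum, Finset.sum_mul]
    refine Finset.sum_congr rfl fun i _ => ?_
    ring
  rw [hsum]
  exact memLp_finsetSum _ fun i _ => (key i).const_mul _

lemma orthantMeasure_eq_pi (d : ℕ) :
    orthantMeasure d = Measure.pi fun _ : Fin d => volume.restrict (Ioi (0 : ℝ)) := by
  rw [← Measure.restrict_pi_pi]
  have : orthant d = univ.pi fun _ => Ioi (0 : ℝ) := by
    ext x
    simp [orthant]
  rw [orthantMeasure, this]
  rfl

lemma memLp_hermiteFun {α : Fin d → ℝ} (hα : ∀ i, -1 < α i) (k : Fin d → ℕ) :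
    MemLp (hermiteFun α k) 2 (orthantMeasure d) := by
  have hm : Measurable (hermiteFun α k) := by
    unfold hermiteFun hermiteFun₁ laguerrePolyNormalized laguerrePoly
    fun_prop
  rw [memLp_two_iff_integrable_sq hm.aestronglyMeasurable, orthantMeasure_eq_pi]
  have := Integrable.fintype_prod (μ := fun _ : Fin d => volume.restrict (Ioi (0 : ℝ)))
    (f := fun i x => hermiteFun₁ (α i) (k i) x ^ 2)
    fun i => (memLp_hermiteFun₁ (hα i) (k i)).integrable_sq
  simpa only [hermiteFun, Finset.prod_pow] using this

variable (𝕜 : Type*) [RCLike 𝕜]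

lemma memLp_ofReal_hermiteFun {α : Fin d → ℝ} (hα : ∀ i, -1 < α i) (k : Fin d → ℕ) :
    MemLp (fun x => (hermiteFun α k x : 𝕜)) 2 (orthantMeasure d) :=
  (memLp_hermiteFun hα k).ofReal

open Classical in
/-- The function `φ_k^α` as an element of `L²(ℝ_+^d)`. By `memLp_ofReal_hermiteFun` the first branch
applies whenever `α ∈ (-1, ∞)^d`. -/
def hermiteVec (α : Fin d → ℝ) (k : Fin d → ℕ) : Lp 𝕜 2 (orthantMeasure d) :=
  if h : MemLp (fun x => (hermiteFun α k x : 𝕜)) 2 (orthantMeasure d) then h.toLp else 0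

variable {𝕜}

/-- The heat semigroup `exp(-t L_α^φ)` on `L²(ℝ_+^d)`, `α ∈ (-1, ∞)^d`, where `L_α^φ` is the
self-adjoint operator with spectral decomposition given by the orthonormal basis `φ_k^α` and the
eigenvalues `4|k| + 2|α| + 2d`. -/
def hermiteHeat (α : Fin d → ℝ) (t : ℝ) (f : Lp 𝕜 2 (orthantMeasure d)) :
    Lp 𝕜 2 (orthantMeasure d) :=
  ∑' k : Fin d → ℕ, ((Real.exp (-t * hermiteEigenvalue α k) : 𝕜) *
    inner 𝕜 (hermiteVec 𝕜 α k) f) • hermiteVec 𝕜 α k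

/-- The `j`-th modified semigroup on `L²(ℝ_+^d)`, with generator `L_{α+e_j}^φ + 2`. -/
def modifiedHermiteHeat (α : Fin d → ℝ) (j : Fin d) (t : ℝ) (f : Lp 𝕜 2 (orthantMeasure d)) :
    Lp 𝕜 2 (orthantMeasure d) :=
  (Real.exp (-2 * t) : 𝕜) • hermiteHeat (α + Pi.single j 1) t f

/-- The term `e^{-t(4|k|+2|α|+2d)} φ_k^α(x) φ_k^α(y)` of the heat kernel. -/
def hermiteKernelTerm (α : Fin d → ℝ) (t : ℝ) (x y : Fin d → ℝ) (k : Fin d → ℕ) : ℝ :=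
  Real.exp (-t * hermiteEigenvalue α k) * (hermiteFun α k x * hermiteFun α k y)

/-- The heat kernel `G_t^{α,φ}(x, y)`, `t > 0`. -/
def hermiteKernel (α : Fin d → ℝ) (t : ℝ) (x y : Fin d → ℝ) : ℝ :=
  ∑' k, hermiteKernelTerm α t x y k

/-- The `j`-th modified semigroup acting on functions: the integral operators with kernels
`e^{-2t} G_t^{α+e_j,φ}(x, y)` for `t > 0`, and the identity for `t = 0`. -/
def modifiedHermiteSemigroup (α : Fin d → ℝ) (j : Fin d) (t : ℝ) (f : (Fin d → ℝ) → 𝕜)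
    (x : Fin d → ℝ) : 𝕜 :=
  if t = 0 then f x
  else (Real.exp (-2 * t) : 𝕜) *
    ∫ y, (hermiteKernel (α + Pi.single j 1) t x y : 𝕜) * f y ∂(orthantMeasure d)

/-- The admissible parameters: `α_j ≥ -3/2` and `α_i ≥ -1/2` for `i ≠ j`. -/
def hermiteAdmissible (j : Fin d) : Set (Fin d → ℝ) :=
  {α | -3 / 2 ≤ α j ∧ ∀ i, i ≠ j → -1 / 2 ≤ α i}

end

/-!
By the Hille–Hardy formula the heat kernel is a product of explicit positive one-dimensional
kernels. The integral over `y` of the kernel of order `β` at time `t` is at most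
`(cosh 2t) ^ (-1/2)` times `laguerreMass a w`, where `a = β / 2 + 1 / 4` and
`w = x ^ 2 / sinh (4 * t)`. For `a > 0` this mass is the integral of `(1 - s) ^ (a - 1 / 2)`,
`0 < s < 1`, against the Gamma density of shape `a` and rate `w`. The factor is at most `1` if
`a ≥ 1 / 2`, that is `β ≥ 1 / 2`; for `a = 0`, that is `β = -1 / 2`, the mass is `1`. If
`0 < a < 1 / 2`, the factor exceeds `1` and the density concentrates at `s = 0` as `w → ∞`, so
that the mass is bounded but larger than `1` for large `w`. Schur's test turns bounds for the
mass into bounds on every `L^p`, and conversely the indicator of a box on which the mass exceeds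
`1` violates contractivity on `L^1`. Such a box exists for small `t` because `w` is constant when
`x` scales like `√(sinh 4t)`, while the remaining factors tend to `1`. That the Laguerre functions
form a basis of `L²` identifies the integral operators with the spectrally defined semigroup.
-/

noncomputable section

variable {d : ℕ}

/-! ### Double series and power series -/

section DoubleSeries

variable {A M E : Type*} [AddMonoid A] [Finset.HasAntidiagonal A]

lemma hasSum_sum_antidiagonal [AddCommMonoid M] [TopologicalSpace M] [ContinuousAdd M]
    [RegularSpace M] {f : A × A → M} {s : M} (hf : HasSum f s) :
    HasSum (fun n => ∑ p ∈ Finset.HasAntidiagonal.antidiagonal n, f p) s := by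
  refine (Finset.HasAntidiagonal.sigmaAntidiagonalEquivProd.hasSum_iff.mpr hf).sigma fun n => ?_
  rw [← Finset.sum_coe_sort]
  exact hasSum_fintype _

lemma hasSum_sum_antidiagonal_iff [AddCommMonoid M] [TopologicalSpace M] [ContinuousAdd M]
    [T3Space M] {f : A × A → M} {g : A → M} {s : M} (hf : Summable f)
    (hg : ∀ i, HasSum (fun k => f (i, k)) (g i)) :
    HasSum (fun n => ∑ p ∈ Finset.HasAntidiagonal.antidiagonal n, f p) s ↔ HasSum g s := by
  have hfiber := hf.hasSum.prod_fiberwise hg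
  have hdiag := hasSum_sum_antidiagonal hf.hasSum
  exact ⟨fun h => h.unique hdiag ▸ hfiber, fun h => h.unique hfiber ▸ hdiag⟩

lemma summable_of_summable_sum_antidiagonal_norm [NormedAddCommGroup E] [CompleteSpace E]
    {f : A × A → E} (hf : Summable fun n => ∑ p ∈ Finset.HasAntidiagonal.antidiagonal n, ‖f p‖) :
    Summable f := by
  refine Summable.of_norm (Finset.HasAntidiagonal.sigmaAntidiagonalEquivProd.summable_iff.1
    ((summable_sigma_of_nonneg fun _ => norm_nonneg _).2
      ⟨fun n => (hasSum_fintype _).summable, ?_⟩))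
  convert! hf with n
  rw [tsum_fintype]
  exact Finset.sum_coe_sort (Finset.HasAntidiagonal.antidiagonal n) (fun p => ‖f p‖)

end DoubleSeries

lemma eq_of_hasSum_powerSeries {𝕜 : Type*} [NontriviallyNormedField 𝕜] {a b : ℕ → 𝕜} {f : 𝕜 → 𝕜}
    (ha : ∀ᶠ h in 𝓝 0, HasSum (fun n => a n * h ^ n) (f h))
    (hb : ∀ᶠ h in 𝓝 0, HasSum (fun n => b n * h ^ n) (f h)) : a = b := by
  have hasFPowerSeriesAt : ∀ c : ℕ → 𝕜, (∀ᶠ h in 𝓝 0, HasSum (fun n => c n * h ^ n) (f h)) →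
      HasFPowerSeriesAt f (FormalMultilinearSeries.ofScalars 𝕜 c) 0 := by
    intro c hc
    rw [hasFPowerSeriesAt_iff]
    filter_upwards [hc] with h hh
    simpa [FormalMultilinearSeries.coeff_ofScalars, mul_comm] using hh
  exact FormalMultilinearSeries.ofScalars_series_injective 𝕜 𝕜
    ((hasFPowerSeriesAt a ha).eq_formalMultilinearSeries (hasFPowerSeriesAt b hb))

lemma hasSum_pow_div_factorial (x : ℝ) :
    HasSum (fun i : ℕ => x ^ i / i.factorial) (Real.exp x) := by
  rw [Real.exp_eq_exp_ℝ]
  exact NormedSpace.expSeries_div_hasSum_exp x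

lemma Gamma_natCast_add_eq_ascPochhammer {c : ℝ} (hc : ∀ k : ℕ, c ≠ -k) (n : ℕ) :
    Real.Gamma (n + c) = (ascPochhammer ℝ n).eval c * Real.Gamma c := by
  induction n with
  | zero => simp
  | succ n ih =>
    have hne : (n : ℝ) + c ≠ 0 := fun h => hc n (by linarith)
    rw [ascPochhammer_succ_eval, Nat.cast_succ, add_right_comm, Real.Gamma_add_one hne, ih]
    ring

lemma hasSum_Gamma_binomial {c r : ℝ} (hc : ∀ k : ℕ, c ≠ -k) (hr : |r| < 1) :
    HasSum (fun k : ℕ => Real.Gamma (k + c) / (Real.Gamma c * k.factorial) * r ^ k)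
      ((1 - r) ^ (-c)) := by
  have h := (Real.one_div_one_sub_rpow_hasFPowerSeriesOnBall_zero c).hasSum (y := r)
    (by simpa [enorm_eq_nnnorm, ← NNReal.coe_lt_coe] using hr)
  rw [zero_add, one_div, ← Real.rpow_neg (by linarith [(abs_lt.1 hr).2])] at h
  convert! h using 2 with k
  have hchoose : (Ring.choose (c + k - 1) k : ℝ) * k.factorial = (ascPochhammer ℝ k).eval c := by
    have := Ring.factorial_nsmul_multichoose_eq_ascPochhammer c k
    rw [Polynomial.ascPochhammer_smeval_eq_eval] at this
    rw [← this, nsmul_eq_mul, Ring.choose, mul_comm]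
    congr 2
    ring
  rw [Gamma_natCast_add_eq_ascPochhammer hc, ← hchoose]
  have := Real.Gamma_ne_zero hc
  simp only [FormalMultilinearSeries.ofScalars_apply_eq, smul_eq_mul]
  field_simp

/-! ### The generating function of the Laguerre polynomials -/

lemma natCast_add_add_one_pos {β : ℝ} (hβ : -1 < β) (n : ℕ) : 0 < (n : ℝ) + β + 1 := by
  linarith [n.cast_nonneg (α := ℝ)]

lemma Gamma_natCast_add_add_one_pos {β : ℝ} (hβ : -1 < β) (n : ℕ) :
    0 < Real.Gamma (n + β + 1) :=
  Real.Gamma_pos_of_pos (natCast_add_add_one_pos hβ n)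

/-- The coefficient of `r ^ (i + k)` in the contribution of `x ^ i` to the generating function of
the Laguerre polynomials, so that `L_n^β(x)` is the sum of `laguerreTerm β x (i, k)` over
`i + k = n`. -/
def laguerreTerm (β x : ℝ) (p : ℕ × ℕ) : ℝ :=
  (-x) ^ p.1 / p.1.factorial *
    (Real.Gamma (p.2 + (p.1 + β + 1)) / (Real.Gamma (p.1 + β + 1) * p.2.factorial))

/-- The generating function `∑ L_n^β(x) r ^ n` of the Laguerre polynomials, in closed form. -/
def laguerreGenFun (β r x : ℝ) : ℝ := (1 - r) ^ (-(β + 1)) * Real.exp (-(x * r / (1 - r)))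

lemma laguerrePoly_eq_sum_antidiagonal (β x : ℝ) (n : ℕ) :
    laguerrePoly β n x = ∑ p ∈ Finset.HasAntidiagonal.antidiagonal n, laguerreTerm β x p := by
  rw [laguerrePoly, Finset.Nat.sum_antidiagonal_eq_sum_range_succ_mk]
  refine Finset.sum_congr rfl fun i hi => ?_
  have hi : i ≤ n := Nat.lt_succ_iff.1 (Finset.mem_range.1 hi)
  rw [laguerreTerm, neg_pow x]
  push_cast [Nat.cast_sub hi]
  rw [show (n : ℝ) - i + (i + β + 1) = n + β + 1 by ring]
  ring

lemma laguerreTerm_neg_nonneg {β x : ℝ} (hβ : -1 < β) (hx : 0 ≤ x) (p : ℕ × ℕ) :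
    0 ≤ laguerreTerm β (-x) p := by
  have := natCast_add_add_one_pos hβ p.1
  have := Gamma_natCast_add_add_one_pos hβ p.1
  have := Real.Gamma_pos_of_pos (by positivity : 0 < (p.2 : ℝ) + (p.1 + β + 1))
  rw [laguerreTerm, neg_neg]
  positivity

lemma abs_laguerreTerm {β : ℝ} (hβ : -1 < β) (x : ℝ) (p : ℕ × ℕ) :
    |laguerreTerm β x p| = laguerreTerm β (-|x|) p := by
  rw [← abs_of_nonneg (laguerreTerm_neg_nonneg hβ (abs_nonneg x) p)]
  simp only [laguerreTerm, abs_mul, abs_div, abs_pow, abs_neg, abs_abs]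

lemma laguerrePoly_neg_nonneg {β x : ℝ} (hβ : -1 < β) (hx : 0 ≤ x) (n : ℕ) :
    0 ≤ laguerrePoly β n (-x) := by
  rw [laguerrePoly_eq_sum_antidiagonal]
  exact Finset.sum_nonneg fun p _ => laguerreTerm_neg_nonneg hβ hx p

lemma abs_laguerrePoly_le {β : ℝ} (hβ : -1 < β) (x : ℝ) (n : ℕ) :
    |laguerrePoly β n x| ≤ laguerrePoly β n (-|x|) := by
  simp only [laguerrePoly_eq_sum_antidiagonal, ← abs_laguerreTerm hβ]
  exact Finset.abs_sum_le_sum_abs _ _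

lemma hasSum_laguerreTerm_mul_pow {β r : ℝ} (hβ : -1 < β) (x : ℝ) (hr : |r| < 1) (i : ℕ) :
    HasSum (fun k => laguerreTerm β x (i, k) * r ^ (i + k))
      ((1 - r) ^ (-(β + 1)) * ((-(x * r / (1 - r))) ^ i / i.factorial)) := by
  have := natCast_add_add_one_pos hβ i
  have hr1 : 0 < 1 - r := by linarith [(abs_lt.1 hr).2]
  have hne : ∀ k : ℕ, (i : ℝ) + β + 1 ≠ -k := fun k => by linarith [k.cast_nonneg (α := ℝ)]
  convert! (hasSum_Gamma_binomial hne hr).mul_left ((-x) ^ i / i.factorial * r ^ i) using 1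
  · funext k
    simp only [laguerreTerm, pow_add]
    ring
  · rw [show -((i : ℝ) + β + 1) = -(β + 1) - i by ring, Real.rpow_sub hr1, Real.rpow_natCast,
      show -(x * r / (1 - r)) = (-x) * r / (1 - r) by ring, div_pow, mul_pow]
    ring

lemma summable_laguerreTerm_mul_pow {β r : ℝ} (hβ : -1 < β) (x : ℝ) (hr : |r| < 1) :
    Summable fun p : ℕ × ℕ => laguerreTerm β x p * r ^ (p.1 + p.2) := by
  have hr' : |(|r|)| < 1 := by rwa [abs_abs]
  rw [← summable_abs_iff]
  simp only [abs_mul, abs_laguerreTerm hβ, abs_pow]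
  rw [summable_prod_of_nonneg fun p =>
    mul_nonneg (laguerreTerm_neg_nonneg hβ (abs_nonneg x) p) (pow_nonneg (abs_nonneg r) _)]
  refine ⟨fun i => (hasSum_laguerreTerm_mul_pow hβ _ hr' i).summable, ?_⟩
  simp_rw [(hasSum_laguerreTerm_mul_pow hβ _ hr' _).tsum_eq]
  exact (hasSum_pow_div_factorial _).summable.mul_left _

lemma hasSum_laguerrePoly_mul_pow {β r : ℝ} (hβ : -1 < β) (x : ℝ) (hr : |r| < 1) :
    HasSum (fun n => laguerrePoly β n x * r ^ n) (laguerreGenFun β r x) := by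
  rw [laguerreGenFun]
  convert! (hasSum_sum_antidiagonal_iff (summable_laguerreTerm_mul_pow hβ x hr)
    (hasSum_laguerreTerm_mul_pow hβ x hr)).2 ((hasSum_pow_div_factorial _).mul_left _) using 2
    with n
  rw [laguerrePoly_eq_sum_antidiagonal, Finset.sum_mul]
  exact Finset.sum_congr rfl fun p hp => by rw [Finset.HasAntidiagonal.mem_antidiagonal.1 hp]

/-! ### Sequences of subexponential growth -/

/-- The sequence `a` grows more slowly than any exponential. This is the form in which bounds on
Laguerre functions of fixed argument enter the convergence proofs. -/
def IsSubexp (a : ℕ → ℝ) : Prop := ∀ ρ : ℝ, 0 < ρ → ρ < 1 → Summable fun n => |a n| * ρ ^ n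

namespace IsSubexp

variable {a b : ℕ → ℝ}

lemma mul (ha : IsSubexp a) (hb : IsSubexp b) : IsSubexp fun n => a n * b n := by
  intro ρ h0 h1
  have hsqrt0 : 0 < √ρ := Real.sqrt_pos.2 h0
  have hsqrt1 : √ρ < 1 := by rw [Real.sqrt_lt' one_pos]; simpa using h1
  obtain ⟨C, hC⟩ := (ha _ hsqrt0 hsqrt1).tendsto_atTop_zero.bddAbove_range
  refine ((hb _ hsqrt0 hsqrt1).mul_left C).of_nonneg_of_le (fun n => by positivity) fun n => ?_
  calc |a n * b n| * ρ ^ n = (|a n| * √ρ ^ n) * (|b n| * √ρ ^ n) := by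
        rw [abs_mul, ← Real.mul_self_sqrt h0.le, mul_pow, Real.sqrt_mul_self hsqrt0.le]
        ring
    _ ≤ C * (|b n| * √ρ ^ n) := by gcongr; exact hC ⟨n, rfl⟩

lemma mono (ha : IsSubexp a) (h : ∀ n, |b n| ≤ |a n|) : IsSubexp b := fun ρ h0 h1 =>
  (ha ρ h0 h1).of_nonneg_of_le (fun n => by positivity) fun n =>
    mul_le_mul_of_nonneg_right (h n) (by positivity)

lemma const_mul (c : ℝ) (ha : IsSubexp a) : IsSubexp fun n => c * a n := by
  intro ρ h0 h1
  simpa only [abs_mul, mul_assoc] using (ha ρ h0 h1).mul_left |c|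

protected lemma one : IsSubexp fun _ => 1 := by
  intro ρ h0 h1
  simpa using summable_geometric_of_lt_one h0.le h1

lemma sqrt (ha : IsSubexp a) : IsSubexp fun n => √(a n) := by
  intro ρ h0 h1
  refine ((IsSubexp.one ρ h0 h1).add (ha ρ h0 h1)).of_nonneg_of_le (fun n => by positivity)
    fun n => ?_
  rw [← add_mul, abs_of_nonneg (Real.sqrt_nonneg _), abs_one]
  gcongr
  exact Real.sqrt_le_iff.2 ⟨by positivity, by nlinarith [abs_nonneg (a n), le_abs_self (a n)]⟩

lemma of_tendsto_ratio (ha : ∀ n, 0 < a n)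
    (h : Tendsto (fun n => a (n + 1) / a n) atTop (𝓝 1)) : IsSubexp a := by
  intro ρ h0 h1
  refine summable_of_ratio_test_tendsto_lt_one h1
    (Eventually.of_forall fun n => by have := ha n; positivity) ?_
  convert! h.mul_const ρ using 2 with n
  · have := ha n
    have := ha (n + 1)
    rw [Real.norm_of_nonneg (by positivity), Real.norm_of_nonneg (by positivity),
      abs_of_pos (ha n), abs_of_pos (ha (n + 1)), pow_succ]
    field_simp
  · rw [one_mul]

end IsSubexp

/-- The weight `Γ(n + 1) / Γ(n + β + 1)`, the square of the normalizing factor of `L_n^β`. -/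
def laguerreWeight (β : ℝ) (n : ℕ) : ℝ := Real.Gamma (n + 1) / Real.Gamma (n + β + 1)

lemma laguerreWeight_pos {β : ℝ} (hβ : -1 < β) (n : ℕ) : 0 < laguerreWeight β n :=
  div_pos (Real.Gamma_pos_of_pos (by positivity)) (Gamma_natCast_add_add_one_pos hβ n)

lemma laguerreWeight_succ_div {β : ℝ} (hβ : -1 < β) (n : ℕ) :
    laguerreWeight β (n + 1) / laguerreWeight β n = (n + 1) / (n + β + 1) := by
  have hpos := natCast_add_add_one_pos hβ n
  have := Gamma_natCast_add_add_one_pos hβ n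
  have := Real.Gamma_pos_of_pos (by positivity : (0 : ℝ) < n + 1)
  simp only [laguerreWeight, Nat.cast_succ]
  rw [Real.Gamma_add_one (by positivity : (n : ℝ) + 1 ≠ 0),
    show (n : ℝ) + 1 + β + 1 = (n + β + 1) + 1 by ring, Real.Gamma_add_one hpos.ne']
  field_simp

lemma tendsto_laguerreWeight_succ_div {β : ℝ} (hβ : -1 < β) :
    Tendsto (fun n => laguerreWeight β (n + 1) / laguerreWeight β n) atTop (𝓝 1) := by
  have h := tendsto_add_mul_div_add_mul_atTop_nhds (1 : ℝ) (β + 1) 1 one_ne_zero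
  simp only [one_mul, div_one] at h
  refine h.congr fun n => ?_
  rw [laguerreWeight_succ_div hβ]
  ring_nf

lemma isSubexp_laguerreWeight {β : ℝ} (hβ : -1 < β) : IsSubexp (laguerreWeight β) :=
  .of_tendsto_ratio (laguerreWeight_pos hβ) (tendsto_laguerreWeight_succ_div hβ)

lemma isSubexp_inv_laguerreWeight {β : ℝ} (hβ : -1 < β) :
    IsSubexp fun n => (laguerreWeight β n)⁻¹ := by
  refine .of_tendsto_ratio (fun n => inv_pos.2 (laguerreWeight_pos hβ n)) ?_
  simpa only [inv_one, inv_div_inv, inv_div] using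
    (tendsto_laguerreWeight_succ_div hβ).inv₀ one_ne_zero

lemma isSubexp_laguerrePoly {β : ℝ} (hβ : -1 < β) (x : ℝ) :
    IsSubexp fun n => laguerrePoly β n x := by
  refine IsSubexp.mono (a := fun n => laguerrePoly β n (-|x|)) (fun ρ h0 h1 => ?_) fun n =>
    (abs_laguerrePoly_le hβ x n).trans (le_abs_self _)
  simp_rw [abs_of_nonneg (laguerrePoly_neg_nonneg hβ (abs_nonneg x) _)]
  exact (hasSum_laguerrePoly_mul_pow hβ _ (by rwa [abs_of_pos h0])).summable

lemma isSubexp_hermiteFun₁ {β : ℝ} (hβ : -1 < β) (x : ℝ) :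
    IsSubexp fun n => hermiteFun₁ β n x := by
  convert! ((isSubexp_laguerreWeight hβ).sqrt.mul (isSubexp_laguerrePoly hβ (x ^ 2))).const_mul
    (√2 * x ^ (β + 1 / 2) * Real.exp (-x ^ 2 / 2)) using 2 with n
  simp only [hermiteFun₁, laguerrePolyNormalized, laguerreWeight]
  ring

/-! ### The Hille–Hardy formula -/

/-- The entire function `∑ v ^ m / (m! Γ(m + β + 1))`, a normalized modified Bessel function:
`I_β(z) = (z / 2) ^ β * besselSeries β (z ^ 2 / 4)`. -/
def besselSeries (β v : ℝ) : ℝ := ∑' m : ℕ, v ^ m / (m.factorial * Real.Gamma (m + β + 1))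

lemma summable_pow_div_Gamma {β : ℝ} (hβ : -1 < β) (v : ℝ) :
    Summable fun m : ℕ => v ^ m / Real.Gamma (m + β + 1) := by
  obtain ⟨C, hC⟩ := (isSubexp_laguerreWeight hβ (1 / 2) (by norm_num)
    (by norm_num)).tendsto_atTop_zero.bddAbove_range
  refine .of_norm_bounded ((hasSum_pow_div_factorial (2 * |v|)).summable.mul_left C) fun n => ?_
  have hweight : laguerreWeight β n * (1 / 2) ^ n ≤ C := by
    simpa only [abs_of_pos (laguerreWeight_pos hβ n)] using hC ⟨n, rfl⟩
  have hGamma := Gamma_natCast_add_add_one_pos hβ n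
  calc ‖v ^ n / Real.Gamma (n + β + 1)‖
      = laguerreWeight β n * (1 / 2) ^ n * ((2 * |v|) ^ n / n.factorial) := by
        rw [Real.norm_eq_abs, abs_div, abs_pow, abs_of_pos hGamma, laguerreWeight,
          Real.Gamma_nat_eq_factorial, mul_pow, div_pow, one_pow]
        field_simp
    _ ≤ C * ((2 * |v|) ^ n / n.factorial) := by gcongr

lemma summable_besselSeries {β : ℝ} (hβ : -1 < β) (v : ℝ) :
    Summable fun m : ℕ => v ^ m / (m.factorial * Real.Gamma (m + β + 1)) := by
  refine .of_norm_bounded (summable_pow_div_Gamma hβ v).norm fun n => ?_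
  have hGamma := Gamma_natCast_add_add_one_pos hβ n
  have hfact : (1 : ℝ) ≤ n.factorial := by exact_mod_cast n.factorial_pos
  rw [norm_div, norm_div, norm_mul, Real.norm_natCast, Real.norm_of_nonneg hGamma.le]
  gcongr
  exact le_mul_of_one_le_left hGamma.le hfact

lemma pow_div_Gamma_mul_laguerreTerm {β : ℝ} (hβ : -1 < β) (ξ z : ℝ) (m k : ℕ) :
    (-ξ) ^ (m + k) / Real.Gamma ((m + k : ℕ) + β + 1) * laguerreTerm β z (m, k) =
      (ξ * z) ^ m / (m.factorial * Real.Gamma (m + β + 1)) * ((-ξ) ^ k / k.factorial) := by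
  have := (Gamma_natCast_add_add_one_pos hβ m).ne'
  have hmk := (Gamma_natCast_add_add_one_pos hβ (m + k)).ne'
  rw [laguerreTerm, show (k : ℝ) + (m + β + 1) = (m + k : ℕ) + β + 1 by push_cast; ring, pow_add,
    show (ξ * z) ^ m = (-ξ) ^ m * (-z) ^ m by rw [← mul_pow, neg_mul_neg]]
  field_simp

lemma hasSum_laguerrePoly_div_Gamma {β : ℝ} (hβ : -1 < β) (ξ z : ℝ) :
    HasSum (fun n : ℕ => (-ξ) ^ n / Real.Gamma (n + β + 1) * laguerrePoly β n z)
      (besselSeries β (ξ * z) * Real.exp (-ξ)) := by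
  have hbessel : HasSum _ (besselSeries β (ξ * z)) := (summable_besselSeries hβ (ξ * z)).hasSum
  have hexp := hasSum_pow_div_factorial (-ξ)
  convert! hasSum_sum_antidiagonal (hbessel.mul hexp
    (summable_mul_of_summable_norm hbessel.summable.norm hexp.summable.norm)) using 2 with n
  rw [laguerrePoly_eq_sum_antidiagonal, Finset.mul_sum]
  refine Finset.sum_congr rfl fun p hp => ?_
  rw [← Finset.HasAntidiagonal.mem_antidiagonal.1 hp]
  exact pow_div_Gamma_mul_laguerreTerm hβ ξ z p.1 p.2

lemma laguerreGenFun_add (β y : ℝ) {r h : ℝ} (hr : r < 1) (hrh : h + r < 1) :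
    laguerreGenFun β (h + r) y =
      laguerreGenFun β r y * laguerreGenFun β (h / (1 - r)) (y / (1 - r)) := by
  have hr : 0 < 1 - r := by linarith
  have hrh : 0 < 1 - (h + r) := by linarith
  have hbase : 1 - h / (1 - r) = (1 - (h + r)) / (1 - r) := by field_simp; ring
  have hexp : -(y * (h + r) / (1 - (h + r))) = -(y * r / (1 - r)) +
      -(y / (1 - r) * (h / (1 - r)) / (1 - h / (1 - r))) := by
    rw [hbase]
    field_simp
    ring
  rw [laguerreGenFun, laguerreGenFun, laguerreGenFun, hexp, Real.exp_add, mul_mul_mul_comm,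
    ← Real.mul_rpow hr.le (by rw [hbase]; positivity), hbase, mul_div_cancel₀ _ hr.ne']

/-- The coefficient of `h ^ p.1` in the term of index `n = p.1 + p.2` of the expansion
`∑ L_n^β(y) (h + r) ^ n` of the generating function at `h + r`. -/
def laguerreTaylorTerm (β r y : ℝ) (p : ℕ × ℕ) : ℝ :=
  (p.1 + p.2).choose p.1 * r ^ p.2 * laguerrePoly β (p.1 + p.2) y

lemma sum_antidiagonal_laguerreTaylorTerm_mul_pow (β r y h : ℝ) (n : ℕ) :
    ∑ p ∈ Finset.HasAntidiagonal.antidiagonal n, laguerreTaylorTerm β r y p * h ^ p.1 =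
      laguerrePoly β n y * (h + r) ^ n := by
  rw [(Commute.all h r).add_pow' n, Finset.mul_sum]
  refine Finset.sum_congr rfl fun p hp => ?_
  rw [laguerreTaylorTerm, Finset.HasAntidiagonal.mem_antidiagonal.1 hp, nsmul_eq_mul]
  ring

section Taylor

variable {β r : ℝ} (hβ : -1 < β) (hr : |r| < 1) (y : ℝ)

include hβ

lemma abs_laguerreTaylorTerm_le (p : ℕ × ℕ) :
    |laguerreTaylorTerm β r y p| ≤ laguerreTaylorTerm β |r| (-|y|) p := by
  rw [laguerreTaylorTerm, laguerreTaylorTerm, abs_mul, abs_mul, Nat.abs_cast, abs_pow]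
  gcongr
  exact abs_laguerrePoly_le hβ y _

lemma summable_laguerreTaylorTerm_mul_pow {h : ℝ} (hh : |h| + |r| < 1) :
    Summable fun p : ℕ × ℕ => laguerreTaylorTerm β r y p * h ^ p.1 := by
  refine summable_of_summable_sum_antidiagonal_norm <|
    (hasSum_laguerrePoly_mul_pow hβ (-|y|) (r := |h| + |r|)
      (by rwa [abs_of_nonneg (by positivity)])).summable.of_nonneg_of_le
    (fun n => Finset.sum_nonneg fun _ _ => norm_nonneg _) fun n => ?_
  rw [← sum_antidiagonal_laguerreTaylorTerm_mul_pow]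
  refine Finset.sum_le_sum fun p _ => ?_
  rw [norm_mul, norm_pow, Real.norm_eq_abs, Real.norm_eq_abs]
  gcongr
  exact abs_laguerreTaylorTerm_le hβ y p

include hr

lemma summable_laguerreTaylorTerm (i : ℕ) :
    Summable fun k => laguerreTaylorTerm β r y (i, k) := by
  have hpos : 0 < (1 - |r|) / 2 := by linarith
  have hsum : Summable fun k => laguerreTaylorTerm β r y (i, k) * ((1 - |r|) / 2) ^ i :=
    (summable_laguerreTaylorTerm_mul_pow hβ y (by rw [abs_of_pos hpos]; linarith)).prod_factor i
  exact (summable_mul_right_iff (pow_pos hpos i).ne').1 hsum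

lemma hasSum_laguerreTaylorTerm (i : ℕ) :
    HasSum (fun k => laguerreTaylorTerm β r y (i, k))
      (laguerreGenFun β r y * (laguerrePoly β i (y / (1 - r)) / (1 - r) ^ i)) := by
  have hr1 : 0 < 1 - r := by linarith [(abs_lt.1 hr).2]
  have hsmall : ∀ᶠ h in 𝓝 (0 : ℝ), |h| + |r| < 1 := by
    have hcont : Continuous fun h : ℝ => |h| + |r| := by fun_prop
    exact hcont.continuousAt.eventually_lt_const (by simpa using hr)
  have hcoeff : (fun i => ∑' k, laguerreTaylorTerm β r y (i, k)) = fun i =>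
      laguerreGenFun β r y * (laguerrePoly β i (y / (1 - r)) / (1 - r) ^ i) := by
    refine eq_of_hasSum_powerSeries (f := fun h => laguerreGenFun β (h + r) y) ?_ ?_ <;>
      filter_upwards [hsmall] with h hh
    · have hexpand := hasSum_laguerrePoly_mul_pow hβ y ((abs_add_le h r).trans_lt hh)
      simp only [← sum_antidiagonal_laguerreTaylorTerm_mul_pow] at hexpand
      exact (hasSum_sum_antidiagonal_iff (summable_laguerreTaylorTerm_mul_pow hβ y hh) fun i =>
        (summable_laguerreTaylorTerm hβ hr y i).hasSum.mul_right (h ^ i)).1 hexpand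
    · have hh' : |h / (1 - r)| < 1 := by
        rw [abs_div, abs_of_pos hr1, div_lt_one hr1]
        linarith [le_abs_self r]
      rw [laguerreGenFun_add β y (by linarith) (by linarith [le_abs_self r, le_abs_self h])]
      convert! (hasSum_laguerrePoly_mul_pow hβ (y / (1 - r)) hh').mul_left
        (laguerreGenFun β r y) using 2 with n
      rw [div_pow]
      ring
  rw [← congrFun hcoeff i]
  exact (summable_laguerreTaylorTerm hβ hr y i).hasSum

end Taylor

section HilleHardy

variable {β : ℝ} (hβ : -1 < β) (x y : ℝ)

include hβ

lemma laguerreTaylorTerm_mul_pow_div_Gamma (r : ℝ) (p : ℕ × ℕ) :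
    (-(r * x)) ^ p.1 / Real.Gamma (p.1 + β + 1) * laguerreTaylorTerm β r y p =
      r ^ (p.1 + p.2) * laguerreWeight β (p.1 + p.2) * laguerrePoly β (p.1 + p.2) y *
        laguerreTerm β x p := by
  have := (Gamma_natCast_add_add_one_pos hβ p.1).ne'
  have := (Gamma_natCast_add_add_one_pos hβ (p.1 + p.2)).ne'
  rw [laguerreTaylorTerm, laguerreTerm, laguerreWeight, Real.Gamma_nat_eq_factorial,
    show (p.2 : ℝ) + (p.1 + β + 1) = (p.1 + p.2 : ℕ) + β + 1 by push_cast; ring,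
    ← Nat.add_choose_mul_factorial_mul_factorial, Nat.choose_symm_add,
    pow_add, neg_pow, mul_pow, neg_pow x]
  push_cast at *
  field_simp

lemma summable_hilleHardy_terms {r : ℝ} (h0 : 0 < r) (h1 : r < 1) :
    Summable fun p : ℕ × ℕ =>
      (-(r * x)) ^ p.1 / Real.Gamma (p.1 + β + 1) * laguerreTaylorTerm β r y p := by
  have hsubexp := ((isSubexp_laguerrePoly hβ (-|x|)).mul (isSubexp_laguerrePoly hβ y)).mul
    (isSubexp_laguerreWeight hβ)
  refine summable_of_summable_sum_antidiagonal_norm ((hsubexp r h0 h1).congr fun n => ?_)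
  have hx := laguerrePoly_neg_nonneg hβ (abs_nonneg x) n
  rw [abs_mul, abs_mul, abs_of_nonneg hx, laguerrePoly_eq_sum_antidiagonal β (-|x|),
    Finset.sum_mul, Finset.sum_mul, Finset.sum_mul]
  refine Finset.sum_congr rfl fun p hp => ?_
  rw [laguerreTaylorTerm_mul_pow_div_Gamma hβ, Finset.HasAntidiagonal.mem_antidiagonal.1 hp,
    Real.norm_eq_abs, abs_mul, abs_mul, abs_mul, abs_laguerreTerm hβ, abs_of_pos (pow_pos h0 n)]
  ring

theorem hasSum_hilleHardy {r : ℝ} (h0 : 0 < r) (h1 : r < 1) :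
    HasSum (fun n => r ^ n * laguerreWeight β n * (laguerrePoly β n x * laguerrePoly β n y))
      ((1 - r) ^ (-(β + 1)) * Real.exp (-(r * (x + y) / (1 - r))) *
        besselSeries β (x * y * r / (1 - r) ^ 2)) := by
  have hr : 0 < 1 - r := by linarith
  have hrows := fun i => (hasSum_laguerreTaylorTerm hβ (by rwa [abs_of_pos h0]) y i).mul_left
    ((-(r * x)) ^ i / Real.Gamma (i + β + 1))
  have hcolumn : HasSum (fun i : ℕ => (-(r * x)) ^ i / Real.Gamma (i + β + 1) *
      (laguerreGenFun β r y * (laguerrePoly β i (y / (1 - r)) / (1 - r) ^ i)))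
      (laguerreGenFun β r y *
        (besselSeries β (r * x / (1 - r) * (y / (1 - r))) * Real.exp (-(r * x / (1 - r))))) := by
    convert! (hasSum_laguerrePoly_div_Gamma hβ (r * x / (1 - r)) (y / (1 - r))).mul_left
      (laguerreGenFun β r y) using 2 with i
    rw [← neg_div, div_pow]
    ring
  convert! (hasSum_sum_antidiagonal_iff (summable_hilleHardy_terms hβ x y h0 h1) hrows).2 hcolumn
    using 1
  · funext n
    rw [mul_comm (laguerrePoly β n x), ← mul_assoc, laguerrePoly_eq_sum_antidiagonal β x,
      Finset.mul_sum]
    refine Finset.sum_congr rfl fun p hp => ?_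
    rw [laguerreTaylorTerm_mul_pow_div_Gamma hβ, Finset.HasAntidiagonal.mem_antidiagonal.1 hp]
  · rw [laguerreGenFun, show -(r * (x + y) / (1 - r)) = -(y * r / (1 - r)) + -(r * x / (1 - r)) by
        ring, Real.exp_add, show x * y * r / (1 - r) ^ 2 = r * x / (1 - r) * (y / (1 - r)) by
        field_simp]
    ring

end HilleHardy

/-! ### The one-dimensional heat kernel -/

/-- The heat kernel of the one-dimensional Hermite type Laguerre operator, in the closed form that
the Hille–Hardy formula yields for the series over the eigenfunctions `hermiteFun₁ β n`. -/
def laguerreKernel₁ (β t x y : ℝ) : ℝ :=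
  2 * (2 * Real.sinh (2 * t)) ^ (-(β + 1)) * (x ^ (β + 1 / 2) * y ^ (β + 1 / 2)) *
    Real.exp (-(Real.cosh (2 * t) / (2 * Real.sinh (2 * t)) * (x ^ 2 + y ^ 2))) *
    besselSeries β ((x * y / (2 * Real.sinh (2 * t))) ^ 2)

lemma sinh_two_mul_pos {t : ℝ} (ht : 0 < t) : 0 < Real.sinh (2 * t) :=
  Real.sinh_pos_iff.2 (by linarith)

lemma one_sub_exp_neg_sq (s : ℝ) : 1 - Real.exp (-s) ^ 2 = Real.exp (-s) * (2 * Real.sinh s) := by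
  have hinv : Real.exp (-s) * Real.exp s = 1 := by rw [← Real.exp_add]; simp
  rw [Real.sinh_eq]
  linear_combination -hinv

lemma hermiteFun₁_mul {β : ℝ} (hβ : -1 < β) (n : ℕ) (x y : ℝ) :
    hermiteFun₁ β n x * hermiteFun₁ β n y =
      2 * (x ^ (β + 1 / 2) * y ^ (β + 1 / 2)) * Real.exp (-((x ^ 2 + y ^ 2) / 2)) *
        (laguerreWeight β n * (laguerrePoly β n (x ^ 2) * laguerrePoly β n (y ^ 2))) := by
  calc hermiteFun₁ β n x * hermiteFun₁ β n y
      = √2 ^ 2 * (x ^ (β + 1 / 2) * y ^ (β + 1 / 2)) *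
        (Real.exp (-x ^ 2 / 2) * Real.exp (-y ^ 2 / 2)) * (√(laguerreWeight β n) ^ 2 *
          (laguerrePoly β n (x ^ 2) * laguerrePoly β n (y ^ 2))) := by
        simp only [hermiteFun₁, laguerrePolyNormalized, laguerreWeight]
        ring
    _ = 2 * (x ^ (β + 1 / 2) * y ^ (β + 1 / 2)) * Real.exp (-((x ^ 2 + y ^ 2) / 2)) *
        (laguerreWeight β n * (laguerrePoly β n (x ^ 2) * laguerrePoly β n (y ^ 2))) := by
        rw [Real.sq_sqrt zero_le_two, Real.sq_sqrt (laguerreWeight_pos hβ n).le, ← Real.exp_add]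
        ring_nf

lemma laguerreKernel₁_eq_hilleHardy {t : ℝ} (ht : 0 < t) (β x y : ℝ) {r : ℝ}
    (hr : r = Real.exp (-(2 * t)) ^ 2) :
    laguerreKernel₁ β t x y =
      Real.exp (-(2 * t)) ^ (β + 1) *
        (2 * (x ^ (β + 1 / 2) * y ^ (β + 1 / 2)) * Real.exp (-((x ^ 2 + y ^ 2) / 2))) *
        ((1 - r) ^ (-(β + 1)) * Real.exp (-(r * (x ^ 2 + y ^ 2) / (1 - r))) *
          besselSeries β (x ^ 2 * y ^ 2 * r / (1 - r) ^ 2)) := by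
  have := sinh_two_mul_pos ht
  have hexp := Real.exp_pos (-(2 * t))
  have hgauss : -(Real.cosh (2 * t) / (2 * Real.sinh (2 * t)) * (x ^ 2 + y ^ 2)) =
      -((x ^ 2 + y ^ 2) / 2) + -(r * (x ^ 2 + y ^ 2) / (1 - r)) := by
    rw [hr, one_sub_exp_neg_sq]
    field_simp
    linear_combination -(x ^ 2 + y ^ 2) * Real.cosh_sub_sinh (2 * t)
  have hbessel : (x * y / (2 * Real.sinh (2 * t))) ^ 2 = x ^ 2 * y ^ 2 * r / (1 - r) ^ 2 := by
    rw [hr, one_sub_exp_neg_sq]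
    field_simp
  have hpow : (2 * Real.sinh (2 * t)) ^ (-(β + 1)) =
      Real.exp (-(2 * t)) ^ (β + 1) * (1 - r) ^ (-(β + 1)) := by
    rw [hr, one_sub_exp_neg_sq, Real.mul_rpow hexp.le (by positivity), ← mul_assoc,
      ← Real.rpow_add hexp, add_neg_cancel, Real.rpow_zero, one_mul]
  rw [laguerreKernel₁, hgauss, hbessel, hpow, Real.exp_add]
  ring

lemma hasSum_laguerreKernel₁ {β t : ℝ} (hβ : -1 < β) (ht : 0 < t) (x y : ℝ) :
    HasSum (fun n : ℕ => Real.exp (-t * (4 * n + 2 * β + 2)) *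
      (hermiteFun₁ β n x * hermiteFun₁ β n y)) (laguerreKernel₁ β t x y) := by
  have hlt : Real.exp (-(2 * t)) ^ 2 < 1 :=
    pow_lt_one₀ (Real.exp_pos _).le (Real.exp_lt_one_iff.2 (by linarith)) two_ne_zero
  rw [laguerreKernel₁_eq_hilleHardy ht β x y rfl]
  convert! (hasSum_hilleHardy hβ (x ^ 2) (y ^ 2) (pow_pos (Real.exp_pos _) 2) hlt).mul_left _
    using 2 with n
  have hexp : Real.exp (-t * (4 * n + 2 * β + 2)) =
      Real.exp (-(2 * t)) ^ (β + 1) * (Real.exp (-(2 * t)) ^ 2) ^ n := by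
    rw [← Real.exp_mul, ← Real.exp_nat_mul, ← Real.exp_nat_mul, ← Real.exp_add]
    push_cast
    ring_nf
  rw [hermiteFun₁_mul hβ, hexp]
  ring

lemma laguerreKernel₁_comm (β t x y : ℝ) : laguerreKernel₁ β t x y = laguerreKernel₁ β t y x := by
  simp only [laguerreKernel₁, mul_comm x y, add_comm (x ^ 2), mul_comm (x ^ (β + 1 / 2))]

lemma besselSeries_nonneg {β v : ℝ} (hβ : -1 < β) (hv : 0 ≤ v) : 0 ≤ besselSeries β v := by
  refine tsum_nonneg fun m => ?_
  have := Gamma_natCast_add_add_one_pos hβ m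
  positivity

lemma laguerreKernel₁_nonneg {β t x y : ℝ} (hβ : -1 < β) (ht : 0 < t) (hx : 0 ≤ x) (hy : 0 ≤ y) :
    0 ≤ laguerreKernel₁ β t x y := by
  have := sinh_two_mul_pos ht
  have := besselSeries_nonneg hβ (sq_nonneg (x * y / (2 * Real.sinh (2 * t))))
  rw [laguerreKernel₁]
  positivity

lemma measurable_besselSeries {β : ℝ} (hβ : -1 < β) : Measurable (besselSeries β) := by
  refine measurable_of_tendsto_metrizable (f := fun n v => ∑ m ∈ Finset.range n,
    v ^ m / (m.factorial * Real.Gamma (m + β + 1))) (fun n => by fun_prop) ?_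
  rw [tendsto_pi_nhds]
  exact fun v => (summable_besselSeries hβ v).hasSum.tendsto_sum_nat

lemma measurable_laguerreKernel₁ {β : ℝ} (hβ : -1 < β) (t : ℝ) :
    Measurable fun p : ℝ × ℝ => laguerreKernel₁ β t p.1 p.2 := by
  have := measurable_besselSeries hβ
  unfold laguerreKernel₁
  fun_prop

lemma exists_besselSeries_le {β ε : ℝ} (hβ : -1 < β) (hε : 0 < ε) :
    ∃ C, 0 ≤ C ∧ ∀ v, 0 ≤ v → besselSeries β v ≤ C * Real.exp (ε * v) := by
  obtain ⟨C, hC⟩ := (summable_pow_div_Gamma hβ ε⁻¹).tendsto_atTop_zero.bddAbove_range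
  have hcoeff : ∀ m : ℕ, ε⁻¹ ^ m / Real.Gamma (m + β + 1) ≤ C := fun m => hC ⟨m, rfl⟩
  have hGamma := Gamma_natCast_add_add_one_pos hβ
  have hC0 : 0 ≤ C := (div_pos (pow_pos (inv_pos.2 hε) 0) (hGamma 0)).le.trans (hcoeff 0)
  refine ⟨C, hC0, fun v hv => ?_⟩
  have hexp := (hasSum_pow_div_factorial (ε * v)).mul_left C
  refine hasSum_le (fun m => ?_) (summable_besselSeries hβ v).hasSum hexp
  calc v ^ m / (m.factorial * Real.Gamma (m + β + 1))
      = ε⁻¹ ^ m / Real.Gamma (m + β + 1) * ((ε * v) ^ m / m.factorial) := by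
        have := (hGamma m).ne'
        rw [mul_pow, inv_pow]
        field_simp
    _ ≤ C * ((ε * v) ^ m / m.factorial) := by gcongr; exact hcoeff m

lemma exists_rpow_mul_exp_neg_mul_sq_le {p κ : ℝ} (hp : 0 ≤ p) (hκ : 0 < κ) :
    ∃ M, ∀ y : ℝ, 0 < y → y ^ p * Real.exp (-(κ * y ^ 2)) ≤ M := by
  refine ⟨((p / 2 + 1) / κ) ^ (p / 2), fun y hy => ?_⟩
  have hsplit : y ^ p = ((p / 2 + 1) / κ) ^ (p / 2) * (κ * y ^ 2 / (p / 2 + 1)) ^ (p / 2) := by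
    rw [← Real.mul_rpow (by positivity) (by positivity),
      show (p / 2 + 1) / κ * (κ * y ^ 2 / (p / 2 + 1)) = y ^ 2 by field_simp, ← Real.rpow_natCast,
      ← Real.rpow_mul hy.le, Nat.cast_two, mul_div_cancel₀ _ two_ne_zero]
  have hexp : (κ * y ^ 2 / (p / 2 + 1)) ^ (p / 2) ≤ Real.exp (κ * y ^ 2) :=
    calc (κ * y ^ 2 / (p / 2 + 1)) ^ (p / 2)
        ≤ Real.exp (κ * y ^ 2 / (p / 2 + 1)) ^ (p / 2) := by
          gcongr
          linarith [Real.add_one_le_exp (κ * y ^ 2 / (p / 2 + 1))]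
      _ = Real.exp (κ * y ^ 2 * (p / 2 / (p / 2 + 1))) := by rw [← Real.exp_mul]; ring_nf
      _ ≤ Real.exp (κ * y ^ 2) := by
          have hle : p / 2 / (p / 2 + 1) ≤ 1 := (div_le_one (by positivity)).2 (by linarith)
          exact Real.exp_le_exp.2 (mul_le_of_le_one_right (by positivity) hle)
  rw [Real.exp_neg, hsplit, ← div_eq_mul_inv, div_le_iff₀ (Real.exp_pos _)]
  gcongr

lemma exists_laguerreKernel₁_le {β t x : ℝ} (hβ : -1 / 2 ≤ β) (ht : 0 < t) (hx : 0 < x) :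
    ∃ M, 0 ≤ M ∧ ∀ y, 0 < y → laguerreKernel₁ β t x y ≤ M := by
  have hs := sinh_two_mul_pos ht
  have := Real.cosh_pos (2 * t)
  rw [funext (laguerreKernel₁.eq_1 β t x)]
  set s := Real.sinh (2 * t)
  set κ := Real.cosh (2 * t) / (2 * s)
  have hκ0 : 0 < κ := by positivity
  obtain ⟨C, hC0, hC⟩ := exists_besselSeries_le (β := β) (by linarith)
    (by positivity : 0 < κ / 2 / (x / (2 * s)) ^ 2)
  obtain ⟨M, hM⟩ := exists_rpow_mul_exp_neg_mul_sq_le (p := β + 1 / 2) (by linarith) (half_pos hκ0)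
  have hM0 : 0 ≤ M := le_trans (by positivity) (hM 1 one_pos)
  refine ⟨2 * (2 * s) ^ (-(β + 1)) * x ^ (β + 1 / 2) * C * M, by positivity, fun y hy => ?_⟩
  have hbessel := hC ((x * y / (2 * s)) ^ 2) (by positivity)
  have hgauss : -(κ * (x ^ 2 + y ^ 2)) + κ / 2 / (x / (2 * s)) ^ 2 * (x * y / (2 * s)) ^ 2 ≤
      -(κ / 2 * y ^ 2) := by
    rw [show κ / 2 / (x / (2 * s)) ^ 2 * (x * y / (2 * s)) ^ 2 = κ / 2 * y ^ 2 by field_simp]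
    nlinarith [mul_nonneg hκ0.le (sq_nonneg x)]
  calc 2 * (2 * s) ^ (-(β + 1)) * (x ^ (β + 1 / 2) * y ^ (β + 1 / 2)) *
        Real.exp (-(κ * (x ^ 2 + y ^ 2))) * besselSeries β ((x * y / (2 * s)) ^ 2)
      ≤ 2 * (2 * s) ^ (-(β + 1)) * (x ^ (β + 1 / 2) * y ^ (β + 1 / 2)) *
        Real.exp (-(κ * (x ^ 2 + y ^ 2))) *
        (C * Real.exp (κ / 2 / (x / (2 * s)) ^ 2 * (x * y / (2 * s)) ^ 2)) := by gcongr
    _ = 2 * (2 * s) ^ (-(β + 1)) * x ^ (β + 1 / 2) * C * (y ^ (β + 1 / 2) *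
        Real.exp (-(κ * (x ^ 2 + y ^ 2)) +
          κ / 2 / (x / (2 * s)) ^ 2 * (x * y / (2 * s)) ^ 2)) := by rw [Real.exp_add]; ring
    _ ≤ 2 * (2 * s) ^ (-(β + 1)) * x ^ (β + 1 / 2) * C *
        (y ^ (β + 1 / 2) * Real.exp (-(κ / 2 * y ^ 2))) := by gcongr
    _ ≤ 2 * (2 * s) ^ (-(β + 1)) * x ^ (β + 1 / 2) * C * M := by
      gcongr
      exact hM y hy

/-! ### The mass of the one-dimensional heat kernel -/

/-- The function `e^{-w} ∑ w^{m+a} Γ(m + a + 1/2) / (m! Γ(m + 2a + 1/2))`. Up to an explicit factor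
it is the integral of `laguerreKernel₁ (2 * a - 1 / 2) t x` over the half-line, at
`w = x ^ 2 / sinh (4 * t)`. -/
def laguerreMass (a w : ℝ) : ℝ≥0∞ :=
  ∑' m : ℕ, ENNReal.ofReal (Real.exp (-w) * w ^ (m + a) * Real.Gamma (m + a + 1 / 2) /
    (m.factorial * Real.Gamma (m + 2 * a + 1 / 2)))

lemma lintegral_rpow_mul_exp_neg_mul_sq {q b : ℝ} (hq : -1 < q) (hb : 0 < b) :
    ∫⁻ y in Ioi (0 : ℝ), ENNReal.ofReal (y ^ q * Real.exp (-(b * y ^ 2))) =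
      ENNReal.ofReal (b ^ (-((q + 1) / 2)) * (1 / 2) * Real.Gamma ((q + 1) / 2)) := by
  rw [← ofReal_integral_eq_lintegral_ofReal]
  · rw [← neg_div, ← integral_rpow_mul_exp_neg_mul_rpow two_pos hq hb]
    congr 1
    refine setIntegral_congr_fun measurableSet_Ioi fun y _ => ?_
    simp only [neg_mul, Real.rpow_two]
  · simpa only [neg_mul, IntegrableOn] using integrableOn_rpow_mul_exp_neg_mul_sq hb hq
  · filter_upwards [ae_restrict_mem measurableSet_Ioi] with y (hy : 0 < y)
    positivity

lemma ofReal_laguerreKernel₁_eq_tsum {β t x y : ℝ} (hβ : -1 < β) (ht : 0 < t) (hx : 0 < x)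
    (hy : 0 < y) :
    ENNReal.ofReal (laguerreKernel₁ β t x y) =
      ∑' m : ℕ, ENNReal.ofReal (2 * (2 * Real.sinh (2 * t)) ^ (-(β + 1)) * x ^ (β + 1 / 2) *
          Real.exp (-(Real.cosh (2 * t) / (2 * Real.sinh (2 * t)) * x ^ 2)) *
          ((x / (2 * Real.sinh (2 * t))) ^ (2 * m) / (m.factorial * Real.Gamma (m + β + 1)))) *
        ENNReal.ofReal (y ^ (2 * m + β + 1 / 2) *
          Real.exp (-(Real.cosh (2 * t) / (2 * Real.sinh (2 * t)) * y ^ 2))) := by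
  have := sinh_two_mul_pos ht
  have hGamma := Gamma_natCast_add_add_one_pos hβ
  rw [laguerreKernel₁, besselSeries, ← tsum_mul_left, ENNReal.ofReal_tsum_of_nonneg
    (fun m => by have := hGamma m; positivity) ((summable_besselSeries hβ _).mul_left _)]
  refine tsum_congr fun m => ?_
  rw [← ENNReal.ofReal_mul (by have := hGamma m; positivity)]
  have hpow : y ^ (2 * m + β + 1 / 2) = y ^ (β + 1 / 2) * y ^ (2 * m) := by
    rw [← Real.rpow_add_natCast hy.ne']
    push_cast
    ring_nf
  rw [hpow, mul_add (Real.cosh _ / _), neg_add (_ * x ^ 2), Real.exp_add, pow_mul, pow_mul,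
    mul_div_right_comm x y, mul_pow, mul_pow]
  ring_nf

lemma laguerreKernel₁_mass_term {a s c x : ℝ} (hs : 0 < s) (hc : 0 < c) (hsc : c ^ 2 = 1 + s ^ 2)
    (hx : 0 < x) (m : ℕ) :
    2 * (2 * s) ^ (-(2 * a + 1 / 2)) * x ^ (2 * a) * Real.exp (-(c / (2 * s) * x ^ 2)) *
      (x / (2 * s)) ^ (2 * m) * ((c / (2 * s)) ^ (-(m + a + 1 / 2)) * (1 / 2)) =
    c ^ (-1 / 2 : ℝ) * Real.exp (-(s ^ 2 * (x ^ 2 / (2 * s * c)))) *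
      (Real.exp (-(x ^ 2 / (2 * s * c))) * (x ^ 2 / (2 * s * c)) ^ (m + a)) := by
  have hs2 : 0 < 2 * s := by positivity
  have hexp : Real.exp (-(c / (2 * s) * x ^ 2)) = Real.exp (-(s ^ 2 * (x ^ 2 / (2 * s * c)))) *
      Real.exp (-(x ^ 2 / (2 * s * c))) := by
    rw [← Real.exp_add]
    congr 1
    field_simp
    linear_combination -hsc
  have hpow : 2 * (2 * s) ^ (-(2 * a + 1 / 2)) * x ^ (2 * a) * (x / (2 * s)) ^ (2 * m) *
      ((c / (2 * s)) ^ (-(m + a + 1 / 2)) * (1 / 2)) =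
      c ^ (-1 / 2 : ℝ) * (x ^ 2 / (2 * s * c)) ^ (m + a) := by
    rw [← Real.rpow_natCast (x / (2 * s)), Real.rpow_def_of_pos hs2, Real.rpow_def_of_pos hx,
      Real.rpow_def_of_pos (by positivity : 0 < x / (2 * s)),
      Real.rpow_def_of_pos (by positivity : 0 < c / (2 * s)),
      Real.rpow_def_of_pos (by positivity : 0 < x ^ 2 / (2 * s * c)), Real.rpow_def_of_pos hc,
      Real.log_div hx.ne' hs2.ne', Real.log_div hc.ne' hs2.ne',
      Real.log_div (by positivity) (by positivity), Real.log_mul hs2.ne' hc.ne', Real.log_pow]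
    rw [show ∀ A B C D : ℝ, 2 * Real.exp A * Real.exp B * Real.exp C * (Real.exp D * (1 / 2)) =
      Real.exp (A + B + C + D) by intros; simp only [Real.exp_add]; ring, ← Real.exp_add]
    congr 1
    push_cast
    ring
  rw [hexp]
  linear_combination Real.exp (-(s ^ 2 * (x ^ 2 / (2 * s * c)))) *
    Real.exp (-(x ^ 2 / (2 * s * c))) * hpow

lemma lintegral_laguerreKernel₁ {β t x : ℝ} (hβ : -1 < β) (ht : 0 < t) (hx : 0 < x) :
    ∫⁻ y in Ioi (0 : ℝ), ENNReal.ofReal (laguerreKernel₁ β t x y) =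
      ENNReal.ofReal (Real.cosh (2 * t) ^ (-1 / 2 : ℝ) * Real.exp (-(Real.sinh (2 * t) ^ 2 *
        (x ^ 2 / (2 * Real.sinh (2 * t) * Real.cosh (2 * t)))))) *
      laguerreMass (β / 2 + 1 / 4) (x ^ 2 / (2 * Real.sinh (2 * t) * Real.cosh (2 * t))) := by
  rw [setLIntegral_congr_fun measurableSet_Ioi fun y hy =>
      ofReal_laguerreKernel₁_eq_tsum hβ ht hx hy,
    lintegral_tsum fun m => by fun_prop, laguerreMass, ← ENNReal.tsum_mul_left]
  have hs := sinh_two_mul_pos ht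
  have hc := Real.cosh_pos (2 * t)
  refine tsum_congr fun m => ?_
  have hGamma := Gamma_natCast_add_add_one_pos hβ m
  rw [lintegral_const_mul _ (by fun_prop), lintegral_rpow_mul_exp_neg_mul_sq
    (by linarith [m.cast_nonneg (α := ℝ)]) (by positivity),
    ← ENNReal.ofReal_mul (by positivity), ← ENNReal.ofReal_mul (by positivity)]
  congr 1
  have hterm := laguerreKernel₁_mass_term (a := β / 2 + 1 / 4) hs hc (Real.cosh_sq' _) hx m
  rw [show 2 * (β / 2 + 1 / 4) + 1 / 2 = β + 1 by ring,
    show 2 * (β / 2 + 1 / 4) = β + 1 / 2 by ring] at hterm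
  rw [show (2 * (m : ℝ) + β + 1 / 2 + 1) / 2 = m + (β / 2 + 1 / 4) + 1 / 2 by ring,
    show (m : ℝ) + 2 * (β / 2 + 1 / 4) + 1 / 2 = m + β + 1 by ring]
  linear_combination Real.Gamma (m + (β / 2 + 1 / 4) + 1 / 2) /
    (m.factorial * Real.Gamma (m + β + 1)) * hterm

lemma laguerreMass_zero {w : ℝ} (hw : 0 ≤ w) : laguerreMass 0 w = 1 := by
  have hexp := (hasSum_pow_div_factorial w).mul_left (Real.exp (-w))
  have hterm : laguerreMass 0 w =
      ∑' m : ℕ, ENNReal.ofReal (Real.exp (-w) * (w ^ m / m.factorial)) := by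
    refine tsum_congr fun m => ?_
    have : 0 < Real.Gamma (m + 1 / 2) := Real.Gamma_pos_of_pos (by positivity)
    simp only [mul_zero, add_zero, Real.rpow_natCast]
    field_simp
  rw [hterm, ← ENNReal.ofReal_tsum_of_nonneg (fun m => by positivity) hexp.summable, hexp.tsum_eq,
    ← Real.exp_add, neg_add_cancel, Real.exp_zero, ENNReal.ofReal_one]

lemma lintegral_rpow_mul_one_sub_rpow {a b : ℝ} (ha : 0 < a) (hb : 0 < b) :
    ∫⁻ s in Ioo (0 : ℝ) 1, ENNReal.ofReal (s ^ (a - 1) * (1 - s) ^ (b - 1)) =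
      ENNReal.ofReal (ProbabilityTheory.beta a b) := by
  have hbeta := ProbabilityTheory.beta_pos ha hb
  have hone := ProbabilityTheory.lintegral_betaPDF_eq_one ha hb
  simp_rw [ProbabilityTheory.lintegral_betaPDF, mul_assoc,
    ENNReal.ofReal_mul (one_div_pos.2 hbeta).le] at hone
  rw [lintegral_const_mul _ (by fun_prop), one_div, ENNReal.ofReal_inv_of_pos hbeta,
    mul_comm] at hone
  rw [ENNReal.eq_inv_of_mul_eq_one_left hone, inv_inv]

lemma ofReal_massIntegrand_eq_tsum {a w s : ℝ} (hw : 0 < w) (hs : s ∈ Ioo (0 : ℝ) 1) :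
    ENNReal.ofReal (w ^ a * Real.exp (-(w * s)) * s ^ (a - 1) * (1 - s) ^ (a - 1 / 2)) =
      ∑' m : ℕ, ENNReal.ofReal (Real.exp (-w) * w ^ (m + a) / m.factorial) *
        ENNReal.ofReal (s ^ (a - 1) * (1 - s) ^ (m + a + 1 / 2 - 1)) := by
  have hs0 : 0 < s := hs.1
  have hs1 : 0 < 1 - s := sub_pos.2 hs.2
  have hexp := (hasSum_pow_div_factorial (w * (1 - s))).mul_left
    (w ^ a * Real.exp (-w) * s ^ (a - 1) * (1 - s) ^ (a - 1 / 2))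
  have hsplit : w ^ a * Real.exp (-(w * s)) * s ^ (a - 1) * (1 - s) ^ (a - 1 / 2) =
      w ^ a * Real.exp (-w) * s ^ (a - 1) * (1 - s) ^ (a - 1 / 2) * Real.exp (w * (1 - s)) := by
    rw [show -(w * s) = -w + w * (1 - s) by ring, Real.exp_add]
    ring
  rw [hsplit, ← hexp.tsum_eq, ENNReal.ofReal_tsum_of_nonneg (fun m => by positivity) hexp.summable]
  refine tsum_congr fun m => ?_
  rw [← ENNReal.ofReal_mul (by positivity), show (m : ℝ) + a + 1 / 2 - 1 = (a - 1 / 2) + m by ring,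
    add_comm (m : ℝ) a, Real.rpow_add_natCast hs1.ne', Real.rpow_add_natCast hw.ne', mul_pow]
  ring_nf

lemma laguerreMass_eq_lintegral {a w : ℝ} (ha : 0 < a) (hw : 0 < w) :
    laguerreMass a w = ENNReal.ofReal (Real.Gamma a)⁻¹ * ∫⁻ s in Ioo (0 : ℝ) 1,
      ENNReal.ofReal (w ^ a * Real.exp (-(w * s)) * s ^ (a - 1) * (1 - s) ^ (a - 1 / 2)) := by
  rw [setLIntegral_congr_fun measurableSet_Ioo fun s hs => ofReal_massIntegrand_eq_tsum hw hs,
    lintegral_tsum fun m => by fun_prop, laguerreMass, ← ENNReal.tsum_mul_left]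
  refine tsum_congr fun m => ?_
  have := Real.Gamma_pos_of_pos ha
  have : 0 < Real.Gamma (m + 2 * a + 1 / 2) := Real.Gamma_pos_of_pos (by positivity)
  rw [lintegral_const_mul _ (by fun_prop), lintegral_rpow_mul_one_sub_rpow ha (by positivity),
    ← ENNReal.ofReal_mul (by positivity), ← ENNReal.ofReal_mul (by positivity),
    ProbabilityTheory.beta, show a + (m + a + 1 / 2) = m + 2 * a + 1 / 2 by ring]
  congr 1
  field_simp

/-! ### Upper bounds for the mass -/

lemma integrableOn_rpow_mul_exp_neg_mul {a w : ℝ} (ha : 0 < a) (hw : 0 < w) :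
    IntegrableOn (fun s : ℝ => s ^ (a - 1) * Real.exp (-(w * s))) (Ioi 0) := by
  have := integrableOn_rpow_mul_exp_neg_mul_rpow (s := a - 1) (by linarith) one_pos hw
  simpa only [Real.rpow_one, neg_mul] using this

lemma lintegral_rpow_mul_exp_neg_mul {a w : ℝ} (ha : 0 < a) (hw : 0 < w) :
    ∫⁻ s in Ioi (0 : ℝ), ENNReal.ofReal (w ^ a * Real.exp (-(w * s)) * s ^ (a - 1)) =
      ENNReal.ofReal (Real.Gamma a) := by
  have hcomm : ∀ s : ℝ, w ^ a * Real.exp (-(w * s)) * s ^ (a - 1) =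
      w ^ a * (s ^ (a - 1) * Real.exp (-(w * s))) := fun s => by ring
  simp_rw [hcomm]
  rw [← ofReal_integral_eq_lintegral_ofReal
    ((integrableOn_rpow_mul_exp_neg_mul ha hw).const_mul (w ^ a))]
  · rw [integral_const_mul, Real.integral_rpow_mul_exp_neg_mul_Ioi ha hw, one_div, ← mul_assoc,
      ← Real.mul_rpow hw.le (by positivity), mul_inv_cancel₀ hw.ne', Real.one_rpow, one_mul]
  · filter_upwards [ae_restrict_mem measurableSet_Ioi] with s (hs : 0 < s)
    positivity

lemma laguerreMass_le_one {a w : ℝ} (ha : 1 / 2 ≤ a) (hw : 0 < w) : laguerreMass a w ≤ 1 := by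
  have ha0 : 0 < a := by linarith
  have hGa := Real.Gamma_pos_of_pos ha0
  rw [laguerreMass_eq_lintegral ha0 hw]
  calc ENNReal.ofReal (Real.Gamma a)⁻¹ * ∫⁻ s in Ioo (0 : ℝ) 1,
        ENNReal.ofReal (w ^ a * Real.exp (-(w * s)) * s ^ (a - 1) * (1 - s) ^ (a - 1 / 2))
      ≤ ENNReal.ofReal (Real.Gamma a)⁻¹ * ∫⁻ s in Ioo (0 : ℝ) 1,
        ENNReal.ofReal (w ^ a * Real.exp (-(w * s)) * s ^ (a - 1)) := by
        refine mul_le_mul_right (setLIntegral_mono' measurableSet_Ioo fun s hs => ?_) _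
        have := hs.1
        refine ENNReal.ofReal_le_ofReal (mul_le_of_le_one_right (by positivity) ?_)
        exact Real.rpow_le_one (by linarith [hs.2]) (by linarith) (by linarith)
    _ ≤ ENNReal.ofReal (Real.Gamma a)⁻¹ * ∫⁻ s in Ioi (0 : ℝ),
        ENNReal.ofReal (w ^ a * Real.exp (-(w * s)) * s ^ (a - 1)) := by
        gcongr
        exact Ioo_subset_Ioi_self
    _ = 1 := by
        rw [lintegral_rpow_mul_exp_neg_mul ha0 hw, ← ENNReal.ofReal_mul (by positivity),
          inv_mul_cancel₀ hGa.ne', ENNReal.ofReal_one]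

lemma rpow_mul_exp_neg_le_one {a v : ℝ} (ha0 : 0 ≤ a) (ha1 : a ≤ 1) (hv : 0 ≤ v) :
    v ^ a * Real.exp (-v) ≤ 1 := by
  rw [Real.exp_neg, ← div_eq_mul_inv, div_le_one (Real.exp_pos v)]
  calc v ^ a ≤ Real.exp v ^ a := by gcongr; linarith [Real.add_one_le_exp v]
    _ ≤ Real.exp v := Real.rpow_le_self_of_one_le (Real.one_le_exp hv) ha1

lemma massIntegrand_le_add {a w s : ℝ} (ha : 0 < a) (ha2 : a ≤ 1 / 2) (hw : 0 < w)
    (hs : s ∈ Ioo (0 : ℝ) 1) :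
    w ^ a * Real.exp (-(w * s)) * s ^ (a - 1) * (1 - s) ^ (a - 1 / 2) ≤
      w ^ a * Real.exp (-(w * s)) * s ^ (a - 1) + (1 - s) ^ (a - 1 / 2) := by
  have hs0 : 0 < s := hs.1
  have hs1 : 0 < 1 - s := sub_pos.2 hs.2
  have hsing : (1 - s) ^ (a - 1 / 2) ≤ 1 + s * (1 - s) ^ (a - 1 / 2) := by
    have hle : (1 - s) ^ (a - 1 / 2 + 1) ≤ 1 :=
      Real.rpow_le_one hs1.le (by linarith) (by linarith)
    rw [Real.rpow_add_one hs1.ne'] at hle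
    linarith
  have hpow : s ^ a = s ^ (a - 1) * s := by rw [← Real.rpow_add_one hs0.ne', sub_add_cancel]
  have hpeak := rpow_mul_exp_neg_le_one ha.le (by linarith) (mul_pos hw hs0).le
  rw [Real.mul_rpow hw.le hs0.le, hpow] at hpeak
  calc w ^ a * Real.exp (-(w * s)) * s ^ (a - 1) * (1 - s) ^ (a - 1 / 2)
      ≤ w ^ a * Real.exp (-(w * s)) * s ^ (a - 1) * (1 + s * (1 - s) ^ (a - 1 / 2)) := by gcongr
    _ = w ^ a * Real.exp (-(w * s)) * s ^ (a - 1) +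
        w ^ a * (s ^ (a - 1) * s) * Real.exp (-(w * s)) * (1 - s) ^ (a - 1 / 2) := by ring
    _ ≤ w ^ a * Real.exp (-(w * s)) * s ^ (a - 1) + 1 * (1 - s) ^ (a - 1 / 2) := by gcongr
    _ = w ^ a * Real.exp (-(w * s)) * s ^ (a - 1) + (1 - s) ^ (a - 1 / 2) := by rw [one_mul]

lemma laguerreMass_le_of_le_half {a w : ℝ} (ha : 0 < a) (ha2 : a ≤ 1 / 2) (hw : 0 < w) :
    laguerreMass a w ≤ ENNReal.ofReal ((Real.Gamma a)⁻¹ *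
      (Real.Gamma a + ProbabilityTheory.beta 1 (a + 1 / 2))) := by
  have hGa := Real.Gamma_pos_of_pos ha
  have hbeta := ProbabilityTheory.beta_pos one_pos (by positivity : 0 < a + 1 / 2)
  rw [laguerreMass_eq_lintegral ha hw, ENNReal.ofReal_mul (by positivity),
    ENNReal.ofReal_add hGa.le hbeta.le, ← lintegral_rpow_mul_one_sub_rpow one_pos (by positivity),
    ← lintegral_rpow_mul_exp_neg_mul ha hw]
  gcongr
  calc ∫⁻ s in Ioo (0 : ℝ) 1,
        ENNReal.ofReal (w ^ a * Real.exp (-(w * s)) * s ^ (a - 1) * (1 - s) ^ (a - 1 / 2))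
      ≤ ∫⁻ s in Ioo (0 : ℝ) 1, (ENNReal.ofReal (w ^ a * Real.exp (-(w * s)) * s ^ (a - 1)) +
        ENNReal.ofReal (s ^ (1 - 1 : ℝ) * (1 - s) ^ (a + 1 / 2 - 1))) := by
        refine setLIntegral_mono' measurableSet_Ioo fun s hs => ?_
        have := hs.1
        have := sub_pos.2 hs.2
        rw [← ENNReal.ofReal_add (by positivity) (by positivity), sub_self, Real.rpow_zero, one_mul,
          show a + 1 / 2 - 1 = a - 1 / 2 by ring]
        exact ENNReal.ofReal_le_ofReal (massIntegrand_le_add ha ha2 hw hs)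
    _ = (∫⁻ s in Ioo (0 : ℝ) 1, ENNReal.ofReal (w ^ a * Real.exp (-(w * s)) * s ^ (a - 1))) +
        ∫⁻ s in Ioo (0 : ℝ) 1, ENNReal.ofReal (s ^ (1 - 1 : ℝ) * (1 - s) ^ (a + 1 / 2 - 1)) :=
        lintegral_add_left (by fun_prop) _
    _ ≤ (∫⁻ s in Ioi (0 : ℝ), ENNReal.ofReal (w ^ a * Real.exp (-(w * s)) * s ^ (a - 1))) +
        ∫⁻ s in Ioo (0 : ℝ) 1, ENNReal.ofReal (s ^ (1 - 1 : ℝ) * (1 - s) ^ (a + 1 / 2 - 1)) := by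
        gcongr
        exact Ioo_subset_Ioi_self

lemma exists_laguerreMass_le {a : ℝ} (ha : 0 ≤ a) :
    ∃ C : ℝ, 1 ≤ C ∧ ∀ w, 0 < w → laguerreMass a w ≤ ENNReal.ofReal C := by
  rcases ha.eq_or_lt with rfl | ha
  · exact ⟨1, le_rfl, fun w hw => by rw [laguerreMass_zero hw.le, ENNReal.ofReal_one]⟩
  rcases le_total (1 / 2) a with ha2 | ha2
  · exact ⟨1, le_rfl, fun w hw => ENNReal.ofReal_one ▸ laguerreMass_le_one ha2 hw⟩
  refine ⟨_, ?_, fun w => laguerreMass_le_of_le_half ha ha2⟩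
  have hGa := Real.Gamma_pos_of_pos ha
  have hbeta := ProbabilityTheory.beta_pos one_pos (by positivity : 0 < a + 1 / 2)
  rw [inv_mul_eq_div, one_le_div hGa]
  linarith

/-! ### Lower bounds for the mass -/

lemma one_sub_mul_le_one_sub_rpow {q s : ℝ} (hq : q ≤ 0) (hs : s < 1) :
    1 + -q * s ≤ (1 - s) ^ q := by
  rw [Real.rpow_def_of_pos (sub_pos.2 hs)]
  nlinarith [Real.log_le_sub_one_of_pos (sub_pos.2 hs), Real.add_one_le_exp (Real.log (1 - s) * q)]

lemma one_sub_add_one_mul_le_one_sub_rpow {q s : ℝ} (hq : 0 ≤ q) (hs0 : 0 ≤ s) (hs : s < 1) :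
    1 + -(q + 1) * s ≤ (1 - s) ^ q :=
  calc 1 + -(q + 1) * s = 1 + (q + 1) * -s := by ring
    _ ≤ (1 - s) ^ (q + 1) :=
      one_add_mul_self_le_rpow_one_add (by linarith) (by linarith)
    _ ≤ (1 - s) ^ q :=
      Real.rpow_le_rpow_of_exponent_ge (sub_pos.2 hs) (by linarith) (by linarith)

lemma ofReal_integral_le_lintegral {X : Type*} [MeasurableSpace X] {μ : Measure X} {f : X → ℝ}
    (hf : Integrable f μ) : ENNReal.ofReal (∫ x, f x ∂μ) ≤ ∫⁻ x, ENNReal.ofReal (f x) ∂μ := by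
  apply ENNReal.ofReal_le_of_le_toReal
  rw [integral_eq_lintegral_pos_part_sub_lintegral_neg_part hf]
  exact sub_le_self _ ENNReal.toReal_nonneg

lemma setIntegral_Ici_one_rpow_mul_exp_neg_mul_le {q w : ℝ} (hq : 0 < q) (hw : 1 ≤ w) :
    ∫ s in Ici (1 : ℝ), s ^ (q - 1) * Real.exp (-(w * s)) ≤
      Real.exp (-(w - 1)) * Real.Gamma q := by
  have hsub : Ici (1 : ℝ) ⊆ Ioi 0 := Ici_subset_Ioi.2 one_pos
  have hint := fun {v : ℝ} (hv : 0 < v) => integrableOn_rpow_mul_exp_neg_mul hq hv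
  calc ∫ s in Ici (1 : ℝ), s ^ (q - 1) * Real.exp (-(w * s))
      ≤ ∫ s in Ici (1 : ℝ), Real.exp (-(w - 1)) * (s ^ (q - 1) * Real.exp (-(1 * s))) := by
        refine setIntegral_mono_on ((hint (by linarith)).mono_set hsub)
          (((hint one_pos).mono_set hsub).const_mul _) measurableSet_Ici fun s (hs : 1 ≤ s) => ?_
        have hexp : Real.exp (-(w * s)) ≤ Real.exp (-(w - 1)) * Real.exp (-(1 * s)) := by
          rw [← Real.exp_add, Real.exp_le_exp]
          nlinarith
        calc s ^ (q - 1) * Real.exp (-(w * s))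
            ≤ s ^ (q - 1) * (Real.exp (-(w - 1)) * Real.exp (-(1 * s))) := by gcongr
          _ = Real.exp (-(w - 1)) * (s ^ (q - 1) * Real.exp (-(1 * s))) := by ring
    _ ≤ ∫ s in Ioi (0 : ℝ), Real.exp (-(w - 1)) * (s ^ (q - 1) * Real.exp (-(1 * s))) := by
        refine setIntegral_mono_set ((hint one_pos).const_mul _) ?_ (Eventually.of_forall hsub)
        filter_upwards [ae_restrict_mem measurableSet_Ioi] with s (hs : 0 < s)
        rw [Pi.zero_apply]
        positivity
    _ = Real.exp (-(w - 1)) * Real.Gamma q := by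
        rw [integral_const_mul, Real.integral_rpow_mul_exp_neg_mul_Ioi hq one_pos, div_one,
          Real.one_rpow, one_mul]

lemma abs_setIntegral_Ioo_rpow_mul_exp_neg_mul_sub_le {q w : ℝ} (hq : 0 < q) (hw : 1 ≤ w) :
    |(∫ s in Ioo (0 : ℝ) 1, s ^ (q - 1) * Real.exp (-(w * s))) - (1 / w) ^ q * Real.Gamma q| ≤
      Real.exp (-(w - 1)) * Real.Gamma q := by
  have hw0 : 0 < w := by linarith
  have hint := integrableOn_rpow_mul_exp_neg_mul hq hw0
  have hsub : Ici (1 : ℝ) ⊆ Ioi 0 := Ici_subset_Ioi.2 one_pos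
  have htail : 0 ≤ ∫ s in Ici (1 : ℝ), s ^ (q - 1) * Real.exp (-(w * s)) :=
    setIntegral_nonneg measurableSet_Ici fun s hs => by
      have : 0 < s := hsub hs
      positivity
  rw [← Real.integral_rpow_mul_exp_neg_mul_Ioi hq hw0, ← Ioo_union_Ici_eq_Ioi one_pos,
    setIntegral_union ((Iio_disjoint_Ici le_rfl).mono_left Ioo_subset_Iio_self) measurableSet_Ici
      (hint.mono_set Ioo_subset_Ioi_self) (hint.mono_set hsub), sub_add_cancel_left, abs_neg,
    abs_of_nonneg htail]
  exact setIntegral_Ici_one_rpow_mul_exp_neg_mul_le hq hw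

lemma le_setIntegral_Ioo_linear_mul_rpow_mul_exp_neg_mul {a w : ℝ} (k : ℝ) (ha : 0 < a)
    (hw : 1 ≤ w) :
    Real.Gamma a * (1 + k * a / w - (1 + |k| * a) * (w ^ a * Real.exp (-(w - 1)))) ≤
      w ^ a * ((∫ s in Ioo (0 : ℝ) 1, s ^ (a - 1) * Real.exp (-(w * s))) +
        k * ∫ s in Ioo (0 : ℝ) 1, s ^ (a + 1 - 1) * Real.exp (-(w * s))) := by
  have hw0 : 0 < w := by linarith
  have := Real.Gamma_pos_of_pos ha
  have := Real.rpow_pos_of_pos hw0 a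
  have hzeroth := abs_setIntegral_Ioo_rpow_mul_exp_neg_mul_sub_le ha hw
  have hfirst := abs_setIntegral_Ioo_rpow_mul_exp_neg_mul_sub_le (by linarith : 0 < a + 1) hw
  rw [Real.Gamma_add_one ha.ne'] at hfirst
  set I₀ := ∫ s in Ioo (0 : ℝ) 1, s ^ (a - 1) * Real.exp (-(w * s))
  set I₁ := ∫ s in Ioo (0 : ℝ) 1, s ^ (a + 1 - 1) * Real.exp (-(w * s))
  have hk : -(|k| * (Real.exp (-(w - 1)) * (a * Real.Gamma a))) ≤
      k * (I₁ - (1 / w) ^ (a + 1) * (a * Real.Gamma a)) :=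
    (neg_le_neg (by rw [abs_mul]; gcongr)).trans (neg_abs_le _)
  calc Real.Gamma a * (1 + k * a / w - (1 + |k| * a) * (w ^ a * Real.exp (-(w - 1))))
      = w ^ a * (((1 / w) ^ a * Real.Gamma a - Real.exp (-(w - 1)) * Real.Gamma a) +
        (k * ((1 / w) ^ (a + 1) * (a * Real.Gamma a)) +
          -(|k| * (Real.exp (-(w - 1)) * (a * Real.Gamma a))))) := by
        rw [Real.rpow_add_one (by positivity), one_div, Real.inv_rpow hw0.le]
        field_simp
        ring
    _ ≤ w ^ a * (I₀ + k * I₁) := by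
        gcongr
        · linarith [(abs_le.1 hzeroth).1]
        · linarith

/-- Laplace's method, with the minorant `1 + k * s` inserted into `laguerreMass_eq_lintegral`. -/
lemma le_laguerreMass {a k w : ℝ} (ha : 0 < a) (hw : 1 ≤ w)
    (hk : ∀ s : ℝ, 0 < s → s < 1 → 1 + k * s ≤ (1 - s) ^ (a - 1 / 2)) :
    ENNReal.ofReal (1 + k * a / w - (1 + |k| * a) * (w ^ a * Real.exp (-(w - 1)))) ≤
      laguerreMass a w := by
  have hw0 : 0 < w := by linarith
  have hGa := Real.Gamma_pos_of_pos ha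
  have hint := fun {q : ℝ} (hq : 0 < q) =>
    (integrableOn_rpow_mul_exp_neg_mul hq hw0).mono_set (Ioo_subset_Ioi_self : Ioo (0 : ℝ) 1 ⊆ _)
  have hint₀ := hint ha
  have hint₁ := (hint (by linarith : 0 < a + 1)).const_mul k
  rw [laguerreMass_eq_lintegral ha hw0]
  calc ENNReal.ofReal (1 + k * a / w - (1 + |k| * a) * (w ^ a * Real.exp (-(w - 1))))
      ≤ ENNReal.ofReal ((Real.Gamma a)⁻¹ * ∫ s in Ioo (0 : ℝ) 1, w ^ a *
        (s ^ (a - 1) * Real.exp (-(w * s)) + k * (s ^ (a + 1 - 1) * Real.exp (-(w * s))))) := by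
        rw [inv_mul_eq_div, integral_const_mul, integral_add hint₀ hint₁, integral_const_mul]
        refine ENNReal.ofReal_le_ofReal ((le_div_iff₀' hGa).2 ?_)
        exact le_setIntegral_Ioo_linear_mul_rpow_mul_exp_neg_mul k ha hw
    _ ≤ ENNReal.ofReal (Real.Gamma a)⁻¹ * ∫⁻ s in Ioo (0 : ℝ) 1, ENNReal.ofReal (w ^ a *
        (s ^ (a - 1) * Real.exp (-(w * s)) + k * (s ^ (a + 1 - 1) * Real.exp (-(w * s))))) := by
        rw [ENNReal.ofReal_mul (by positivity)]
        gcongr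
        exact ofReal_integral_le_lintegral ((hint₀.add hint₁).const_mul _)
    _ ≤ ENNReal.ofReal (Real.Gamma a)⁻¹ * ∫⁻ s in Ioo (0 : ℝ) 1,
        ENNReal.ofReal (w ^ a * Real.exp (-(w * s)) * s ^ (a - 1) * (1 - s) ^ (a - 1 / 2)) := by
        refine mul_le_mul_right (setLIntegral_mono' measurableSet_Ioo fun s hs => ?_) _
        have hs0 : 0 < s := hs.1
        refine ENNReal.ofReal_le_ofReal (Eq.trans_le ?_
          (mul_le_mul_of_nonneg_left (hk s hs0 hs.2) (by positivity)))
        rw [show a + 1 - 1 = a - 1 + 1 by ring, Real.rpow_add_one hs0.ne']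
        ring

lemma eventually_rpow_mul_exp_le (a D : ℝ) {δ : ℝ} (hδ : 0 < δ) :
    ∀ᶠ w : ℝ in atTop, D * (w ^ a * Real.exp (-(w - 1))) ≤ δ / w := by
  have hlim := (tendsto_rpow_mul_exp_neg_mul_atTop_nhds_zero (a + 1) 1 one_pos).const_mul
    (D * Real.exp 1)
  rw [mul_zero] at hlim
  filter_upwards [hlim.eventually (gt_mem_nhds hδ), eventually_gt_atTop 0] with w hlt hw
  have hexp : Real.exp (-(w - 1)) = Real.exp 1 * Real.exp (-1 * w) := by
    rw [← Real.exp_add]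
    ring_nf
  rw [Real.rpow_add_one hw.ne'] at hlt
  rw [le_div_iff₀ hw, hexp]
  linarith

lemma exists_Icc_le_laguerreMass {a ε : ℝ} (ha : 0 ≤ a) (hε : 0 < ε) :
    ∃ A B : ℝ, 0 < A ∧ A < B ∧ ∀ w ∈ Icc A B, ENNReal.ofReal (1 - ε) ≤ laguerreMass a w := by
  rcases ha.eq_or_lt with rfl | ha
  · refine ⟨1, 2, one_pos, one_lt_two, fun w hw => ?_⟩
    rw [laguerreMass_zero (zero_le_one.trans hw.1), ENNReal.ofReal_le_one]
    linarith
  obtain ⟨k, hk⟩ : ∃ k : ℝ, ∀ s : ℝ, 0 < s → s < 1 → 1 + k * s ≤ (1 - s) ^ (a - 1 / 2) := by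
    rcases le_total a (1 / 2) with h | h
    · exact ⟨_, fun s _ hs => one_sub_mul_le_one_sub_rpow (by linarith) hs⟩
    · exact ⟨_, fun s hs0 hs => one_sub_add_one_mul_le_one_sub_rpow (by linarith) hs0.le hs⟩
  have hlim : Tendsto (fun w : ℝ => (|k| * a + 1) / w) atTop (𝓝 0) :=
    tendsto_const_nhds.div_atTop tendsto_id
  obtain ⟨W, hW⟩ := ((eventually_rpow_mul_exp_le a (1 + |k| * a) one_pos).and
    ((hlim.eventually (gt_mem_nhds hε)).and (eventually_gt_atTop 1))).exists_forall_of_atTop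
  have hW1 : 1 < W := (hW W le_rfl).2.2
  refine ⟨W, W + 1, by linarith, by linarith, fun w hw => ?_⟩
  obtain ⟨herr, hsmall, hw1⟩ := hW w hw.1
  refine (ENNReal.ofReal_le_ofReal ?_).trans (le_laguerreMass ha hw1.le hk)
  have hfirst : -(|k| * a / w) ≤ k * a / w := by
    rw [← neg_div, ← neg_mul]
    gcongr
    exact neg_abs_le k
  rw [add_div] at hsmall
  linarith

lemma exists_Icc_lt_laguerreMass {a : ℝ} (ha : 0 < a) (ha2 : a < 1 / 2) :
    ∃ h A B : ℝ, 1 < h ∧ 0 < A ∧ A < B ∧ ∀ w ∈ Icc A B, ENNReal.ofReal h ≤ laguerreMass a w := by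
  have hk0 : 0 < -(a - 1 / 2) := by linarith
  set k := -(a - 1 / 2)
  have hk : ∀ s : ℝ, 0 < s → s < 1 → 1 + k * s ≤ (1 - s) ^ (a - 1 / 2) :=
    fun s _ hs => one_sub_mul_le_one_sub_rpow (by linarith) hs
  obtain ⟨W, hW⟩ := ((eventually_rpow_mul_exp_le a (1 + |k| * a)
    (by positivity : 0 < k * a / 2)).and (eventually_gt_atTop 1)).exists_forall_of_atTop
  have hW0 : 0 < W := one_pos.trans (hW W le_rfl).2
  refine ⟨1 + k * a / 2 / (W + 1), W, W + 1, lt_add_of_pos_right _ (by positivity), hW0,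
    by linarith, fun w hw => ?_⟩
  obtain ⟨herr, hw1⟩ := hW w hw.1
  refine (ENNReal.ofReal_le_ofReal ?_).trans (le_laguerreMass ha hw1.le hk)
  have hgain : k * a / 2 / (W + 1) ≤ k * a / 2 / w := by
    gcongr
    exact hw.2
  have hhalves : k * a / w = k * a / 2 / w + k * a / 2 / w := by ring
  linarith

/-! ### Orthonormality of the Laguerre functions -/

/-- The coefficient of `x ^ i` in the Laguerre polynomial, for `i ≤ n`. -/
def laguerreCoeff (β : ℝ) (n i : ℕ) : ℝ :=
  (-1) ^ i * Real.Gamma (n + β + 1) / (Real.Gamma (i + β + 1) * (n - i).factorial * i.factorial)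

lemma laguerrePoly_eq_sum_laguerreCoeff (β : ℝ) (n : ℕ) (x : ℝ) :
    laguerrePoly β n x = ∑ i ∈ Finset.range (n + 1), laguerreCoeff β n i * x ^ i := rfl

/-- The `i`-th power of `x ^ 2` times the orthogonality weight `2 x ^ (2β + 1) e ^ (-x²)` of the
functions `laguerrePoly β n (x ^ 2)`. -/
def laguerreMonomial (β : ℝ) (i : ℕ) (x : ℝ) : ℝ :=
  2 * (x ^ 2) ^ i * x ^ (2 * β + 1) * Real.exp (-x ^ 2)

lemma laguerreMonomial_eq {β x : ℝ} (i : ℕ) (hx : 0 < x) :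
    laguerreMonomial β i x = 2 * (x ^ (2 * i + (2 * β + 1)) * Real.exp (-1 * x ^ 2)) := by
  have hpow : x ^ (2 * i + (2 * β + 1)) = (x ^ 2) ^ i * x ^ (2 * β + 1) := by
    rw [Real.rpow_add hx, ← pow_mul, ← Real.rpow_natCast]
    push_cast
    rfl
  rw [laguerreMonomial, hpow, neg_one_mul]
  ring

lemma integrableOn_laguerreMonomial {β : ℝ} (hβ : -1 < β) (i : ℕ) :
    IntegrableOn (laguerreMonomial β i) (Ioi 0) :=
  IntegrableOn.congr_fun ((integrableOn_rpow_mul_exp_neg_mul_sq one_pos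
    (by linarith [i.cast_nonneg (α := ℝ)] : -1 < 2 * (i : ℝ) + (2 * β + 1))).const_mul 2)
    (fun _ hx => (laguerreMonomial_eq i hx).symm) measurableSet_Ioi

lemma integral_laguerreMonomial {β : ℝ} (hβ : -1 < β) (i : ℕ) :
    ∫ x in Ioi (0 : ℝ), laguerreMonomial β i x = Real.Gamma (i + β + 1) := by
  have hgauss := integral_rpow_mul_exp_neg_mul_rpow (q := 2 * (i : ℝ) + (2 * β + 1)) two_pos
    (by linarith [i.cast_nonneg (α := ℝ)]) one_pos
  simp only [Real.rpow_two] at hgauss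
  rw [setIntegral_congr_fun measurableSet_Ioi fun x hx => laguerreMonomial_eq i hx,
    integral_const_mul, hgauss, Real.one_rpow,
    show (2 * (i : ℝ) + (2 * β + 1) + 1) / 2 = i + β + 1 by ring]
  ring

lemma laguerreCoeff_mul_Gamma {β : ℝ} (hβ : -1 < β) {n i : ℕ} (hi : i ≤ n) :
    laguerreCoeff β n i * Real.Gamma (i + β + 1) =
      (-1) ^ n * Real.Gamma (n + β + 1) / n.factorial * ((-1) ^ (n - i) * n.choose i) := by
  have := Gamma_natCast_add_add_one_pos hβ i
  have hsign : (-1 : ℝ) ^ n * (-1) ^ (n - i) = (-1) ^ i := by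
    obtain ⟨k, rfl⟩ := Nat.exists_eq_add_of_le hi
    rw [Nat.add_sub_cancel_left, pow_add, mul_assoc, ← pow_add, Even.neg_one_pow ⟨k, rfl⟩, mul_one]
  rw [laguerreCoeff, Nat.cast_choose ℝ hi, ← hsign]
  field_simp

lemma sum_laguerreCoeff_mul_Gamma_mul_eval {β : ℝ} (hβ : -1 < β) (n : ℕ) (P : Polynomial ℝ) :
    ∑ i ∈ Finset.range (n + 1), laguerreCoeff β n i * Real.Gamma (i + β + 1) * P.eval (i : ℝ) =
      (-1) ^ n * Real.Gamma (n + β + 1) / n.factorial * (fwdDiff (1 : ℝ))^[n] P.eval 0 := by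
  rw [fwdDiff_iter_eq_sum_shift, Finset.mul_sum]
  refine Finset.sum_congr rfl fun i hi => ?_
  rw [laguerreCoeff_mul_Gamma hβ (Finset.mem_range_succ_iff.1 hi), zsmul_eq_mul, nsmul_one,
    zero_add]
  push_cast
  ring

lemma sum_laguerreCoeff_mul_Gamma {β : ℝ} (hβ : -1 < β) {n j : ℕ} (hj : j ≤ n) :
    ∑ i ∈ Finset.range (n + 1), laguerreCoeff β n i * Real.Gamma ((i + j : ℕ) + β + 1) =
      if j = n then (-1) ^ n * Real.Gamma (n + β + 1) else 0 := by
  set P : Polynomial ℝ := (ascPochhammer ℝ j).comp (Polynomial.X + Polynomial.C (β + 1)) with hP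
  have hmonic : P.Monic := (monic_ascPochhammer ℝ j).comp_X_add_C _
  have hdeg : P.natDegree = j := by
    rw [hP, Polynomial.natDegree_comp, ascPochhammer_natDegree, Polynomial.natDegree_X_add_C,
      mul_one]
  have hGamma : ∀ i : ℕ, Real.Gamma ((i + j : ℕ) + β + 1) =
      Real.Gamma (i + β + 1) * P.eval (i : ℝ) := fun i => by
    have := natCast_add_add_one_pos hβ i
    rw [show ((i + j : ℕ) : ℝ) + β + 1 = j + (i + β + 1) by push_cast; ring,
      Gamma_natCast_add_eq_ascPochhammer
        (fun k => (by linarith [k.cast_nonneg (α := ℝ)] : -(k : ℝ) < i + β + 1).ne'), hP,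
      Polynomial.eval_comp, Polynomial.eval_add, Polynomial.eval_X, Polynomial.eval_C, add_assoc,
      mul_comm]
  simp_rw [hGamma, ← mul_assoc]
  rw [sum_laguerreCoeff_mul_Gamma_mul_eval hβ]
  split_ifs with hjn
  · have hdiff := P.fwdDiff_iter_degree_eq_factorial
    rw [hdeg, hmonic.leadingCoeff, hjn] at hdiff
    rw [hdiff, one_smul, Pi.natCast_apply, div_mul_cancel₀ _ (by positivity)]
  · rw [Polynomial.fwdDiff_iter_eq_zero_of_degree_lt (by lia), Pi.zero_apply, mul_zero]

lemma laguerrePoly_mul_laguerreMonomial (β : ℝ) (n j : ℕ) (x : ℝ) :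
    laguerrePoly β n (x ^ 2) * laguerreMonomial β j x =
      ∑ i ∈ Finset.range (n + 1), laguerreCoeff β n i * laguerreMonomial β (i + j) x := by
  rw [laguerrePoly_eq_sum_laguerreCoeff, Finset.sum_mul]
  refine Finset.sum_congr rfl fun i _ => ?_
  simp only [laguerreMonomial, pow_add]
  ring

lemma integrableOn_laguerrePoly_mul_laguerreMonomial {β : ℝ} (hβ : -1 < β) (n j : ℕ) :
    IntegrableOn (fun x => laguerrePoly β n (x ^ 2) * laguerreMonomial β j x) (Ioi 0) := by
  simp_rw [laguerrePoly_mul_laguerreMonomial]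
  exact integrable_finsetSum _ fun i _ => (integrableOn_laguerreMonomial hβ _).const_mul _

lemma integral_laguerrePoly_mul_laguerreMonomial {β : ℝ} (hβ : -1 < β) {n j : ℕ} (hj : j ≤ n) :
    ∫ x in Ioi (0 : ℝ), laguerrePoly β n (x ^ 2) * laguerreMonomial β j x =
      if j = n then (-1) ^ n * Real.Gamma (n + β + 1) else 0 := by
  simp_rw [laguerrePoly_mul_laguerreMonomial]
  rw [integral_finsetSum _ fun i _ => (integrableOn_laguerreMonomial hβ _).const_mul _,
    ← sum_laguerreCoeff_mul_Gamma hβ hj]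
  simp_rw [integral_const_mul, integral_laguerreMonomial hβ]

lemma hermiteFun₁_mul_eq_sum_laguerreMonomial {x : ℝ} (hx : 0 < x) (β : ℝ) (n m : ℕ) :
    hermiteFun₁ β n x * hermiteFun₁ β m x =
      ∑ j ∈ Finset.range (m + 1), √(laguerreWeight β n) * √(laguerreWeight β m) *
        laguerreCoeff β m j * (laguerrePoly β n (x ^ 2) * laguerreMonomial β j x) := by
  have hpow : x ^ (2 * β + 1) = x ^ (β + 1 / 2) * x ^ (β + 1 / 2) := by
    rw [← Real.rpow_add hx]
    ring_nf
  have hexp : Real.exp (-x ^ 2) = Real.exp (-x ^ 2 / 2) * Real.exp (-x ^ 2 / 2) := by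
    rw [← Real.exp_add]
    ring_nf
  calc hermiteFun₁ β n x * hermiteFun₁ β m x
      = √(laguerreWeight β n) * √(laguerreWeight β m) * laguerrePoly β n (x ^ 2) *
        (√2 * √2 * x ^ (2 * β + 1) * Real.exp (-x ^ 2)) * laguerrePoly β m (x ^ 2) := by
        rw [hpow, hexp]
        simp only [hermiteFun₁, laguerrePolyNormalized, laguerreWeight]
        ring
    _ = ∑ j ∈ Finset.range (m + 1), √(laguerreWeight β n) * √(laguerreWeight β m) *
        laguerreCoeff β m j * (laguerrePoly β n (x ^ 2) * laguerreMonomial β j x) := by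
        rw [Real.mul_self_sqrt zero_le_two, laguerrePoly_eq_sum_laguerreCoeff β m, Finset.mul_sum]
        refine Finset.sum_congr rfl fun j _ => ?_
        rw [laguerreMonomial]
        ring

lemma laguerreWeight_mul_laguerreCoeff_self {β : ℝ} (hβ : -1 < β) (n : ℕ) :
    laguerreWeight β n * laguerreCoeff β n n * ((-1) ^ n * Real.Gamma (n + β + 1)) = 1 := by
  have := Gamma_natCast_add_add_one_pos hβ n
  have hsign : (-1 : ℝ) ^ n * (-1) ^ n = 1 := by rw [← pow_add, Even.neg_one_pow ⟨n, rfl⟩]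
  rw [laguerreWeight, laguerreCoeff, Real.Gamma_nat_eq_factorial, Nat.sub_self, Nat.factorial_zero,
    Nat.cast_one, mul_one]
  field_simp
  linear_combination hsign

lemma integral_hermiteFun₁_mul_of_le {β : ℝ} (hβ : -1 < β) {n m : ℕ} (hmn : m ≤ n) :
    ∫ x in Ioi (0 : ℝ), hermiteFun₁ β n x * hermiteFun₁ β m x = if n = m then 1 else 0 := by
  rw [setIntegral_congr_fun measurableSet_Ioi fun x hx =>
      hermiteFun₁_mul_eq_sum_laguerreMonomial hx β n m,
    integral_finsetSum _ fun j _ =>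
      (integrableOn_laguerrePoly_mul_laguerreMonomial hβ n j).const_mul _]
  simp_rw [integral_const_mul]
  rw [Finset.sum_congr rfl fun j hj => by rw [integral_laguerrePoly_mul_laguerreMonomial hβ
    ((Finset.mem_range_succ_iff.1 hj).trans hmn)]]
  split_ifs with h
  · rw [h, Finset.sum_range_succ, Finset.sum_eq_zero fun j hj => by
        rw [if_neg (Finset.mem_range.1 hj).ne, mul_zero],
      if_pos rfl, zero_add, Real.mul_self_sqrt (laguerreWeight_pos hβ m).le,
      laguerreWeight_mul_laguerreCoeff_self hβ]
  · refine Finset.sum_eq_zero fun j hj => ?_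
    have hjm := Finset.mem_range_succ_iff.1 hj
    rw [if_neg (by lia), mul_zero]

lemma integral_hermiteFun₁_mul {β : ℝ} (hβ : -1 < β) (n m : ℕ) :
    ∫ x in Ioi (0 : ℝ), hermiteFun₁ β n x * hermiteFun₁ β m x = if n = m then 1 else 0 := by
  rcases le_total m n with h | h
  · exact integral_hermiteFun₁_mul_of_le hβ h
  · simp_rw [mul_comm (hermiteFun₁ β n _), eq_comm (a := n)]
    exact integral_hermiteFun₁_mul_of_le hβ h

lemma integral_hermiteFun_mul {β : Fin d → ℝ} (hβ : ∀ i, -1 < β i) (k l : Fin d → ℕ) :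
    ∫ x, hermiteFun β k x * hermiteFun β l x ∂(orthantMeasure d) = if k = l then 1 else 0 := by
  rw [orthantMeasure_eq_pi]
  simp only [hermiteFun, ← Finset.prod_mul_distrib]
  rw [integral_fintype_prod_eq_prod fun i x =>
    hermiteFun₁ (β i) (k i) x * hermiteFun₁ (β i) (l i) x]
  simp_rw [fun i => integral_hermiteFun₁_mul (hβ i) (k i) (l i)]
  split_ifs with h
  · exact Finset.prod_eq_one fun i _ => if_pos (congrFun h i)
  · obtain ⟨i, hi⟩ := Function.ne_iff.1 h
    exact Finset.prod_eq_zero (Finset.mem_univ i) (if_neg hi)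

/-! ### The heat kernel in several dimensions -/

lemma hasSum_pi_prod {κ : Type*} {f : Fin d → κ → ℝ} {a : Fin d → ℝ}
    (h : ∀ i, HasSum (f i) (a i)) :
    HasSum (fun k : Fin d → κ => ∏ i, f i (k i)) (∏ i, a i) := by
  induction d with
  | zero => simp
  | succ d ih =>
    set g : (Fin d → κ) → ℝ := fun k => ∏ i, f (Fin.succ i) (k i) with hg
    have htail : HasSum g (∏ i : Fin d, a i.succ) := ih fun i => h i.succ
    have hmul : HasSum (fun p : κ × (Fin d → κ) => f 0 p.1 * g p.2) (a 0 * ∏ i : Fin d, a i.succ) :=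
      HasSum.mul (f := f 0) (g := g) (h 0) htail
        (summable_mul_of_summable_norm (h 0).summable.norm htail.summable.norm)
    have hcons : (fun k : Fin (d + 1) → κ => ∏ i, f i (k i)) ∘ Fin.consEquiv (fun _ => κ) =
        fun p : κ × (Fin d → κ) => f 0 p.1 * g p.2 := by
      funext p
      simp [hg, Fin.consEquiv, Fin.prod_univ_succ]
    rwa [← (Fin.consEquiv fun _ => κ).hasSum_iff, Fin.prod_univ_succ, hcons]

lemma lintegral_pi_prod {E : Type*} [MeasurableSpace E] {μ : Fin d → Measure E}
    [∀ i, SigmaFinite (μ i)] {f : Fin d → E → ℝ≥0∞} (hf : ∀ i, Measurable (f i)) :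
    ∫⁻ x, ∏ i, f i (x i) ∂(Measure.pi μ) = ∏ i, ∫⁻ x, f i x ∂(μ i) := by
  induction d with
  | zero => simp
  | succ d ih =>
    have hmeas : Measurable fun x : Fin d → E => ∏ i, f i.succ (x i) := by fun_prop
    calc ∫⁻ x, ∏ i, f i (x i) ∂(Measure.pi μ)
        = ∫⁻ x : E × (Fin d → E), f 0 x.1 * ∏ i : Fin d, f i.succ (x.2 i)
          ∂((μ 0).prod (Measure.pi fun i => μ i.succ)) := by
          rw [← ((measurePreserving_piFinSuccAbove μ 0).symm).lintegral_comp_emb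
            (MeasurableEquiv.measurableEmbedding _)]
          simp_rw [MeasurableEquiv.piFinSuccAbove_symm_apply, Fin.insertNthEquiv,
            Fin.prod_univ_succ, Fin.insertNth_zero, Equiv.coe_fn_mk, Fin.cons_succ,
            Fin.zero_succAbove, cast_eq, Fin.cons_zero]
      _ = ∏ i, ∫⁻ x, f i x ∂(μ i) := by
          rw [lintegral_prod_mul (hf 0).aemeasurable hmeas.aemeasurable,
            ih fun i => hf i.succ, Fin.prod_univ_succ]

/-- The heat kernel of the Hermite type Laguerre operator, as the product of its one-dimensional
closed forms. -/
def laguerreKernel (β : Fin d → ℝ) (t : ℝ) (x y : Fin d → ℝ) : ℝ :=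
  ∏ i, laguerreKernel₁ (β i) t (x i) (y i)

lemma exp_neg_mul_hermiteEigenvalue (β : Fin d → ℝ) (t : ℝ) (k : Fin d → ℕ) :
    Real.exp (-t * hermiteEigenvalue β k) = ∏ i, Real.exp (-t * (4 * k i + 2 * β i + 2)) := by
  rw [← Real.exp_sum, ← Finset.mul_sum, hermiteEigenvalue]
  simp only [Finset.sum_add_distrib, Finset.mul_sum, Finset.sum_const, Finset.card_univ,
    Fintype.card_fin, nsmul_eq_mul, mul_comm (d : ℝ)]

lemma hasSum_hermiteKernelTerm {β : Fin d → ℝ} (hβ : ∀ i, -1 < β i) {t : ℝ} (ht : 0 < t)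
    (x y : Fin d → ℝ) :
    HasSum (hermiteKernelTerm β t x y) (laguerreKernel β t x y) := by
  have hterm : hermiteKernelTerm β t x y = fun k => ∏ i, Real.exp (-t * (4 * k i + 2 * β i + 2)) *
      (hermiteFun₁ (β i) (k i) (x i) * hermiteFun₁ (β i) (k i) (y i)) := by
    funext k
    simp only [hermiteKernelTerm, exp_neg_mul_hermiteEigenvalue, hermiteFun,
      Finset.prod_mul_distrib]
  have hprod := hasSum_pi_prod fun i => hasSum_laguerreKernel₁ (hβ i) ht (x i) (y i)
  rw [hterm]
  exact hprod

lemma hermiteKernel_eq_laguerreKernel {β : Fin d → ℝ} (hβ : ∀ i, -1 < β i) {t : ℝ} (ht : 0 < t)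
    (x y : Fin d → ℝ) : hermiteKernel β t x y = laguerreKernel β t x y :=
  (hasSum_hermiteKernelTerm hβ ht x y).tsum_eq

lemma summable_exp_mul_abs_hermiteFun₁ {β : ℝ} (hβ : -1 < β) {t : ℝ} (ht : 0 < t) (x : ℝ) :
    Summable fun n : ℕ => Real.exp (-t * (4 * n + 2 * β + 2)) * |hermiteFun₁ β n x| := by
  have hlt : Real.exp (-t * 4) < 1 := Real.exp_lt_one_iff.2 (by linarith)
  refine ((isSubexp_hermiteFun₁ hβ x _ (Real.exp_pos _) hlt).mul_left
    (Real.exp (-t * (2 * β + 2)))).congr fun n => ?_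
  rw [show -t * (4 * n + 2 * β + 2) = -t * (2 * β + 2) + n * (-t * 4) by ring, Real.exp_add,
    Real.exp_nat_mul]
  ring

lemma summable_exp_mul_abs_hermiteFun {β : Fin d → ℝ} (hβ : ∀ i, -1 < β i) {t : ℝ} (ht : 0 < t)
    (x : Fin d → ℝ) :
    Summable fun k => Real.exp (-t * hermiteEigenvalue β k) * |hermiteFun β k x| := by
  refine (hasSum_pi_prod fun i =>
    (summable_exp_mul_abs_hermiteFun₁ (hβ i) ht (x i)).hasSum).summable.congr fun k => ?_
  simp only [exp_neg_mul_hermiteEigenvalue, hermiteFun, Finset.abs_prod, Finset.prod_mul_distrib]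

lemma laguerreKernel_comm (β : Fin d → ℝ) (t : ℝ) (x y : Fin d → ℝ) :
    laguerreKernel β t x y = laguerreKernel β t y x :=
  Finset.prod_congr rfl fun _ _ => laguerreKernel₁_comm _ _ _ _

lemma laguerreKernel_nonneg {β : Fin d → ℝ} (hβ : ∀ i, -1 < β i) {t : ℝ} (ht : 0 < t)
    {x y : Fin d → ℝ} (hx : x ∈ orthant d) (hy : y ∈ orthant d) : 0 ≤ laguerreKernel β t x y :=
  Finset.prod_nonneg fun i _ => laguerreKernel₁_nonneg (hβ i) ht (hx i).le (hy i).le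

lemma measurable_laguerreKernel {β : Fin d → ℝ} (hβ : ∀ i, -1 < β i) (t : ℝ) :
    Measurable fun p : (Fin d → ℝ) × (Fin d → ℝ) => laguerreKernel β t p.1 p.2 :=
  Finset.measurable_fun_prod _ fun i _ => (measurable_laguerreKernel₁ (hβ i) t).comp
    (f := fun p : (Fin d → ℝ) × (Fin d → ℝ) => (p.1 i, p.2 i)) (by fun_prop)

lemma exists_laguerreKernel_le {β : Fin d → ℝ} (hβ : ∀ i, -1 / 2 ≤ β i) {t : ℝ} (ht : 0 < t)
    {x : Fin d → ℝ} (hx : x ∈ orthant d) :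
    ∃ M, ∀ y ∈ orthant d, laguerreKernel β t x y ≤ M := by
  choose M _ hM using fun i => exists_laguerreKernel₁_le (hβ i) ht (hx i)
  exact ⟨∏ i, M i, fun y hy => Finset.prod_le_prod (fun i _ => laguerreKernel₁_nonneg
    (by linarith [hβ i]) ht (hx i).le (hy i).le) fun i _ => hM i (y i) (hy i)⟩

/-- The mass of the one-dimensional heat kernel, computed in `lintegral_laguerreKernel₁`. -/
def laguerreKernelMass (β t x : ℝ) : ℝ≥0∞ :=
  ∫⁻ y in Ioi (0 : ℝ), ENNReal.ofReal (laguerreKernel₁ β t x y)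

lemma measurableSet_orthant (d : ℕ) : MeasurableSet (orthant d) := by
  rw [orthant, ofPred_forall]
  exact MeasurableSet.iInter fun i => measurableSet_lt measurable_const (measurable_pi_apply i)

lemma ae_mem_orthant (d : ℕ) : ∀ᵐ x ∂(orthantMeasure d), x ∈ orthant d :=
  ae_restrict_mem (measurableSet_orthant d)

lemma lintegral_laguerreKernel {β : Fin d → ℝ} (hβ : ∀ i, -1 < β i) {t : ℝ} (ht : 0 < t)
    {x : Fin d → ℝ} (hx : x ∈ orthant d) :
    ∫⁻ y, ENNReal.ofReal (laguerreKernel β t x y) ∂(orthantMeasure d) =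
      ∏ i, laguerreKernelMass (β i) t (x i) := by
  have hmeas : ∀ i, Measurable fun y => ENNReal.ofReal (laguerreKernel₁ (β i) t (x i) y) := fun i =>
    ((measurable_laguerreKernel₁ (hβ i) t).comp measurable_prodMk_left).ennreal_ofReal
  simp only [laguerreKernelMass]
  rw [← lintegral_pi_prod hmeas, ← orthantMeasure_eq_pi]
  refine lintegral_congr_ae ?_
  filter_upwards [ae_mem_orthant d] with y hy
  exact ENNReal.ofReal_prod_of_nonneg fun i _ =>
    laguerreKernel₁_nonneg (hβ i) ht (hx i).le (hy i).le

/-! ### Completeness of the Laguerre functions -/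

lemma integral_eq_of_mem_span {X : Type*} [TopologicalSpace X] [MeasurableSpace X]
    [OpensMeasurableSpace X] {P Q : Measure X} [IsFiniteMeasure P] [IsFiniteMeasure Q]
    {S : Set (BoundedContinuousFunction X ℝ)} (h : ∀ f ∈ S, ∫ x, f x ∂P = ∫ x, f x ∂Q)
    {g : BoundedContinuousFunction X ℝ} (hg : g ∈ Submodule.span ℝ S) :
    ∫ x, g x ∂P = ∫ x, g x ∂Q := by
  induction hg using Submodule.span_induction with
  | mem f hf => exact h f hf
  | zero => simp only [BoundedContinuousFunction.coe_zero, Pi.zero_apply, integral_zero]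
  | add f g _ _ hf hg =>
    simp only [BoundedContinuousFunction.coe_add, Pi.add_apply]
    rw [integral_add (f.integrable P) (g.integrable P),
      integral_add (f.integrable Q) (g.integrable Q), hf, hg]
  | smul c f _ hf =>
    simp only [BoundedContinuousFunction.coe_smul]
    rw [integral_smul, integral_smul, hf]

/-- The function `y ↦ ∏ i, exp (-N i * (y i) ^ 2)`, on `[0, ∞)^d` because such functions separate
the points there but not on `ℝ^d`. -/
def gaussianMonomial (N : Fin d → ℕ) : BoundedContinuousFunction (Fin d → NNReal) ℝ :=
  BoundedContinuousFunction.ofNormedAddCommGroup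
    (fun y => ∏ i, Real.exp (-(N i * (y i : ℝ) ^ 2))) (by fun_prop) 1 fun y => by
      rw [Real.norm_of_nonneg (by positivity)]
      exact Finset.prod_le_one (fun i _ => by positivity) fun i _ =>
        Real.exp_le_one_iff.2 (neg_nonpos.2 (by positivity))

lemma gaussianMonomial_apply (N : Fin d → ℕ) (y : Fin d → NNReal) :
    gaussianMonomial N y = ∏ i, Real.exp (-(N i * (y i : ℝ) ^ 2)) := rfl

lemma gaussianMonomial_single (i : Fin d) (y : Fin d → NNReal) :
    gaussianMonomial (Pi.single i 1) y = Real.exp (-(y i : ℝ) ^ 2) := by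
  rw [gaussianMonomial_apply, Finset.prod_eq_single i]
  · simp
  · intro j _ hj
    simp [hj]
  · simp

lemma exists_gaussianMonomial_ne {y z : Fin d → NNReal} (hyz : y ≠ z) :
    ∃ N, gaussianMonomial N y ≠ gaussianMonomial N z := by
  obtain ⟨i, hi⟩ := Function.ne_iff.1 hyz
  refine ⟨Pi.single i 1, fun h => hi (NNReal.coe_injective ?_)⟩
  rw [gaussianMonomial_single, gaussianMonomial_single] at h
  exact (sq_eq_sq₀ (y i).coe_nonneg (z i).coe_nonneg).1 (neg_injective (Real.exp_injective h))

/-- The multiplicative monoid of the functions `gaussianMonomial N`. -/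
def gaussianMonomials (d : ℕ) : Submonoid (BoundedContinuousFunction (Fin d → NNReal) ℝ) where
  carrier := range gaussianMonomial
  one_mem' := ⟨0, by ext y; simp [gaussianMonomial_apply]⟩
  mul_mem' := by
    rintro _ _ ⟨N, rfl⟩ ⟨M, rfl⟩
    refine ⟨N + M, ?_⟩
    ext y
    simp only [BoundedContinuousFunction.mul_apply, gaussianMonomial_apply,
      ← Finset.prod_mul_distrib, ← Real.exp_add, Pi.add_apply, Nat.cast_add]
    exact Finset.prod_congr rfl fun i _ => by ring_nf

/-- The algebra generated by the functions `gaussianMonomial N`. -/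
def gaussianAlgebra (d : ℕ) : StarSubalgebra ℝ (BoundedContinuousFunction (Fin d → NNReal) ℝ) where
  toSubalgebra := Algebra.adjoin ℝ (gaussianMonomials d : Set _)
  star_mem' {a} ha := by
    have hstar : star a = a := by ext y; simp
    rwa [hstar]

lemma mem_gaussianAlgebra {g : BoundedContinuousFunction (Fin d → NNReal) ℝ} :
    g ∈ gaussianAlgebra d ↔ g ∈ Submodule.span ℝ (range (gaussianMonomial (d := d))) := by
  have hspan := Algebra.adjoin_eq_span ℝ
    (gaussianMonomials d : Set (BoundedContinuousFunction (Fin d → NNReal) ℝ))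
  rw [Submonoid.closure_eq] at hspan
  change g ∈ Subalgebra.toSubmodule (Algebra.adjoin ℝ (gaussianMonomials d : Set _)) ↔ _
  rw [hspan]
  rfl

lemma measure_eq_of_integral_gaussianMonomial_eq {P Q : Measure (Fin d → NNReal)}
    [IsFiniteMeasure P] [IsFiniteMeasure Q]
    (h : ∀ N, ∫ y, gaussianMonomial N y ∂P = ∫ y, gaussianMonomial N y ∂Q) : P = Q := by
  refine ext_of_forall_mem_subalgebra_integral_eq_of_pseudoEMetric_complete_countable
    (𝕜 := ℝ) (A := gaussianAlgebra d) ?_ fun g hg => ?_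
  · intro y z hyz
    obtain ⟨N, hN⟩ := exists_gaussianMonomial_ne hyz
    exact ⟨gaussianMonomial N, ⟨(gaussianMonomial N).toContinuousMap, ⟨gaussianMonomial N,
      mem_gaussianAlgebra.2 (Submodule.subset_span ⟨N, rfl⟩), rfl⟩, rfl⟩, hN⟩
  · refine integral_eq_of_mem_span ?_ (mem_gaussianAlgebra.1 hg)
    rintro _ ⟨N, rfl⟩
    exact h N

section SignedDensity

variable {X Y : Type*} [MeasurableSpace X] [MeasurableSpace Y] {μ : Measure X} {v : X → ℝ}

lemma ae_eq_zero_of_withDensity_ofReal_eq (hv : Integrable v μ)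
    (h : μ.withDensity (fun x => ENNReal.ofReal (v x)) =
      μ.withDensity fun x => ENNReal.ofReal (-v x)) : v =ᵐ[μ] 0 := by
  have hneg : Integrable (fun x => -v x) μ := hv.neg
  filter_upwards [(withDensity_eq_iff hv.aemeasurable.ennreal_ofReal
    hneg.aemeasurable.ennreal_ofReal hv.lintegral_lt_top.ne).1 h] with x hx
  have hparts := congrArg ENNReal.toReal hx
  rwa [ENNReal.toReal_ofReal', ENNReal.toReal_ofReal', ← sub_eq_zero,
    max_zero_sub_max_neg_zero_eq_self] at hparts

lemma integral_withDensity_ofReal_sub (hv : Integrable v μ) {g : X → ℝ}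
    (hg : AEStronglyMeasurable g μ) {c : ℝ} (hgc : ∀ x, |g x| ≤ c) :
    (∫ x, g x ∂(μ.withDensity fun x => ENNReal.ofReal (v x))) -
      ∫ x, g x ∂(μ.withDensity fun x => ENNReal.ofReal (-v x)) = ∫ x, v x * g x ∂μ := by
  have hneg : Integrable (fun x => -v x) μ := hv.neg
  have hpart {w : X → ℝ} (hw : Integrable w μ) :
      Integrable (fun x => (ENNReal.ofReal (w x)).toReal • g x) μ :=
    (integrable_toReal_of_lintegral_ne_top hw.aemeasurable.ennreal_ofReal
      hw.lintegral_lt_top.ne).mul_bdd hg (Eventually.of_forall hgc)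
  rw [integral_withDensity_eq_integral_toReal_smul₀ hv.aemeasurable.ennreal_ofReal
      (Eventually.of_forall fun _ => ENNReal.ofReal_lt_top),
    integral_withDensity_eq_integral_toReal_smul₀ hneg.aemeasurable.ennreal_ofReal
      (Eventually.of_forall fun _ => ENNReal.ofReal_lt_top), ← integral_sub (hpart hv) (hpart hneg)]
  refine integral_congr_ae (Eventually.of_forall fun x => ?_)
  simp only [ENNReal.toReal_ofReal', smul_eq_mul, ← sub_mul, max_zero_sub_max_neg_zero_eq_self]

lemma measure_eq_of_map_eq {P Q : Measure X} {Φ : X → Y} {Ψ : Y → X} (hΦ : Measurable Φ)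
    (hΨ : Measurable Ψ) (hP : ∀ᵐ x ∂P, Ψ (Φ x) = x) (hQ : ∀ᵐ x ∂Q, Ψ (Φ x) = x)
    (h : P.map Φ = Q.map Φ) : P = Q := by
  have hback {ν : Measure X} (hν : ∀ᵐ x ∂ν, Ψ (Φ x) = x) : (ν.map Φ).map Ψ = ν := by
    have hid : Ψ ∘ Φ =ᵐ[ν] id := hν
    rw [Measure.map_map hΨ hΦ, Measure.map_congr hid, Measure.map_id]
  rw [← hback hP, ← hback hQ, h]

end SignedDensity

lemma ae_eq_zero_of_integral_mul_gaussian_eq_zero {v : (Fin d → ℝ) → ℝ}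
    (hv : Integrable v (orthantMeasure d))
    (h : ∀ N : Fin d → ℕ,
      ∫ x, v x * ∏ i, Real.exp (-(N i * x i ^ 2)) ∂(orthantMeasure d) = 0) :
    v =ᵐ[orthantMeasure d] 0 := by
  let Φ : (Fin d → ℝ) → (Fin d → NNReal) := fun x i => (x i).toNNReal
  let Ψ : (Fin d → NNReal) → (Fin d → ℝ) := fun y i => y i
  have hΦ : Measurable Φ := by fun_prop
  have hΨ : Measurable Ψ := by fun_prop
  have hinv : ∀ᵐ x ∂(orthantMeasure d), Ψ (Φ x) = x := by
    filter_upwards [ae_mem_orthant d] with x hx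
    exact funext fun i => Real.coe_toNNReal _ (hx i).le
  have := isFiniteMeasure_withDensity_ofReal hv.2
  have := isFiniteMeasure_withDensity_ofReal hv.neg.2
  refine ae_eq_zero_of_withDensity_ofReal_eq hv (measure_eq_of_map_eq hΦ hΨ
    ((withDensity_absolutelyContinuous _ _).ae_le hinv)
    ((withDensity_absolutelyContinuous _ _).ae_le hinv)
    (measure_eq_of_integral_gaussianMonomial_eq fun N => ?_))
  have hmeas := (gaussianMonomial N).continuous.measurable
  rw [integral_map hΦ.aemeasurable hmeas.aestronglyMeasurable,
    integral_map hΦ.aemeasurable hmeas.aestronglyMeasurable, ← sub_eq_zero,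
    integral_withDensity_ofReal_sub (g := fun x => gaussianMonomial N (Φ x)) hv
      (hmeas.comp hΦ).aestronglyMeasurable
      fun x => (gaussianMonomial N).norm_coe_le_norm (Φ x), ← h N]
  refine integral_congr_ae ?_
  filter_upwards [hinv] with x hx
  have hcoord (i : Fin d) : (Φ x i : ℝ) = x i := congrFun hx i
  simp only [gaussianMonomial_apply, hcoord]

lemma hermiteFun₁_zero {β : ℝ} (hβ : -1 < β) (x : ℝ) :
    hermiteFun₁ β 0 x = √2 * √(laguerreWeight β 0) * (x ^ (β + 1 / 2) * Real.exp (-x ^ 2 / 2)) := by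
  have : 0 < Real.Gamma (β + 1) := Real.Gamma_pos_of_pos (by linarith)
  simp [hermiteFun₁, laguerrePolyNormalized, laguerrePoly, laguerreWeight, this.ne']
  ring

lemma hermiteFun_zero_pos {β : Fin d → ℝ} (hβ : ∀ i, -1 < β i) {x : Fin d → ℝ}
    (hx : x ∈ orthant d) : 0 < hermiteFun β 0 x :=
  Finset.prod_pos fun i _ => by
    have := hx i
    have := laguerreWeight_pos (hβ i) 0
    rw [Pi.zero_apply, hermiteFun₁_zero (hβ i)]
    positivity

/-- The coefficients of `φ_0^β(x) exp (-N x²)` in the Laguerre functions: the generating function of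
the Laguerre polynomials at `r = N / (N + 1)`, where `r / (1 - r) = N`. -/
def gaussianCoeff (β : ℝ) (N n : ℕ) : ℝ :=
  √(laguerreWeight β 0) * (1 / (N + 1) : ℝ) ^ (β + 1) *
    ((N / (N + 1) : ℝ) ^ n * √(laguerreWeight β n)⁻¹)

lemma gaussianCoeff_nonneg (β : ℝ) (N n : ℕ) : 0 ≤ gaussianCoeff β N n := by
  rw [gaussianCoeff]
  positivity

lemma summable_gaussianCoeff {β : ℝ} (hβ : -1 < β) (N : ℕ) : Summable (gaussianCoeff β N) := by
  have hle : (N / (N + 1) : ℝ) ≤ (N + 1) / (N + 2) := by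
    rw [div_le_div_iff₀ (by positivity) (by positivity)]
    nlinarith
  have hsum := (isSubexp_inv_laguerreWeight hβ).sqrt ((N + 1) / (N + 2)) (by positivity)
    (by rw [div_lt_one (by positivity)]; linarith)
  refine Summable.mul_left _ (hsum.of_nonneg_of_le (fun n => by positivity) fun n => ?_)
  rw [mul_comm, abs_of_nonneg (Real.sqrt_nonneg _)]
  gcongr

lemma gaussianCoeff_mul_hermiteFun₁ {β : ℝ} (hβ : -1 < β) (N n : ℕ) (x : ℝ) :
    gaussianCoeff β N n * hermiteFun₁ β n x =
      √(laguerreWeight β 0) * (1 / (N + 1) : ℝ) ^ (β + 1) *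
        (√2 * x ^ (β + 1 / 2) * Real.exp (-x ^ 2 / 2)) *
        (laguerrePoly β n (x ^ 2) * (N / (N + 1) : ℝ) ^ n) := by
  have hweight : √(laguerreWeight β n)⁻¹ * √(laguerreWeight β n) = 1 := by
    rw [Real.sqrt_inv]
    exact inv_mul_cancel₀ (Real.sqrt_pos.2 (laguerreWeight_pos hβ n)).ne'
  rw [gaussianCoeff, hermiteFun₁, laguerrePolyNormalized, ← laguerreWeight]
  linear_combination √(laguerreWeight β 0) * (1 / (N + 1) : ℝ) ^ (β + 1) *
    (N / (N + 1) : ℝ) ^ n * √2 * laguerrePoly β n (x ^ 2) * x ^ (β + 1 / 2) *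
    Real.exp (-x ^ 2 / 2) * hweight

lemma hasSum_gaussianCoeff {β : ℝ} (hβ : -1 < β) (N : ℕ) (x : ℝ) :
    HasSum (fun n => gaussianCoeff β N n * hermiteFun₁ β n x)
      (hermiteFun₁ β 0 x * Real.exp (-(N * x ^ 2))) := by
  have hsub : (1 : ℝ) - N / (N + 1) = 1 / (N + 1) := by field_simp; ring
  have hlt : |(N / (N + 1) : ℝ)| < 1 := by
    rw [abs_of_nonneg (by positivity), div_lt_one (by positivity)]
    linarith
  have hpow : (1 / (N + 1) : ℝ) ^ (β + 1) * (1 / (N + 1) : ℝ) ^ (-(β + 1)) = 1 := by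
    rw [← Real.rpow_add (by positivity), add_neg_cancel, Real.rpow_zero]
  have hexponent : x ^ 2 * (N / (N + 1) : ℝ) / (1 / (N + 1)) = N * x ^ 2 := by field_simp
  simp_rw [gaussianCoeff_mul_hermiteFun₁ hβ]
  convert! (hasSum_laguerrePoly_mul_pow hβ (x ^ 2) hlt).mul_left _ using 1
  rw [hermiteFun₁_zero hβ, laguerreGenFun, hsub, hexponent]
  linear_combination -(√(laguerreWeight β 0) * (√2 * x ^ (β + 1 / 2) * Real.exp (-x ^ 2 / 2)) *
    Real.exp (-(N * x ^ 2))) * hpow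

lemma hasSum_prod_gaussianCoeff_mul_hermiteFun {β : Fin d → ℝ} (hβ : ∀ i, -1 < β i)
    (N : Fin d → ℕ) (x : Fin d → ℝ) :
    HasSum (fun k : Fin d → ℕ => (∏ i, gaussianCoeff (β i) (N i) (k i)) * hermiteFun β k x)
      (hermiteFun β 0 x * ∏ i, Real.exp (-(N i * x i ^ 2))) := by
  have hprod := hasSum_pi_prod fun i => hasSum_gaussianCoeff (hβ i) (N i) (x i)
  simp only [Finset.prod_mul_distrib] at hprod
  exact hprod

lemma integral_hermiteFun_sq {β : Fin d → ℝ} (hβ : ∀ i, -1 < β i) (k : Fin d → ℕ) :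
    ∫ x, hermiteFun β k x ^ 2 ∂(orthantMeasure d) = 1 := by
  simp_rw [sq]
  rw [integral_hermiteFun_mul hβ, if_pos rfl]

lemma integral_abs_mul_le_of_memLp_two {X : Type*} [MeasurableSpace X] {μ : Measure X}
    {f g : X → ℝ} (hf : MemLp f 2 μ) (hg : MemLp g 2 μ) :
    ∫ x, |f x * g x| ∂μ ≤ ((∫ x, f x ^ 2 ∂μ) + ∫ x, g x ^ 2 ∂μ) / 2 := by
  rw [← integral_add hf.integrable_sq hg.integrable_sq, ← integral_div]
  refine integral_mono (hf.integrable_mul hg).abs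
    ((hf.integrable_sq.add hg.integrable_sq).div_const 2) fun x => ?_
  simp only [abs_mul]
  nlinarith [sq_nonneg (|f x| - |g x|), sq_abs (f x), sq_abs (g x)]

lemma integral_hermiteFun_zero_mul_gaussian_eq_zero {β : Fin d → ℝ} (hβ : ∀ i, -1 < β i)
    {u : (Fin d → ℝ) → ℝ} (hu : MemLp u 2 (orthantMeasure d))
    (h : ∀ k, ∫ x, hermiteFun β k x * u x ∂(orthantMeasure d) = 0) (N : Fin d → ℕ) :
    ∫ x, hermiteFun β 0 x * u x * ∏ i, Real.exp (-(N i * x i ^ 2)) ∂(orthantMeasure d) = 0 := by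
  set c : (Fin d → ℕ) → ℝ := fun k => ∏ i, gaussianCoeff (β i) (N i) (k i)
  have hc : Summable c :=
    (hasSum_pi_prod fun i => (summable_gaussianCoeff (hβ i) (N i)).hasSum).summable
  have hc0 (k : Fin d → ℕ) : 0 ≤ c k := Finset.prod_nonneg fun i _ => gaussianCoeff_nonneg _ _ _
  have hexpand (x : Fin d → ℝ) : HasSum (fun k => c k * (hermiteFun β k x * u x))
      (hermiteFun β 0 x * u x * ∏ i, Real.exp (-(N i * x i ^ 2))) := by
    simpa only [mul_assoc, mul_comm (u x)] using
      (hasSum_prod_gaussianCoeff_mul_hermiteFun hβ N x).mul_right (u x)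
  have hnorm (k : Fin d → ℕ) : ∫ x, ‖c k * (hermiteFun β k x * u x)‖ ∂(orthantMeasure d) ≤
      c k * ((1 + ∫ x, u x ^ 2 ∂(orthantMeasure d)) / 2) := by
    simp_rw [norm_mul (c k)]
    rw [integral_const_mul, Real.norm_of_nonneg (hc0 k), ← integral_hermiteFun_sq hβ k]
    exact mul_le_mul_of_nonneg_left
      (integral_abs_mul_le_of_memLp_two (memLp_hermiteFun hβ k) hu) (hc0 k)
  have hsum := hasSum_integral_of_summable_integral_norm
    (F := fun k x => c k * (hermiteFun β k x * u x))
    (fun k => ((memLp_hermiteFun hβ k).integrable_mul hu).const_mul _)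
    ((hc.mul_right _).of_nonneg_of_le (fun k => integral_nonneg fun x => norm_nonneg _) hnorm)
  simp_rw [integral_const_mul, h, mul_zero, (hexpand _).tsum_eq] at hsum
  exact hsum.unique hasSum_zero

lemma ae_eq_zero_of_integral_hermiteFun_mul_eq_zero {β : Fin d → ℝ} (hβ : ∀ i, -1 < β i)
    {u : (Fin d → ℝ) → ℝ} (hu : MemLp u 2 (orthantMeasure d))
    (h : ∀ k, ∫ x, hermiteFun β k x * u x ∂(orthantMeasure d) = 0) :
    u =ᵐ[orthantMeasure d] 0 := by
  filter_upwards [ae_eq_zero_of_integral_mul_gaussian_eq_zero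
    ((memLp_hermiteFun hβ 0).integrable_mul hu)
    (integral_hermiteFun_zero_mul_gaussian_eq_zero hβ hu h), ae_mem_orthant d] with x hx hxo
  exact (mul_eq_zero.1 hx).resolve_left (hermiteFun_zero_pos hβ hxo).ne'

section HilbertBasis

variable (𝕜 : Type*) [RCLike 𝕜] {β : Fin d → ℝ}

lemma coeFn_hermiteVec (hβ : ∀ i, -1 < β i) (k : Fin d → ℕ) :
    hermiteVec 𝕜 β k =ᵐ[orthantMeasure d] fun x => (hermiteFun β k x : 𝕜) := by
  rw [hermiteVec, dif_pos (memLp_ofReal_hermiteFun 𝕜 hβ k)]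
  exact MemLp.coeFn_toLp _

variable {𝕜} in
lemma inner_hermiteVec (hβ : ∀ i, -1 < β i) (k : Fin d → ℕ) (f : Lp 𝕜 2 (orthantMeasure d)) :
    inner 𝕜 (hermiteVec 𝕜 β k) f = ∫ x, (hermiteFun β k x : 𝕜) * f x ∂(orthantMeasure d) := by
  rw [L2.inner_def]
  refine integral_congr_ae ?_
  filter_upwards [coeFn_hermiteVec 𝕜 hβ k] with x hx
  rw [hx, RCLike.inner_apply, RCLike.conj_ofReal, mul_comm]

lemma orthonormal_hermiteVec (hβ : ∀ i, -1 < β i) : Orthonormal 𝕜 (hermiteVec 𝕜 β) := by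
  classical
  rw [orthonormal_iff_ite]
  intro k l
  have hreal : ∫ x, (hermiteFun β k x : 𝕜) * hermiteVec 𝕜 β l x ∂(orthantMeasure d) =
      ∫ x, ((hermiteFun β k x * hermiteFun β l x : ℝ) : 𝕜) ∂(orthantMeasure d) := by
    refine integral_congr_ae ?_
    filter_upwards [coeFn_hermiteVec 𝕜 hβ l] with x hx
    rw [hx, RCLike.ofReal_mul]
  rw [inner_hermiteVec hβ, hreal, integral_ofReal, integral_hermiteFun_mul hβ]
  split_ifs <;> simp

lemma orthogonal_span_hermiteVec (hβ : ∀ i, -1 < β i) :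
    (Submodule.span 𝕜 (range (hermiteVec 𝕜 β)))ᗮ = ⊥ := by
  rw [eq_bot_iff]
  intro f hf
  have horth (k : Fin d → ℕ) : ∫ x, (hermiteFun β k x : 𝕜) * f x ∂(orthantMeasure d) = 0 := by
    rw [← inner_hermiteVec hβ]
    exact (Submodule.mem_orthogonal _ _).1 hf _ (Submodule.subset_span ⟨k, rfl⟩)
  have hint (k : Fin d → ℕ) :
      Integrable (fun x => (hermiteFun β k x : 𝕜) * f x) (orthantMeasure d) :=
    (memLp_ofReal_hermiteFun 𝕜 hβ k).integrable_mul (Lp.memLp f)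
  have hre := ae_eq_zero_of_integral_hermiteFun_mul_eq_zero hβ (Lp.memLp f).re fun k => by
    simpa only [horth k, RCLike.re_ofReal_mul, map_zero] using integral_re (hint k)
  have him := ae_eq_zero_of_integral_hermiteFun_mul_eq_zero hβ (Lp.memLp f).im fun k => by
    simpa only [horth k, RCLike.im_ofReal_mul, map_zero] using integral_im (hint k)
  rw [Submodule.mem_bot, Lp.eq_zero_iff_ae_eq_zero]
  filter_upwards [hre, him] with x hrex himx
  exact RCLike.ext (by simpa using hrex) (by simpa using himx)

/-- The Laguerre functions of Hermite type as an orthonormal basis of `L²(ℝ_+^d)`. -/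
def hermiteBasis (hβ : ∀ i, -1 < β i) :
    HilbertBasis (Fin d → ℕ) 𝕜 (Lp 𝕜 2 (orthantMeasure d)) :=
  HilbertBasis.mkOfOrthogonalEqBot (orthonormal_hermiteVec 𝕜 hβ) (orthogonal_span_hermiteVec 𝕜 hβ)

lemma coe_hermiteBasis (hβ : ∀ i, -1 < β i) : ⇑(hermiteBasis 𝕜 hβ) = hermiteVec 𝕜 β :=
  HilbertBasis.coe_mkOfOrthogonalEqBot _ _

end HilbertBasis

/-! ### Schur kernels -/

section SchurKernel

variable {X : Type*} [MeasurableSpace X] {μ : Measure X} {𝕜 : Type*} [RCLike 𝕜]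

lemma memL1AddLinfty_of_memLp {p : ℝ≥0∞} (hp : 1 ≤ p) {f : X → 𝕜} (hf : MemLp f p μ) :
    MemL1AddLinfty μ f := by
  rcases eq_or_ne p ∞ with rfl | hp_top
  · exact ⟨0, f, MemLp.zero, hf, by rw [zero_add]⟩
  obtain ⟨f', hf', hff'⟩ := hf.aestronglyMeasurable
  have hfp : MemLp f' p μ := hf.ae_eq hff'
  set S : Set X := {x | 1 ≤ ‖f' x‖₊}
  have hSm : MeasurableSet S := measurableSet_le measurable_const hf'.nnnorm.measurable
  have hμS : μ S ≠ ∞ :=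
    (hfp.meas_ge_lt_top (zero_lt_one.trans_le hp).ne' hp_top one_ne_zero).ne
  refine ⟨S.indicator f', Sᶜ.indicator f', ?_, ?_, ?_⟩
  · exact (hfp.indicator hSm).mono_exponent_of_measure_support_ne_top
      (fun x hx => indicator_of_notMem hx _) hμS hp
  · refine memLp_top_of_bound (hf'.indicator hSm.compl).aestronglyMeasurable 1
      (Eventually.of_forall fun x => ?_)
    by_cases hx : x ∈ S
    · simp [hx]
    · rw [indicator_of_mem hx]
      exact (not_le.1 hx).le
  · rwa [indicator_self_add_compl]

lemma MemL1AddLinfty.aestronglyMeasurable {f : X → 𝕜} (hf : MemL1AddLinfty μ f) :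
    AEStronglyMeasurable f μ := by
  obtain ⟨g, h, hg, hh, hfgh⟩ := hf
  exact (hg.aestronglyMeasurable.add hh.aestronglyMeasurable).congr hfgh.symm

lemma MemL1AddLinfty.norm {f : X → 𝕜} (hf : MemL1AddLinfty μ f) :
    MemL1AddLinfty μ fun x => ‖f x‖ := by
  have hfm := hf.aestronglyMeasurable.norm
  obtain ⟨g, h, hg, hh, hfgh⟩ := hf
  have hmin : AEStronglyMeasurable (fun x => min ‖f x‖ ‖h x‖) μ := hfm.inf hh.1.norm
  refine ⟨fun x => ‖f x‖ - min ‖f x‖ ‖h x‖, fun x => min ‖f x‖ ‖h x‖,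
    hg.of_le (hfm.sub hmin) ?_, hh.of_le hmin (Eventually.of_forall fun x => ?_), ?_⟩
  · filter_upwards [hfgh] with x hx
    have htri : ‖f x‖ ≤ ‖g x‖ + ‖h x‖ := by
      rw [hx]
      exact norm_add_le _ _
    rw [Real.norm_of_nonneg (sub_nonneg.2 (min_le_left _ _)), sub_le_comm]
    exact le_min (by linarith [norm_nonneg (g x)]) (by linarith)
  · rw [Real.norm_of_nonneg (le_min (norm_nonneg _) (norm_nonneg _))]
    exact min_le_right _ _
  · exact Eventually.of_forall fun x => (sub_add_cancel _ _).symm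

/-- The integral operator with the real kernel `K`, acting on real- or complex-valued functions. -/
def kernelOp (μ : Measure X) (K : X → X → ℝ) (f : X → 𝕜) (x : X) : 𝕜 :=
  ∫ y, (K x y : 𝕜) * f y ∂μ

/-- A nonnegative symmetric kernel whose sections are bounded and have integral at most `C`. By the
Schur test it defines an integral operator of norm at most `C` on every `L^p`; the boundedness of
the sections makes the operator act on `L¹ + L^∞` pointwise, not just almost everywhere. -/
structure IsSchurKernel (μ : Measure X) (K : X → X → ℝ) (C : ℝ) : Prop where
  measurable : Measurable fun p : X × X => K p.1 p.2
  nonneg : ∀ x y, 0 ≤ K x y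
  symm : ∀ x y, K x y = K y x
  lintegral_le : ∀ x, ∫⁻ y, ENNReal.ofReal (K x y) ∂μ ≤ ENNReal.ofReal C
  bdd : ∀ x, ∃ M, ∀ y, K x y ≤ M

lemma kernelOp_congr_ae (K : X → X → ℝ) {f g : X → 𝕜} (h : f =ᵐ[μ] g) :
    kernelOp μ K f = kernelOp μ K g := by
  funext x
  refine integral_congr_ae ?_
  filter_upwards [h] with y hy
  rw [hy]

lemma kernelOp_smul (K : X → X → ℝ) (c : 𝕜) (f : X → 𝕜) :
    kernelOp μ K (c • f) = c • kernelOp μ K f := by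
  funext x
  simp only [kernelOp, Pi.smul_apply, smul_eq_mul, ← integral_const_mul, mul_left_comm]

lemma kernelOp_conj (K : X → X → ℝ) (f : X → 𝕜) (x : X) :
    kernelOp μ K (fun y => (starRingEnd 𝕜) (f y)) x = (starRingEnd 𝕜) (kernelOp μ K f x) := by
  simp only [kernelOp, ← integral_conj, map_mul, RCLike.conj_ofReal]

lemma rpow_lintegral_mul_le {k f : X → ℝ≥0∞} (hk : Measurable k) (hf : AEMeasurable f μ) {q : ℝ}
    (hq : 1 ≤ q) :
    (∫⁻ y, k y * f y ∂μ) ^ q ≤ (∫⁻ y, k y ∂μ) ^ (q - 1) * ∫⁻ y, k y * f y ^ q ∂μ := by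
  have hq0 : 0 < q := zero_lt_one.trans_le hq
  set ν := μ.withDensity k with hν
  have heLpNorm (r : ℝ) : eLpNorm' f r ν = (∫⁻ y, k y * f y ^ r ∂μ) ^ (1 / r) := by
    simp only [eLpNorm'_eq_lintegral_enorm, enorm_eq_self, hν,
      lintegral_withDensity_eq_lintegral_mul₀ hk.aemeasurable (hf.pow_const r), Pi.mul_apply]
  have hmass : ν univ = ∫⁻ y, k y ∂μ := by
    rw [hν, withDensity_apply _ MeasurableSet.univ, Measure.restrict_univ]
  have hjensen := eLpNorm'_le_eLpNorm'_mul_rpow_measure_univ (μ := ν) one_pos hq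
    (hf.mono_ac (withDensity_absolutelyContinuous μ k)).aestronglyMeasurable
  simp only [heLpNorm, hmass, ENNReal.rpow_one, div_one] at hjensen
  refine (ENNReal.rpow_le_rpow hjensen hq0.le).trans_eq ?_
  rw [ENNReal.mul_rpow_of_nonneg _ _ hq0.le, ← ENNReal.rpow_mul, ← ENNReal.rpow_mul,
    one_div_mul_cancel hq0.ne', ENNReal.rpow_one, mul_comm, sub_mul, one_mul,
    one_div_mul_cancel hq0.ne']

namespace IsSchurKernel

variable {K L : X → X → ℝ} {C C' : ℝ}

lemma mono (hK : IsSchurKernel μ K C) (hC : C ≤ C') : IsSchurKernel μ K C' where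
  __ := hK
  lintegral_le x := (hK.lintegral_le x).trans (ENNReal.ofReal_le_ofReal hC)

lemma measurable_right (hK : IsSchurKernel μ K C) (x : X) : Measurable (K x) :=
  hK.measurable.comp (measurable_const.prodMk measurable_id)

lemma aestronglyMeasurable_right (hK : IsSchurKernel μ K C) (x : X) :
    AEStronglyMeasurable (fun y => (K x y : 𝕜)) μ :=
  (RCLike.measurable_ofReal.comp (hK.measurable_right x)).aestronglyMeasurable

lemma aestronglyMeasurable_ofReal (hK : IsSchurKernel μ K C) (ν : Measure (X × X)) :
    AEStronglyMeasurable (fun p : X × X => (K p.1 p.2 : 𝕜)) ν :=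
  (RCLike.measurable_ofReal.comp hK.measurable).aestronglyMeasurable

lemma norm_ofReal_eq (hK : IsSchurKernel μ K C) (x y : X) : ‖(K x y : 𝕜)‖ = K x y := by
  rw [RCLike.norm_ofReal, abs_of_nonneg (hK.nonneg x y)]

lemma enorm_ofReal_eq (hK : IsSchurKernel μ K C) (x y : X) :
    ‖(K x y : 𝕜)‖ₑ = ENNReal.ofReal (K x y) := by
  rw [← ofReal_norm, hK.norm_ofReal_eq]

lemma integrable_right (hK : IsSchurKernel μ K C) (x : X) :
    Integrable (fun y => (K x y : 𝕜)) μ := by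
  refine ⟨hK.aestronglyMeasurable_right x, ?_⟩
  simp_rw [HasFiniteIntegral, hK.enorm_ofReal_eq]
  exact (hK.lintegral_le x).trans_lt ENNReal.ofReal_lt_top

lemma integrable_mul (hK : IsSchurKernel μ K C) (x : X) {f : X → 𝕜} (hf : MemL1AddLinfty μ f) :
    Integrable (fun y => (K x y : 𝕜) * f y) μ := by
  obtain ⟨g, h, hg, hh, hfgh⟩ := hf
  obtain ⟨M, hM⟩ := hK.bdd x
  have hKg : Integrable (fun y => (K x y : 𝕜) * g y) μ :=
    (memLp_one_iff_integrable.1 hg).bdd_mul (c := M) (hK.aestronglyMeasurable_right x)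
      (Eventually.of_forall fun y => (hK.norm_ofReal_eq x y).trans_le (hM y))
  have hKh : Integrable (fun y => (K x y : 𝕜) * h y) μ :=
    (hK.integrable_right x).mul_of_top_left hh
  refine (hKg.add hKh).congr ?_
  filter_upwards [hfgh] with y hy
  rw [hy, Pi.add_apply, Pi.add_apply, mul_add]

lemma kernelOp_add (hK : IsSchurKernel μ K C) {f g : X → 𝕜} (hf : MemL1AddLinfty μ f)
    (hg : MemL1AddLinfty μ g) : kernelOp μ K (f + g) = kernelOp μ K f + kernelOp μ K g := by
  funext x
  simp only [kernelOp, Pi.add_apply, mul_add]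
  exact integral_add (hK.integrable_mul x hf) (hK.integrable_mul x hg)

lemma aestronglyMeasurable_kernelOp [SFinite μ] (hK : IsSchurKernel μ K C) {f : X → 𝕜}
    (hf : AEStronglyMeasurable f μ) : AEStronglyMeasurable (kernelOp μ K f) μ :=
  ((hK.aestronglyMeasurable_ofReal _).mul hf.comp_snd).integral_prod_right'

lemma enorm_kernelOp_le (hK : IsSchurKernel μ K C) (f : X → 𝕜) (x : X) :
    ‖kernelOp μ K f x‖ₑ ≤ ∫⁻ y, ENNReal.ofReal (K x y) * ‖f y‖ₑ ∂μ := by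
  refine (enorm_integral_le_lintegral_enorm _).trans_eq ?_
  simp_rw [enorm_mul, hK.enorm_ofReal_eq]

lemma lintegral_lintegral_mul_le [SFinite μ] (hK : IsSchurKernel μ K C) {g : X → ℝ≥0∞}
    (hg : AEMeasurable g μ) :
    ∫⁻ x, ∫⁻ y, ENNReal.ofReal (K x y) * g y ∂μ ∂μ ≤ ENNReal.ofReal C * ∫⁻ y, g y ∂μ := by
  rw [lintegral_lintegral_swap (hK.measurable.ennreal_ofReal.aemeasurable.mul hg.comp_snd),
    ← lintegral_const_mul'' _ hg]
  refine lintegral_mono fun y => ?_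
  simp_rw [hK.symm _ y]
  rw [lintegral_mul_const _ (hK.measurable_right y).ennreal_ofReal]
  exact mul_le_mul_left (hK.lintegral_le y) _

lemma eLpNorm_top_kernelOp_le (hK : IsSchurKernel μ K C) (f : X → 𝕜) :
    eLpNorm (kernelOp μ K f) ∞ μ ≤ ENNReal.ofReal C * eLpNorm f ∞ μ := by
  rw [eLpNorm_exponent_top, eLpNorm_exponent_top]
  refine eLpNormEssSup_le_of_ae_enorm_bound (Eventually.of_forall fun x => ?_)
  calc ‖kernelOp μ K f x‖ₑ
      ≤ ∫⁻ y, ENNReal.ofReal (K x y) * ‖f y‖ₑ ∂μ := hK.enorm_kernelOp_le f x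
    _ ≤ ∫⁻ y, ENNReal.ofReal (K x y) * eLpNormEssSup f μ ∂μ := by
        refine lintegral_mono_ae ?_
        filter_upwards [enorm_ae_le_eLpNormEssSup f μ] with y hy
        gcongr
    _ = (∫⁻ y, ENNReal.ofReal (K x y) ∂μ) * eLpNormEssSup f μ :=
        lintegral_mul_const _ (hK.measurable_right x).ennreal_ofReal
    _ ≤ ENNReal.ofReal C * eLpNormEssSup f μ := mul_le_mul_left (hK.lintegral_le x) _

lemma lintegral_enorm_kernelOp_rpow_le [SFinite μ] (hK : IsSchurKernel μ K C) {f : X → 𝕜}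
    (hf : AEStronglyMeasurable f μ) {q : ℝ} (hq : 1 ≤ q) :
    ∫⁻ x, ‖kernelOp μ K f x‖ₑ ^ q ∂μ ≤ ENNReal.ofReal C ^ q * ∫⁻ y, ‖f y‖ₑ ^ q ∂μ := by
  set c := ENNReal.ofReal C
  have hpow : c ^ (q - 1) * c = c ^ q := by
    conv_lhs => rw [← ENNReal.rpow_one c, ← ENNReal.rpow_mul, one_mul]
    rw [← ENNReal.rpow_add_of_nonneg _ _ (sub_nonneg.2 hq) zero_le_one, sub_add_cancel]
  calc ∫⁻ x, ‖kernelOp μ K f x‖ₑ ^ q ∂μ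
      ≤ ∫⁻ x, c ^ (q - 1) * ∫⁻ y, ENNReal.ofReal (K x y) * ‖f y‖ₑ ^ q ∂μ ∂μ := by
        refine lintegral_mono fun x =>
          (ENNReal.rpow_le_rpow (hK.enorm_kernelOp_le f x) (zero_le_one.trans hq)).trans
            ((rpow_lintegral_mul_le (hK.measurable_right x).ennreal_ofReal hf.enorm hq).trans ?_)
        gcongr
        exact hK.lintegral_le x
    _ = c ^ (q - 1) * ∫⁻ x, ∫⁻ y, ENNReal.ofReal (K x y) * ‖f y‖ₑ ^ q ∂μ ∂μ :=
        lintegral_const_mul' _ _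
          (ENNReal.rpow_ne_top_of_nonneg (sub_nonneg.2 hq) ENNReal.ofReal_ne_top)
    _ ≤ c ^ (q - 1) * (c * ∫⁻ y, ‖f y‖ₑ ^ q ∂μ) :=
        mul_le_mul_right (hK.lintegral_lintegral_mul_le (hf.enorm.pow_const q)) _
    _ = c ^ q * ∫⁻ y, ‖f y‖ₑ ^ q ∂μ := by rw [← mul_assoc, hpow]

theorem eLpNorm_kernelOp_le [SFinite μ] (hK : IsSchurKernel μ K C) {p : ℝ≥0∞} (hp : 1 ≤ p)
    {f : X → 𝕜} (hf : AEStronglyMeasurable f μ) :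
    eLpNorm (kernelOp μ K f) p μ ≤ ENNReal.ofReal C * eLpNorm f p μ := by
  rcases eq_or_ne p ∞ with rfl | hp_top
  · exact hK.eLpNorm_top_kernelOp_le f
  have hp0 : p ≠ 0 := (zero_lt_one.trans_le hp).ne'
  have hq : 1 ≤ p.toReal := by simpa using ENNReal.toReal_mono hp_top hp
  have hq0 : 0 < p.toReal := zero_lt_one.trans_le hq
  rw [eLpNorm_eq_lintegral_rpow_enorm_toReal hp0 hp_top,
    eLpNorm_eq_lintegral_rpow_enorm_toReal hp0 hp_top]
  refine (ENNReal.rpow_le_rpow (hK.lintegral_enorm_kernelOp_rpow_le hf hq)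
    (by positivity)).trans_eq ?_
  rw [ENNReal.mul_rpow_of_nonneg _ _ (by positivity), ← ENNReal.rpow_mul,
    mul_one_div_cancel hq0.ne', ENNReal.rpow_one]

lemma memLp_kernelOp [SFinite μ] (hK : IsSchurKernel μ K C) {p : ℝ≥0∞} (hp : 1 ≤ p)
    {f : X → 𝕜} (hf : MemLp f p μ) : MemLp (kernelOp μ K f) p μ :=
  ⟨hK.aestronglyMeasurable_kernelOp hf.1, (hK.eLpNorm_kernelOp_le hp hf.1).trans_lt
    (ENNReal.mul_lt_top ENNReal.ofReal_lt_top hf.2)⟩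

lemma memL1AddLinfty_kernelOp [SFinite μ] (hK : IsSchurKernel μ K C) {f : X → 𝕜}
    (hf : MemL1AddLinfty μ f) : MemL1AddLinfty μ (kernelOp μ K f) := by
  obtain ⟨g, h, hg, hh, hfgh⟩ := hf
  refine ⟨kernelOp μ K g, kernelOp μ K h, hK.memLp_kernelOp le_rfl hg,
    hK.memLp_kernelOp le_top hh, ?_⟩
  rw [kernelOp_congr_ae K hfgh, hK.kernelOp_add (memL1AddLinfty_of_memLp le_rfl hg)
    (memL1AddLinfty_of_memLp le_top hh)]

lemma lpOpNormLE [SFinite μ] (hK : IsSchurKernel μ K C) {p : ℝ≥0∞} (hp : 1 ≤ p)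
    {A : (X → 𝕜) → (X → 𝕜)} (hA : ∀ f, A f =ᵐ[μ] kernelOp μ K f) : LpOpNormLE μ p A C := by
  intro f hf
  refine ⟨(memLp_congr_ae (hA f)).2 (hK.memLp_kernelOp hp hf), ?_⟩
  rw [eLpNorm_congr_ae (hA f)]
  exact hK.eLpNorm_kernelOp_le hp hf.1

lemma integral_norm_mul (hK : IsSchurKernel μ K C) (f : X → 𝕜) (x : X) :
    ∫ y, ‖(K x y : 𝕜) * f y‖ ∂μ = kernelOp μ K (fun y => ‖f y‖) x := by
  simp only [norm_mul, hK.norm_ofReal_eq, kernelOp, RCLike.ofReal_real_eq_id, id_eq]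

lemma integrable_mul_mul_of_memLp_two [SFinite μ] (hK : IsSchurKernel μ K C) {f g : X → 𝕜}
    (hf : MemLp f 2 μ) (hg : MemLp g 2 μ) :
    Integrable (fun p : X × X => (K p.1 p.2 : 𝕜) * f p.2 * g p.1) (μ.prod μ) := by
  have hmeas : AEStronglyMeasurable (fun p : X × X => (K p.1 p.2 : 𝕜) * f p.2 * g p.1)
      (μ.prod μ) :=
    ((hK.aestronglyMeasurable_ofReal _).mul hf.1.comp_snd).mul hg.1.comp_fst
  refine (integrable_prod_iff hmeas).2 ⟨Eventually.of_forall fun x =>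
    (hK.integrable_mul x (memL1AddLinfty_of_memLp one_le_two hf)).mul_const (g x), ?_⟩
  simp only [norm_mul _ (g _), integral_mul_const, hK.integral_norm_mul]
  exact (hK.memLp_kernelOp one_le_two hf.norm).integrable_mul hg.norm

lemma integral_kernelOp_mul [SFinite μ] (hK : IsSchurKernel μ K C) {f g : X → 𝕜}
    (hf : MemLp f 2 μ) (hg : MemLp g 2 μ) :
    ∫ x, kernelOp μ K f x * g x ∂μ = ∫ x, f x * kernelOp μ K g x ∂μ := by
  simp only [kernelOp, ← integral_mul_const, ← integral_const_mul]
  rw [integral_integral_swap (hK.integrable_mul_mul_of_memLp_two hf hg)]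
  simp only [hK.symm _ _, mul_assoc, mul_left_comm]

lemma integral_inner_kernelOp [SFinite μ] (hK : IsSchurKernel μ K C) {f g : X → 𝕜}
    (hf : MemLp f 2 μ) (hg : MemLp g 2 μ) :
    ∫ x, inner 𝕜 (kernelOp μ K f x) (g x) ∂μ = ∫ x, inner 𝕜 (f x) (kernelOp μ K g x) ∂μ := by
  have hstar : MemLp (fun x => (starRingEnd 𝕜) (f x)) 2 μ := hf.star
  simp only [RCLike.inner_apply', ← kernelOp_conj]
  exact hK.integral_kernelOp_mul hstar hg

lemma integrable_mul_mul_of_memL1AddLinfty [SFinite μ] (hK : IsSchurKernel μ K C)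
    (hL : IsSchurKernel μ L C') (x : X) {f : X → 𝕜} (hf : MemL1AddLinfty μ f) :
    Integrable (fun p : X × X => (K x p.1 : 𝕜) * ((L p.1 p.2 : 𝕜) * f p.2)) (μ.prod μ) := by
  have hmeas : AEStronglyMeasurable
      (fun p : X × X => (K x p.1 : 𝕜) * ((L p.1 p.2 : 𝕜) * f p.2)) (μ.prod μ) :=
    (hK.aestronglyMeasurable_right x).comp_fst.mul
      ((hL.aestronglyMeasurable_ofReal _).mul hf.aestronglyMeasurable.comp_snd)
  refine (integrable_prod_iff hmeas).2
    ⟨Eventually.of_forall fun z => (hL.integrable_mul z hf).const_mul (K x z : 𝕜), ?_⟩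
  simp only [norm_mul (K x _ : 𝕜), integral_const_mul, hL.integral_norm_mul, hK.norm_ofReal_eq]
  exact hK.integrable_mul x (hL.memL1AddLinfty_kernelOp hf.norm)

lemma kernelOp_kernelOp [SFinite μ] {M : X → X → ℝ} (hK : IsSchurKernel μ K C)
    (hL : IsSchurKernel μ L C') (hKL : ∀ x y, ∫ z, K x z * L z y ∂μ = M x y) {f : X → 𝕜}
    (hf : MemL1AddLinfty μ f) :
    kernelOp μ K (kernelOp μ L f) = kernelOp μ M f := by
  funext x
  simp only [kernelOp, ← integral_const_mul]
  rw [integral_integral_swap (hK.integrable_mul_mul_of_memL1AddLinfty hL x hf)]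
  refine integral_congr_ae (Eventually.of_forall fun y => ?_)
  simp only [← mul_assoc, integral_mul_const, ← hKL x y, ← integral_ofReal, RCLike.ofReal_mul]

lemma kernelOp_nonneg (hK : IsSchurKernel μ K C) {f : X → 𝕜} (hf : ∀ᵐ x ∂μ, 0 ≤ f x) (x : X) :
    0 ≤ kernelOp μ K f x := by
  refine integral_nonneg_of_ae ?_
  filter_upwards [hf] with y hy
  exact mul_nonneg (RCLike.ofReal_nonneg.2 (hK.nonneg x y)) hy

lemma kernelOp_one_le (hK : IsSchurKernel μ K C) (hC : 0 ≤ C) (x : X) :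
    kernelOp μ K (fun _ => (1 : 𝕜)) x ≤ (C : 𝕜) := by
  simp only [kernelOp, mul_one]
  rw [integral_ofReal, integral_eq_lintegral_of_nonneg_ae (Eventually.of_forall (hK.nonneg x))
    (hK.measurable_right x).aestronglyMeasurable, RCLike.ofReal_le_ofReal]
  exact ENNReal.toReal_le_of_le_ofReal hC (hK.lintegral_le x)

lemma eLpNorm_one_kernelOp_indicator [SFinite μ] (hK : IsSchurKernel μ K C) {E : Set X}
    (hE : MeasurableSet E) :
    eLpNorm (kernelOp μ K (E.indicator fun _ => (1 : 𝕜))) 1 μ =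
      ∫⁻ y in E, ∫⁻ x, ENNReal.ofReal (K y x) ∂μ ∂μ := by
  have henorm (x : X) : ‖kernelOp μ K (E.indicator fun _ => (1 : 𝕜)) x‖ₑ =
      ∫⁻ y in E, ENNReal.ofReal (K y x) ∂μ := by
    have hop : kernelOp μ K (E.indicator fun _ => (1 : 𝕜)) x =
        ((∫ y in E, K x y ∂μ : ℝ) : 𝕜) := by
      rw [← integral_ofReal, ← integral_indicator hE]
      refine integral_congr_ae (Eventually.of_forall fun y => ?_)
      by_cases hy : y ∈ E <;> simp [hy]
    have hint : Integrable (K x) μ := by simpa using hK.integrable_right (𝕜 := ℝ) x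
    rw [hop, ← ofReal_norm, RCLike.norm_ofReal,
      abs_of_nonneg (integral_nonneg fun y => hK.nonneg x y),
      ofReal_integral_eq_lintegral_ofReal hint.integrableOn (Eventually.of_forall (hK.nonneg x))]
    simp_rw [hK.symm x]
  rw [eLpNorm_one_eq_lintegral_enorm, lintegral_congr henorm]
  exact lintegral_lintegral_swap
    (hK.measurable.ennreal_ofReal.comp measurable_swap).aemeasurable

lemma eLpNorm_one_indicator_lt_kernelOp [SFinite μ] (hK : IsSchurKernel μ K C) {E : Set X}
    (hE : MeasurableSet E) (hE0 : μ E ≠ 0) (hE_top : μ E ≠ ∞) {c : ℝ≥0∞} (hc : 1 < c)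
    (hcK : ∀ x ∈ E, c ≤ ∫⁻ y, ENNReal.ofReal (K x y) ∂μ) :
    eLpNorm (E.indicator fun _ => (1 : 𝕜)) 1 μ <
      eLpNorm (kernelOp μ K (E.indicator fun _ => (1 : 𝕜))) 1 μ :=
  calc eLpNorm (E.indicator fun _ => (1 : 𝕜)) 1 μ
      = 1 * μ E := by
        simp [eLpNorm_indicator_const hE one_ne_zero ENNReal.one_ne_top]
    _ < c * μ E := ENNReal.mul_lt_mul_left hE0 hE_top hc
    _ = ∫⁻ _ in E, c ∂μ := (setLIntegral_const E c).symm
    _ ≤ ∫⁻ x in E, ∫⁻ y, ENNReal.ofReal (K x y) ∂μ ∂μ := setLIntegral_mono' hE hcK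
    _ = _ := (hK.eLpNorm_one_kernelOp_indicator hE).symm

end IsSchurKernel

theorem isSymmetricDiffusionSemigroup_of_isSchurKernel [SFinite μ] {T : ℝ → (X → 𝕜) → (X → 𝕜)}
    {K : ℝ → X → X → ℝ} (hK : ∀ t, 0 < t → IsSchurKernel μ (K t) 1) (hT0 : ∀ f, T 0 f = f)
    (hT : ∀ t, 0 < t → ∀ f, T t f =ᵐ[μ] kernelOp μ (K t) f)
    (hCK : ∀ s t, 0 < s → 0 < t → ∀ x y, ∫ z, K s x z * K t z y ∂μ = K (s + t) x y)
    (hcont : ∀ f, MemLp f 2 μ → Tendsto (fun t => eLpNorm (T t f - f) 2 μ) (𝓝[>] 0) (𝓝 0)) :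
    IsSymmetricDiffusionSemigroup μ T where
  congr_ae t ht f g _ hfg := by
    rcases ht.eq_or_lt with rfl | ht
    · rwa [hT0, hT0]
    · refine (hT t ht f).trans (EventuallyEq.trans ?_ (hT t ht g).symm)
      rw [kernelOp_congr_ae _ hfg]
  aestronglyMeasurable t ht f hf := by
    rcases ht.eq_or_lt with rfl | ht
    · rw [hT0]
      exact hf.aestronglyMeasurable
    · exact ((hK t ht).aestronglyMeasurable_kernelOp hf.aestronglyMeasurable).congr (hT t ht f).symm
  map_add t ht f g hf hg := by
    rcases ht.eq_or_lt with rfl | ht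
    · rw [hT0, hT0, hT0]
    · filter_upwards [hT t ht (f + g), hT t ht f, hT t ht g] with x h1 h2 h3
      rw [h1, Pi.add_apply, h2, h3, (hK t ht).kernelOp_add hf hg, Pi.add_apply]
  map_smul t ht c f _ := by
    rcases ht.eq_or_lt with rfl | ht
    · rw [hT0, hT0]
    · filter_upwards [hT t ht (c • f), hT t ht f] with x h1 h2
      rw [h1, Pi.smul_apply, h2, kernelOp_smul, Pi.smul_apply]
  map_zero_time f _ := by rw [hT0]
  contraction p hp t ht f hf := by
    rcases ht.eq_or_lt with rfl | ht
    · rw [hT0]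
    · rw [eLpNorm_congr_ae (hT t ht f)]
      simpa using (hK t ht).eLpNorm_kernelOp_le hp hf.1
  semigroup p hp s t hs ht f hf := by
    rcases hs.eq_or_lt with rfl | hs
    · rw [hT0, zero_add]
    rcases ht.eq_or_lt with rfl | ht
    · rw [hT0, add_zero]
    filter_upwards [hT _ (add_pos hs ht) f, hT s hs (T t f)] with x h1 h2
    rw [h1, h2, kernelOp_congr_ae _ (hT t ht f),
      (hK s hs).kernelOp_kernelOp (hK t ht) (hCK s t hs ht) (memL1AddLinfty_of_memLp hp hf)]
  selfAdjoint t ht f g hf hg := by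
    rcases ht.eq_or_lt with rfl | ht
    · rw [hT0, hT0]
    calc ∫ x, inner 𝕜 (T t f x) (g x) ∂μ
        = ∫ x, inner 𝕜 (kernelOp μ (K t) f x) (g x) ∂μ :=
          integral_congr_ae ((hT t ht f).mono fun x hx => by simp only [hx])
      _ = ∫ x, inner 𝕜 (f x) (kernelOp μ (K t) g x) ∂μ := (hK t ht).integral_inner_kernelOp hf hg
      _ = ∫ x, inner 𝕜 (f x) (T t g x) ∂μ :=
          integral_congr_ae ((hT t ht g).mono fun x hx => by simp only [hx])
  continuous_zero := hcont

theorem isSubmarkovian_of_isSchurKernel [SFinite μ] {T : ℝ → (X → 𝕜) → (X → 𝕜)}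
    {K : ℝ → X → X → ℝ} (hK : ∀ t, 0 < t → IsSchurKernel μ (K t) 1) (hT0 : ∀ f, T 0 f = f)
    (hT : ∀ t, 0 < t → ∀ f, T t f =ᵐ[μ] kernelOp μ (K t) f)
    (hCK : ∀ s t, 0 < s → 0 < t → ∀ x y, ∫ z, K s x z * K t z y ∂μ = K (s + t) x y)
    (hcont : ∀ f, MemLp f 2 μ → Tendsto (fun t => eLpNorm (T t f - f) 2 μ) (𝓝[>] 0) (𝓝 0)) :
    IsSubmarkovian μ T where
  toIsSymmetricDiffusionSemigroup :=
    isSymmetricDiffusionSemigroup_of_isSchurKernel hK hT0 hT hCK hcont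
  positive t ht f _ h0 := by
    rcases ht.eq_or_lt with rfl | ht
    · rwa [hT0]
    · filter_upwards [hT t ht f] with x hx
      rw [hx]
      exact (hK t ht).kernelOp_nonneg h0 x
  map_one_le t ht := by
    rcases ht.eq_or_lt with rfl | ht
    · rw [hT0]
      simp
    · filter_upwards [hT t ht fun _ => 1] with x hx
      rw [hx]
      simpa using (hK t ht).kernelOp_one_le (𝕜 := 𝕜) zero_le_one x

end SchurKernel

/-! ### The modified kernel -/

instance sigmaFinite_orthantMeasure (d : ℕ) : SigmaFinite (orthantMeasure d) := by
  unfold orthantMeasure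
  infer_instance

/-- The kernel `e^{-2t} G_t^β`, extended by zero off the orthant; for `β = α + e_j` this is the
kernel of the modified semigroup. -/
def modifiedKernel (β : Fin d → ℝ) (t : ℝ) (x y : Fin d → ℝ) : ℝ :=
  (orthant d ×ˢ orthant d).indicator
    (fun p => Real.exp (-2 * t) * laguerreKernel β t p.1 p.2) (x, y)

lemma modifiedKernel_of_mem (β : Fin d → ℝ) (t : ℝ) {x y : Fin d → ℝ} (hx : x ∈ orthant d)
    (hy : y ∈ orthant d) : modifiedKernel β t x y = Real.exp (-2 * t) * laguerreKernel β t x y :=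
  indicator_of_mem (mk_mem_prod hx hy) _

lemma modifiedKernel_of_notMem_left (β : Fin d → ℝ) (t : ℝ) {x : Fin d → ℝ} (hx : x ∉ orthant d)
    (y : Fin d → ℝ) : modifiedKernel β t x y = 0 :=
  indicator_of_notMem (fun h => hx h.1) _

lemma modifiedKernel_comm (β : Fin d → ℝ) (t : ℝ) (x y : Fin d → ℝ) :
    modifiedKernel β t x y = modifiedKernel β t y x := by
  by_cases hx : x ∈ orthant d <;> by_cases hy : y ∈ orthant d <;>
    simp [modifiedKernel, hx, hy, laguerreKernel_comm β t x y]

lemma modifiedKernel_nonneg {β : Fin d → ℝ} (hβ : ∀ i, -1 < β i) {t : ℝ} (ht : 0 < t)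
    (x y : Fin d → ℝ) : 0 ≤ modifiedKernel β t x y :=
  indicator_nonneg (s := orthant d ×ˢ orthant d) (fun _ hp =>
    mul_nonneg (Real.exp_pos _).le (laguerreKernel_nonneg hβ ht hp.1 hp.2)) (x, y)

lemma measurable_modifiedKernel {β : Fin d → ℝ} (hβ : ∀ i, -1 < β i) (t : ℝ) :
    Measurable fun p : (Fin d → ℝ) × (Fin d → ℝ) => modifiedKernel β t p.1 p.2 :=
  (measurable_const.mul (measurable_laguerreKernel hβ t)).indicator
    ((measurableSet_orthant d).prod (measurableSet_orthant d))

lemma exists_modifiedKernel_le {β : Fin d → ℝ} (hβ : ∀ i, -1 / 2 ≤ β i) {t : ℝ} (ht : 0 < t)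
    (x : Fin d → ℝ) : ∃ M, ∀ y, modifiedKernel β t x y ≤ M := by
  by_cases hx : x ∈ orthant d
  · obtain ⟨M, hM⟩ := exists_laguerreKernel_le hβ ht hx
    refine ⟨max (Real.exp (-2 * t) * M) 0, fun y => ?_⟩
    by_cases hy : y ∈ orthant d
    · rw [modifiedKernel_of_mem β t hx hy]
      exact (mul_le_mul_of_nonneg_left (hM y hy) (Real.exp_pos _).le).trans (le_max_left _ _)
    · rw [modifiedKernel_comm, modifiedKernel_of_notMem_left β t hy]
      exact le_max_right _ _
  · exact ⟨0, fun y => (modifiedKernel_of_notMem_left β t hx y).le⟩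

lemma lintegral_modifiedKernel {β : Fin d → ℝ} (hβ : ∀ i, -1 < β i) {t : ℝ} (ht : 0 < t)
    {x : Fin d → ℝ} (hx : x ∈ orthant d) :
    ∫⁻ y, ENNReal.ofReal (modifiedKernel β t x y) ∂(orthantMeasure d) =
      ENNReal.ofReal (Real.exp (-2 * t)) * ∏ i, laguerreKernelMass (β i) t (x i) := by
  rw [← lintegral_laguerreKernel hβ ht hx, ← lintegral_const_mul' _ _ ENNReal.ofReal_ne_top]
  refine lintegral_congr_ae ?_
  filter_upwards [ae_mem_orthant d] with y hy
  rw [modifiedKernel_of_mem β t hx hy, ENNReal.ofReal_mul (Real.exp_pos _).le]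

lemma laguerreKernelMass_le {β : ℝ} (hβ : -1 < β) {t x : ℝ} (ht : 0 < t) (hx : 0 < x) {C : ℝ}
    (hC : ∀ w, 0 < w → laguerreMass (β / 2 + 1 / 4) w ≤ ENNReal.ofReal C) :
    laguerreKernelMass β t x ≤ ENNReal.ofReal (Real.cosh (2 * t) ^ (-1 / 2 : ℝ) * C) := by
  have := sinh_two_mul_pos ht
  have hcosh := Real.cosh_pos (2 * t)
  rw [laguerreKernelMass, lintegral_laguerreKernel₁ hβ ht hx,
    ENNReal.ofReal_mul (q := C) (Real.rpow_nonneg hcosh.le _)]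
  have hw : 0 < x ^ 2 / (2 * Real.sinh (2 * t) * Real.cosh (2 * t)) := by positivity
  refine mul_le_mul' (ENNReal.ofReal_le_ofReal ?_) (hC _ hw)
  refine mul_le_of_le_one_right (by positivity) ?_
  rw [Real.exp_le_one_iff, neg_nonpos]
  positivity

lemma lintegral_modifiedKernel_le {β : Fin d → ℝ} (hβ : ∀ i, -1 < β i) {t : ℝ} (ht : 0 < t)
    {C : Fin d → ℝ} (hC0 : ∀ i, 0 ≤ C i)
    (hC : ∀ i w, 0 < w → laguerreMass (β i / 2 + 1 / 4) w ≤ ENNReal.ofReal (C i))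
    (x : Fin d → ℝ) :
    ∫⁻ y, ENNReal.ofReal (modifiedKernel β t x y) ∂(orthantMeasure d) ≤
      ENNReal.ofReal
        ((∏ i, C i) * (Real.exp (-2 * t) * Real.cosh (2 * t) ^ (-(d : ℝ) / 2))) := by
  by_cases hx : x ∈ orthant d
  swap
  · simp [modifiedKernel_of_notMem_left β t hx]
  have hcosh := Real.cosh_pos (2 * t)
  have hpow : (Real.cosh (2 * t) ^ (-1 / 2 : ℝ)) ^ d = Real.cosh (2 * t) ^ (-(d : ℝ) / 2) := by
    rw [← Real.rpow_mul_natCast hcosh.le]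
    congr 1
    ring
  calc ∫⁻ y, ENNReal.ofReal (modifiedKernel β t x y) ∂(orthantMeasure d)
      = ENNReal.ofReal (Real.exp (-2 * t)) * ∏ i, laguerreKernelMass (β i) t (x i) :=
        lintegral_modifiedKernel hβ ht hx
    _ ≤ ENNReal.ofReal (Real.exp (-2 * t)) *
          ∏ i, ENNReal.ofReal (Real.cosh (2 * t) ^ (-1 / 2 : ℝ) * C i) :=
        mul_le_mul_right (Finset.prod_le_prod' fun i _ =>
          laguerreKernelMass_le (hβ i) ht (hx i) (hC i)) _
    _ = _ := by
        rw [← ENNReal.ofReal_prod_of_nonneg fun i _ => mul_nonneg (by positivity) (hC0 i),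
          ← ENNReal.ofReal_mul (Real.exp_pos _).le, Finset.prod_mul_distrib, Finset.prod_const,
          Finset.card_univ, Fintype.card_fin, hpow]
        congr 1
        ring

lemma isSchurKernel_modifiedKernel {β : Fin d → ℝ} (hβ : ∀ i, -1 / 2 ≤ β i) {t : ℝ} (ht : 0 < t)
    {C : Fin d → ℝ} (hC0 : ∀ i, 0 ≤ C i)
    (hC : ∀ i w, 0 < w → laguerreMass (β i / 2 + 1 / 4) w ≤ ENNReal.ofReal (C i)) :
    IsSchurKernel (orthantMeasure d) (modifiedKernel β t)
      ((∏ i, C i) * (Real.exp (-2 * t) * Real.cosh (2 * t) ^ (-(d : ℝ) / 2))) :=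
  have hβ' : ∀ i, -1 < β i := fun i => by linarith [hβ i]
  { measurable := measurable_modifiedKernel hβ' t
    nonneg := modifiedKernel_nonneg hβ' ht
    symm := modifiedKernel_comm β t
    lintegral_le := lintegral_modifiedKernel_le hβ' ht hC0 hC
    bdd := exists_modifiedKernel_le hβ ht }

lemma isSchurKernel_modifiedKernel_of_eq_or_le {β : Fin d → ℝ}
    (hβ : ∀ i, β i = -1 / 2 ∨ 1 / 2 ≤ β i) {t : ℝ} (ht : 0 < t) :
    IsSchurKernel (orthantMeasure d) (modifiedKernel β t)
      (Real.exp (-2 * t) * Real.cosh (2 * t) ^ (-(d : ℝ) / 2)) := by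
  have hmass (i : Fin d) (w : ℝ) (hw : 0 < w) :
      laguerreMass (β i / 2 + 1 / 4) w ≤ ENNReal.ofReal 1 := by
    rw [ENNReal.ofReal_one]
    rcases hβ i with h | h
    · rw [h, show (-1 / 2 : ℝ) / 2 + 1 / 4 = 0 by norm_num, laguerreMass_zero hw.le]
    · exact laguerreMass_le_one (by linarith) hw
  have hβ' (i : Fin d) : -1 / 2 ≤ β i := (hβ i).elim (fun h => h.ge) fun h => by linarith
  simpa using isSchurKernel_modifiedKernel hβ' ht (C := fun _ => 1) (fun _ => zero_le_one) hmass

lemma exists_isSchurKernel_modifiedKernel {β : Fin d → ℝ} (hβ : ∀ i, -1 / 2 ≤ β i) :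
    ∃ C, 1 < C ∧ ∀ t, 0 < t → IsSchurKernel (orthantMeasure d) (modifiedKernel β t)
      (C * (Real.exp (-2 * t) * Real.cosh (2 * t) ^ (-(d : ℝ) / 2))) := by
  choose C hC1 hC using fun i =>
    exists_laguerreMass_le (a := β i / 2 + 1 / 4) (by linarith [hβ i])
  have hC0 (i : Fin d) : 0 < C i := zero_lt_one.trans_le (hC1 i)
  refine ⟨∏ i, C i + 1, lt_add_of_pos_left _ (Finset.prod_pos fun i _ => hC0 i), fun t ht => ?_⟩
  refine (isSchurKernel_modifiedKernel hβ ht (fun i => (hC0 i).le) hC).mono ?_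
  have := Real.cosh_pos (2 * t)
  gcongr
  exact le_add_of_nonneg_right zero_le_one

lemma exp_mul_cosh_rpow_lt_one (d : ℕ) {t : ℝ} (ht : 0 < t) :
    Real.exp (-2 * t) * Real.cosh (2 * t) ^ (-(d : ℝ) / 2) < 1 := by
  have hexp : Real.exp (-2 * t) < 1 := Real.exp_lt_one_iff.2 (by linarith)
  have hcosh : Real.cosh (2 * t) ^ (-(d : ℝ) / 2) ≤ 1 :=
    Real.rpow_le_one_of_one_le_of_nonpos (Real.one_le_cosh _)
      (by linarith [d.cast_nonneg (α := ℝ)])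
  exact mul_lt_one_of_nonneg_of_lt_one_left (Real.exp_pos _).le hexp hcosh

/-! ### Chapman–Kolmogorov -/

lemma memLp_two_of_integrable_of_bound {X : Type*} [MeasurableSpace X] {μ : Measure X}
    {f : X → ℝ} {M : ℝ} (hf : Integrable f μ) (hM : ∀ᵐ y ∂μ, ‖f y‖ ≤ M) : MemLp f 2 μ := by
  rw [memLp_two_iff_integrable_sq hf.1]
  simp only [sq]
  exact hf.mul_bdd hf.1 hM

lemma memLp_laguerreKernel {β : Fin d → ℝ} (hβ : ∀ i, -1 / 2 ≤ β i) {t : ℝ} (ht : 0 < t)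
    {x : Fin d → ℝ} (hx : x ∈ orthant d) :
    MemLp (fun y => laguerreKernel β t x y) 2 (orthantMeasure d) := by
  obtain ⟨M, hM⟩ := exists_laguerreKernel_le hβ ht hx
  obtain ⟨C, -, hC⟩ := exists_isSchurKernel_modifiedKernel hβ
  have hint : Integrable (fun y => laguerreKernel β t x y) (orthantMeasure d) := by
    refine (((hC t ht).integrable_right (𝕜 := ℝ) x).const_mul (Real.exp (-2 * t))⁻¹).congr ?_
    filter_upwards [ae_mem_orthant d] with y hy
    rw [modifiedKernel_of_mem β t hx hy]
    simp
  refine memLp_two_of_integrable_of_bound (M := M) hint ?_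
  filter_upwards [ae_mem_orthant d] with y hy
  rw [Real.norm_of_nonneg (laguerreKernel_nonneg (fun i => by linarith [hβ i]) ht hx hy)]
  exact hM y hy

lemma summable_integral_norm_hermiteKernelTerm_mul {β : Fin d → ℝ} (hβ : ∀ i, -1 < β i) {t : ℝ}
    (ht : 0 < t) (x : Fin d → ℝ) {h : (Fin d → ℝ) → ℝ} (hh : MemLp h 2 (orthantMeasure d)) :
    Summable fun k => ∫ y, ‖hermiteKernelTerm β t x y k * h y‖ ∂(orthantMeasure d) := by
  refine ((summable_exp_mul_abs_hermiteFun hβ ht x).mul_right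
    ((1 + ∫ y, h y ^ 2 ∂(orthantMeasure d)) / 2)).of_nonneg_of_le
    (fun k => integral_nonneg fun y => norm_nonneg _) fun k => ?_
  calc ∫ y, ‖hermiteKernelTerm β t x y k * h y‖ ∂(orthantMeasure d)
      = Real.exp (-t * hermiteEigenvalue β k) * |hermiteFun β k x| *
          ∫ y, |hermiteFun β k y * h y| ∂(orthantMeasure d) := by
        rw [← integral_const_mul]
        simp only [hermiteKernelTerm, norm_mul, Real.norm_eq_abs, abs_mul, Real.abs_exp, mul_assoc]
    _ ≤ _ := by
        rw [← integral_hermiteFun_sq hβ k]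
        gcongr
        exact integral_abs_mul_le_of_memLp_two (memLp_hermiteFun hβ k) hh

lemma hasSum_integral_laguerreKernel_mul {β : Fin d → ℝ} (hβ : ∀ i, -1 < β i) {t : ℝ} (ht : 0 < t)
    (x : Fin d → ℝ) {h : (Fin d → ℝ) → ℝ} (hh : MemLp h 2 (orthantMeasure d)) :
    HasSum (fun k => Real.exp (-t * hermiteEigenvalue β k) * hermiteFun β k x *
        ∫ y, hermiteFun β k y * h y ∂(orthantMeasure d))
      (∫ y, laguerreKernel β t x y * h y ∂(orthantMeasure d)) := by
  have hterm (k : Fin d → ℕ) (y : Fin d → ℝ) : hermiteKernelTerm β t x y k * h y =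
      Real.exp (-t * hermiteEigenvalue β k) * hermiteFun β k x * (hermiteFun β k y * h y) := by
    rw [hermiteKernelTerm]
    ring
  have hsum := hasSum_integral_of_summable_integral_norm (μ := orthantMeasure d)
    (F := fun (k : Fin d → ℕ) y => hermiteKernelTerm β t x y k * h y)
    (fun k => by
      simp only [hterm]
      exact ((memLp_hermiteFun hβ k).integrable_mul hh).const_mul _)
    (summable_integral_norm_hermiteKernelTerm_mul hβ ht x hh)
  have htsum (y : Fin d → ℝ) : ∑' k, hermiteKernelTerm β t x y k * h y =
      laguerreKernel β t x y * h y :=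
    ((hasSum_hermiteKernelTerm hβ ht x y).mul_right (h y)).tsum_eq
  simp only [htsum] at hsum
  simpa only [hterm, integral_const_mul] using hsum

lemma integral_laguerreKernel_mul_hermiteFun {β : Fin d → ℝ} (hβ : ∀ i, -1 < β i) {t : ℝ}
    (ht : 0 < t) (x : Fin d → ℝ) (k : Fin d → ℕ) :
    ∫ y, laguerreKernel β t x y * hermiteFun β k y ∂(orthantMeasure d) =
      Real.exp (-t * hermiteEigenvalue β k) * hermiteFun β k x := by
  refine (hasSum_integral_laguerreKernel_mul hβ ht x (memLp_hermiteFun hβ k)).unique ?_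
  simp_rw [integral_hermiteFun_mul hβ]
  convert! hasSum_single (f := fun l => Real.exp (-t * hermiteEigenvalue β l) * hermiteFun β l x *
    if l = k then 1 else 0) k (fun l hl => by simp [hl]) using 1
  simp

lemma integral_laguerreKernel_mul_laguerreKernel {β : Fin d → ℝ} (hβ : ∀ i, -1 / 2 ≤ β i)
    {s t : ℝ} (hs : 0 < s) (ht : 0 < t) (x : Fin d → ℝ) {y : Fin d → ℝ} (hy : y ∈ orthant d) :
    ∫ z, laguerreKernel β s x z * laguerreKernel β t z y ∂(orthantMeasure d) =
      laguerreKernel β (s + t) x y := by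
  have hβ' : ∀ i, -1 < β i := fun i => by linarith [hβ i]
  simp_rw [laguerreKernel_comm β t _ y]
  refine (hasSum_integral_laguerreKernel_mul hβ' hs x (memLp_laguerreKernel hβ ht hy)).unique ?_
  convert! hasSum_hermiteKernelTerm hβ' (add_pos hs ht) x y using 1
  funext k
  simp_rw [mul_comm (hermiteFun β k _) (laguerreKernel β t y _)]
  rw [integral_laguerreKernel_mul_hermiteFun hβ' ht, hermiteKernelTerm, neg_add, add_mul,
    Real.exp_add]
  ring

lemma integral_modifiedKernel_mul_modifiedKernel {β : Fin d → ℝ} (hβ : ∀ i, -1 / 2 ≤ β i)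
    {s t : ℝ} (hs : 0 < s) (ht : 0 < t) (x y : Fin d → ℝ) :
    ∫ z, modifiedKernel β s x z * modifiedKernel β t z y ∂(orthantMeasure d) =
      modifiedKernel β (s + t) x y := by
  by_cases hx : x ∈ orthant d
  swap
  · simp [modifiedKernel_of_notMem_left _ _ hx]
  by_cases hy : y ∈ orthant d
  swap
  · simp_rw [modifiedKernel_comm β _ _ y]
    simp [modifiedKernel_of_notMem_left _ _ hy]
  rw [modifiedKernel_of_mem β _ hx hy, ← integral_laguerreKernel_mul_laguerreKernel hβ hs ht x hy,
    ← integral_const_mul]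
  refine integral_congr_ae ?_
  filter_upwards [ae_mem_orthant d] with z hz
  rw [modifiedKernel_of_mem β s hx hz, modifiedKernel_of_mem β t hz hy, mul_add, Real.exp_add]
  ring

/-! ### The modified semigroup -/

section HilbertBasis

variable {𝕜 E ι : Type*} [RCLike 𝕜] [NormedAddCommGroup E] [InnerProductSpace 𝕜 E]

lemma hasSum_sq_norm_inner_hilbertBasis (b : HilbertBasis ι 𝕜 E) (x : E) :
    HasSum (fun i => ‖inner 𝕜 (b i) x‖ ^ 2) (‖x‖ ^ 2) := by
  have h := RCLike.hasSum_re 𝕜 (b.hasSum_inner_mul_inner x x)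
  simpa only [inner_mul_symm_re_eq_norm, norm_mul, norm_inner_symm x, ← sq,
    inner_self_eq_norm_sq] using h

lemma tendsto_tsum_sq_one_sub_exp_mul {c m : ι → ℝ} (hc : Summable fun i => c i ^ 2)
    (hm : ∀ i, 0 ≤ m i) :
    Tendsto (fun t => ∑' i, ((1 - Real.exp (-t * m i)) * c i) ^ 2) (𝓝[>] 0) (𝓝 0) := by
  suffices Tendsto (fun t => ∑' i, ((1 - Real.exp (-t * m i)) * c i) ^ 2) (𝓝[>] 0)
      (𝓝 (∑' _ : ι, (0 : ℝ))) by rwa [tsum_zero] at this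
  refine tendsto_tsum_of_dominated_convergence hc (fun i => ?_) ?_
  · have hcont : Continuous fun t : ℝ => ((1 - Real.exp (-t * m i)) * c i) ^ 2 := by fun_prop
    simpa using (hcont.tendsto 0).mono_left nhdsWithin_le_nhds
  · filter_upwards [self_mem_nhdsWithin] with t ht i
    have hexp : Real.exp (-t * m i) ≤ 1 :=
      Real.exp_le_one_iff.2 (mul_nonpos_of_nonpos_of_nonneg (neg_nonpos.2 (le_of_lt ht)) (hm i))
    rw [Real.norm_of_nonneg (sq_nonneg _), mul_pow]
    refine mul_le_of_le_one_left (sq_nonneg _) (pow_le_one₀ (sub_nonneg.2 hexp) ?_)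
    linarith [Real.exp_pos (-t * m i)]

lemma tendsto_of_inner_hilbertBasis_eq_exp_mul (b : HilbertBasis ι 𝕜 E) {m : ι → ℝ}
    (hm : ∀ i, 0 ≤ m i) {u : ℝ → E} {x : E}
    (hu : ∀ t, 0 < t → ∀ i, inner 𝕜 (b i) (u t) = (Real.exp (-t * m i) : 𝕜) * inner 𝕜 (b i) x) :
    Tendsto u (𝓝[>] 0) (𝓝 x) := by
  have hparseval (t : ℝ) (ht : 0 < t) :
      ∑' i, ((1 - Real.exp (-t * m i)) * ‖inner 𝕜 (b i) x‖) ^ 2 = ‖u t - x‖ ^ 2 := by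
    rw [← (hasSum_sq_norm_inner_hilbertBasis b _).tsum_eq]
    refine tsum_congr fun i => ?_
    have hcoeff : inner 𝕜 (b i) (u t - x) =
        ((Real.exp (-t * m i) - 1 : ℝ) : 𝕜) * inner 𝕜 (b i) x := by
      rw [inner_sub_right, hu t ht]
      push_cast
      ring
    rw [hcoeff, norm_mul, RCLike.norm_ofReal, mul_pow, mul_pow, sq_abs, sub_sq_comm]
  have hlim := (tendsto_tsum_sq_one_sub_exp_mul
    (hasSum_sq_norm_inner_hilbertBasis b x).summable hm).sqrt
  rw [Real.sqrt_zero] at hlim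
  refine tendsto_iff_norm_sub_tendsto_zero.2 (hlim.congr' ?_)
  filter_upwards [self_mem_nhdsWithin] with t ht
  rw [hparseval t ht, Real.sqrt_sq (norm_nonneg _)]

end HilbertBasis

lemma hermiteEigenvalue_nonneg {β : Fin d → ℝ} (hβ : ∀ i, -1 ≤ β i) (k : Fin d → ℕ) :
    0 ≤ hermiteEigenvalue β k := by
  have hk : (0 : ℝ) ≤ ∑ i, (k i : ℝ) := Finset.sum_nonneg fun i _ => (k i).cast_nonneg
  have hsum : ∑ _i : Fin d, (-1 : ℝ) ≤ ∑ i, β i := Finset.sum_le_sum fun i _ => hβ i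
  rw [Finset.sum_const, Finset.card_univ, Fintype.card_fin, nsmul_eq_mul] at hsum
  rw [hermiteEigenvalue]
  linarith

section Semigroup

variable {𝕜 : Type*} [RCLike 𝕜] {α β : Fin d → ℝ} {j : Fin d} {t : ℝ}

lemma kernelOp_modifiedKernel_ae_eq (hβ : ∀ i, -1 < β i) (ht : 0 < t) (f : (Fin d → ℝ) → 𝕜) :
    kernelOp (orthantMeasure d) (modifiedKernel β t) f =ᵐ[orthantMeasure d] fun x =>
      (Real.exp (-2 * t) : 𝕜) * ∫ y, (hermiteKernel β t x y : 𝕜) * f y ∂(orthantMeasure d) := by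
  filter_upwards [ae_mem_orthant d] with x hx
  rw [kernelOp, ← integral_const_mul]
  refine integral_congr_ae ?_
  filter_upwards [ae_mem_orthant d] with y hy
  rw [hermiteKernel_eq_laguerreKernel hβ ht, modifiedKernel_of_mem _ _ hx hy]
  push_cast
  ring

lemma integrable_hermiteKernel_mul (hβ : ∀ i, -1 / 2 ≤ β i) (ht : 0 < t)
    {f : (Fin d → ℝ) → 𝕜} (hf : MemL1AddLinfty (orthantMeasure d) f) {x : Fin d → ℝ}
    (hx : x ∈ orthant d) :
    Integrable (fun y => (hermiteKernel β t x y : 𝕜) * f y) (orthantMeasure d) := by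
  obtain ⟨C, -, hC⟩ := exists_isSchurKernel_modifiedKernel hβ
  refine (((hC t ht).integrable_mul x hf).const_mul ((Real.exp (-2 * t) : ℝ) : 𝕜)⁻¹).congr ?_
  filter_upwards [ae_mem_orthant d] with y hy
  have : ((Real.exp (-2 * t) : ℝ) : 𝕜) ≠ 0 := RCLike.ofReal_ne_zero.2 (Real.exp_pos _).ne'
  rw [hermiteKernel_eq_laguerreKernel (fun i => by linarith [hβ i]) ht,
    modifiedKernel_of_mem _ _ hx hy, RCLike.ofReal_mul]
  field_simp

lemma kernelOp_hermiteFun (hβ : ∀ i, -1 < β i) (ht : 0 < t) (k : Fin d → ℕ) :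
    kernelOp (orthantMeasure d) (modifiedKernel β t) (fun x => (hermiteFun β k x : 𝕜))
      =ᵐ[orthantMeasure d] fun x =>
        (Real.exp (-t * (hermiteEigenvalue β k + 2)) : 𝕜) * hermiteFun β k x := by
  filter_upwards [kernelOp_modifiedKernel_ae_eq hβ ht fun x => (hermiteFun β k x : 𝕜)] with x hx
  simp only [hx, hermiteKernel_eq_laguerreKernel hβ ht, ← RCLike.ofReal_mul]
  rw [integral_ofReal, integral_laguerreKernel_mul_hermiteFun hβ ht, ← RCLike.ofReal_mul,
    ← mul_assoc, ← Real.exp_add]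
  congr 3
  ring

lemma inner_hermiteVec_toLp_kernelOp (hβ : ∀ i, -1 < β i) (ht : 0 < t)
    (f : Lp 𝕜 2 (orthantMeasure d)) {C : ℝ}
    (hK : IsSchurKernel (orthantMeasure d) (modifiedKernel β t) C) (k : Fin d → ℕ) :
    inner 𝕜 (hermiteVec 𝕜 β k) (hK.memLp_kernelOp one_le_two (Lp.memLp f)).toLp =
      (Real.exp (-t * (hermiteEigenvalue β k + 2)) : 𝕜) * inner 𝕜 (hermiteVec 𝕜 β k) f := by
  rw [inner_hermiteVec hβ, inner_hermiteVec hβ]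
  calc _ = ∫ x, (hermiteFun β k x : 𝕜) * kernelOp (orthantMeasure d) (modifiedKernel β t) f x
          ∂(orthantMeasure d) := by
        refine integral_congr_ae ?_
        filter_upwards [(hK.memLp_kernelOp one_le_two (Lp.memLp f)).coeFn_toLp] with x hx
        rw [hx]
    _ = ∫ x, kernelOp (orthantMeasure d) (modifiedKernel β t)
          (fun x => (hermiteFun β k x : 𝕜)) x * f x ∂(orthantMeasure d) :=
        (hK.integral_kernelOp_mul (memLp_ofReal_hermiteFun 𝕜 hβ k) (Lp.memLp f)).symm
    _ = _ := by
        rw [← integral_const_mul]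
        refine integral_congr_ae ?_
        filter_upwards [kernelOp_hermiteFun (𝕜 := 𝕜) hβ ht k] with x hx
        rw [hx, mul_assoc]

lemma modifiedHermiteHeat_eq_tsum (α : Fin d → ℝ) (j : Fin d) (t : ℝ)
    (f : Lp 𝕜 2 (orthantMeasure d)) :
    modifiedHermiteHeat α j t f =
      ∑' k, ((Real.exp (-t * (hermiteEigenvalue (α + Pi.single j 1) k + 2)) : 𝕜) *
        inner 𝕜 (hermiteVec 𝕜 (α + Pi.single j 1) k) f) •
          hermiteVec 𝕜 (α + Pi.single j 1) k := by
  rw [modifiedHermiteHeat, hermiteHeat, ← tsum_const_smul'']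
  refine tsum_congr fun k => ?_
  rw [mul_add, add_comm (_ * _), mul_comm (-t) 2, ← neg_mul_comm, Real.exp_add, smul_smul]
  push_cast
  rw [mul_assoc]

lemma modifiedHermiteHeat_zero (hβ : ∀ i, -1 < (α + Pi.single j 1 : Fin d → ℝ) i)
    (f : Lp 𝕜 2 (orthantMeasure d)) : modifiedHermiteHeat α j 0 f = f := by
  have h := ((hermiteBasis 𝕜 hβ).hasSum_repr f).tsum_eq
  simp only [HilbertBasis.repr_apply_apply, coe_hermiteBasis] at h
  simpa [modifiedHermiteHeat_eq_tsum] using h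

lemma modifiedHermiteHeat_eq_toLp (hβ : ∀ i, -1 < (α + Pi.single j 1 : Fin d → ℝ) i) (ht : 0 < t)
    (f : Lp 𝕜 2 (orthantMeasure d)) {C : ℝ}
    (hK : IsSchurKernel (orthantMeasure d) (modifiedKernel (α + Pi.single j 1) t) C) :
    modifiedHermiteHeat α j t f = (hK.memLp_kernelOp one_le_two (Lp.memLp f)).toLp := by
  have h := ((hermiteBasis 𝕜 hβ).hasSum_repr
    (hK.memLp_kernelOp one_le_two (Lp.memLp f)).toLp).tsum_eq
  simp only [HilbertBasis.repr_apply_apply, coe_hermiteBasis,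
    inner_hermiteVec_toLp_kernelOp hβ ht f hK] at h
  rw [modifiedHermiteHeat_eq_tsum, h]

lemma modifiedHermiteSemigroup_zero (α : Fin d → ℝ) (j : Fin d) (f : (Fin d → ℝ) → 𝕜) :
    modifiedHermiteSemigroup α j 0 f = f :=
  funext fun _ => if_pos rfl

lemma modifiedHermiteSemigroup_ae_eq (hβ : ∀ i, -1 < (α + Pi.single j 1 : Fin d → ℝ) i)
    (ht : 0 < t) (f : (Fin d → ℝ) → 𝕜) :
    modifiedHermiteSemigroup α j t f =ᵐ[orthantMeasure d]
      kernelOp (orthantMeasure d) (modifiedKernel (α + Pi.single j 1) t) f := by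
  filter_upwards [kernelOp_modifiedKernel_ae_eq hβ ht f] with x hx
  rw [hx, modifiedHermiteSemigroup, if_neg ht.ne']

lemma modifiedHermiteHeat_ae_eq (hβ : ∀ i, -1 / 2 ≤ (α + Pi.single j 1 : Fin d → ℝ) i)
    (ht : 0 ≤ t) (f : Lp 𝕜 2 (orthantMeasure d)) :
    modifiedHermiteHeat α j t f =ᵐ[orthantMeasure d] modifiedHermiteSemigroup α j t f := by
  have hβ' : ∀ i, -1 < (α + Pi.single j 1 : Fin d → ℝ) i := fun i => by linarith [hβ i]
  rcases ht.eq_or_lt with rfl | ht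
  · rw [modifiedHermiteHeat_zero hβ', modifiedHermiteSemigroup_zero]
  obtain ⟨C, -, hC⟩ := exists_isSchurKernel_modifiedKernel hβ
  rw [modifiedHermiteHeat_eq_toLp hβ' ht f (hC t ht)]
  exact (MemLp.coeFn_toLp _).trans (modifiedHermiteSemigroup_ae_eq hβ' ht f).symm

lemma modifiedHermiteHeat_toLp_ae_eq (hβ : ∀ i, -1 / 2 ≤ (α + Pi.single j 1 : Fin d → ℝ) i)
    (ht : 0 < t) {f : (Fin d → ℝ) → 𝕜} (hf : MemLp f 2 (orthantMeasure d)) :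
    modifiedHermiteHeat α j t hf.toLp =ᵐ[orthantMeasure d]
      kernelOp (orthantMeasure d) (modifiedKernel (α + Pi.single j 1) t) f := by
  rw [← kernelOp_congr_ae _ hf.coeFn_toLp]
  exact (modifiedHermiteHeat_ae_eq hβ ht.le _).trans
    (modifiedHermiteSemigroup_ae_eq (fun i => by linarith [hβ i]) ht _)

lemma tendsto_modifiedHermiteHeat (hβ : ∀ i, -1 / 2 ≤ (α + Pi.single j 1 : Fin d → ℝ) i)
    (f : Lp 𝕜 2 (orthantMeasure d)) :
    Tendsto (fun t => modifiedHermiteHeat α j t f) (𝓝[>] 0) (𝓝 f) := by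
  have hβ' : ∀ i, -1 < (α + Pi.single j 1 : Fin d → ℝ) i := fun i => by linarith [hβ i]
  obtain ⟨C, -, hC⟩ := exists_isSchurKernel_modifiedKernel hβ
  refine tendsto_of_inner_hilbertBasis_eq_exp_mul (hermiteBasis 𝕜 hβ')
    (fun k => add_nonneg (hermiteEigenvalue_nonneg (fun i => (hβ' i).le) k) zero_le_two)
    fun t ht k => ?_
  rw [coe_hermiteBasis, modifiedHermiteHeat_eq_toLp hβ' ht f (hC t ht),
    inner_hermiteVec_toLp_kernelOp hβ' ht f (hC t ht)]

lemma tendsto_eLpNorm_modifiedHermiteSemigroup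
    (hβ : ∀ i, -1 / 2 ≤ (α + Pi.single j 1 : Fin d → ℝ) i) {f : (Fin d → ℝ) → 𝕜}
    (hf : MemLp f 2 (orthantMeasure d)) :
    Tendsto (fun t => eLpNorm (modifiedHermiteSemigroup α j t f - f) 2 (orthantMeasure d))
      (𝓝[>] 0) (𝓝 0) := by
  refine (tendsto_iff_edist_tendsto_0.1 (tendsto_modifiedHermiteHeat hβ hf.toLp)).congr' ?_
  filter_upwards [self_mem_nhdsWithin] with t ht
  rw [Lp.edist_def]
  exact eLpNorm_congr_ae (((modifiedHermiteHeat_toLp_ae_eq hβ ht hf).trans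
    (modifiedHermiteSemigroup_ae_eq (fun i => by linarith [hβ i]) ht f).symm).sub hf.coeFn_toLp)

theorem isSubmarkovian_modifiedHermiteSemigroup
    (hβ : ∀ i, (α + Pi.single j 1 : Fin d → ℝ) i = -1 / 2 ∨
      1 / 2 ≤ (α + Pi.single j 1 : Fin d → ℝ) i) :
    IsSubmarkovian (𝕜 := 𝕜) (orthantMeasure d) (modifiedHermiteSemigroup α j) := by
  have hβ' (i : Fin d) : -1 / 2 ≤ (α + Pi.single j 1 : Fin d → ℝ) i :=
    (hβ i).elim (fun h => h.ge) fun h => by linarith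
  exact isSubmarkovian_of_isSchurKernel
    (fun t ht => (isSchurKernel_modifiedKernel_of_eq_or_le hβ ht).mono
      (exp_mul_cosh_rpow_lt_one d ht).le)
    (modifiedHermiteSemigroup_zero α j)
    (fun t ht f => modifiedHermiteSemigroup_ae_eq (fun i => by linarith [hβ' i]) ht f)
    (fun s t hs ht x y => integral_modifiedKernel_mul_modifiedKernel hβ' hs ht x y)
    fun f hf => tendsto_eLpNorm_modifiedHermiteSemigroup hβ' hf

lemma isOpen_orthant (d : ℕ) : IsOpen (orthant d) := by
  simp only [orthant, ofPred_forall]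
  exact isOpen_iInter_of_finite fun i => isOpen_lt continuous_const (continuous_apply i)

lemma orthantMeasure_ne_zero (d : ℕ) : orthantMeasure d ≠ 0 := by
  rw [orthantMeasure, Ne, Measure.restrict_eq_zero]
  exact ((isOpen_orthant d).measure_pos _ ⟨1, fun _ => one_pos⟩).ne'

theorem not_isMarkovian_modifiedHermiteSemigroup
    (hβ : ∀ i, (α + Pi.single j 1 : Fin d → ℝ) i = -1 / 2 ∨
      1 / 2 ≤ (α + Pi.single j 1 : Fin d → ℝ) i) :
    ¬ IsMarkovian (𝕜 := 𝕜) (orthantMeasure d) (modifiedHermiteSemigroup α j) := by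
  intro hM
  have hβ' (i : Fin d) : -1 < (α + Pi.single j 1 : Fin d → ℝ) i := by
    rcases hβ i with h | h <;> linarith
  have : (ae (orthantMeasure d)).NeBot := ae_neBot.2 (orthantMeasure_ne_zero d)
  obtain ⟨x, hone, hkernel⟩ := ((hM.map_one 1 zero_le_one).and
    (modifiedHermiteSemigroup_ae_eq (𝕜 := 𝕜) hβ' one_pos fun _ => 1)).exists
  have hle := (isSchurKernel_modifiedKernel_of_eq_or_le hβ one_pos).kernelOp_one_le (𝕜 := 𝕜)
    (by positivity) x
  rw [← hkernel, hone, ← RCLike.ofReal_one, RCLike.ofReal_le_ofReal] at hle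
  exact hle.not_gt (exp_mul_cosh_rpow_lt_one d one_pos)

end Semigroup

/-! ### Failure of contractivity -/

lemma le_laguerreKernelMass {β : ℝ} (hβ : -1 < β) {A B η : ℝ}
    (hη : ∀ w ∈ Icc A B, ENNReal.ofReal η ≤ laguerreMass (β / 2 + 1 / 4) w) {t x : ℝ}
    (ht : 0 < t) (hx : 0 < x)
    (hxw : x ^ 2 / (2 * Real.sinh (2 * t) * Real.cosh (2 * t)) ∈ Icc A B) :
    ENNReal.ofReal (Real.cosh (2 * t) ^ (-1 / 2 : ℝ) *
        Real.exp (-(Real.sinh (2 * t) ^ 2 * B)) * η) ≤ laguerreKernelMass β t x := by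
  have := Real.cosh_pos (2 * t)
  rw [laguerreKernelMass, lintegral_laguerreKernel₁ hβ ht hx, ENNReal.ofReal_mul (by positivity)]
  refine mul_le_mul' (ENNReal.ofReal_le_ofReal ?_) (hη _ hxw)
  have := hxw.2
  gcongr

lemma le_lintegral_modifiedKernel {β : Fin d → ℝ} (hβ : ∀ i, -1 < β i) {A B η : Fin d → ℝ}
    (hη0 : ∀ i, 0 ≤ η i)
    (hη : ∀ i, ∀ w ∈ Icc (A i) (B i), ENNReal.ofReal (η i) ≤ laguerreMass (β i / 2 + 1 / 4) w)
    {t : ℝ} (ht : 0 < t) {x : Fin d → ℝ} (hx : x ∈ orthant d)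
    (hxw : ∀ i, x i ^ 2 / (2 * Real.sinh (2 * t) * Real.cosh (2 * t)) ∈ Icc (A i) (B i)) :
    ENNReal.ofReal (Real.exp (-2 * t) * ∏ i, (Real.cosh (2 * t) ^ (-1 / 2 : ℝ) *
        Real.exp (-(Real.sinh (2 * t) ^ 2 * B i)) * η i)) ≤
      ∫⁻ y, ENNReal.ofReal (modifiedKernel β t x y) ∂(orthantMeasure d) := by
  have := Real.cosh_pos (2 * t)
  rw [lintegral_modifiedKernel hβ ht hx, ENNReal.ofReal_mul (Real.exp_pos _).le,
    ENNReal.ofReal_prod_of_nonneg fun i _ => mul_nonneg (by positivity) (hη0 i)]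
  exact mul_le_mul_right (Finset.prod_le_prod' fun i _ =>
    le_laguerreKernelMass (hβ i) (hη i) ht (hx i) (hxw i)) _

lemma exists_Icc_le_laguerreMass_one_lt_prod {β : Fin d → ℝ} (hβ : ∀ i, -1 / 2 ≤ β i)
    (hβ' : ∃ i, -1 / 2 < β i ∧ β i < 1 / 2) :
    ∃ A B η : Fin d → ℝ, (∀ i, 0 < A i) ∧ (∀ i, A i < B i) ∧ (∀ i, 0 ≤ η i) ∧ (1 < ∏ i, η i) ∧
      ∀ i, ∀ w ∈ Icc (A i) (B i), ENNReal.ofReal (η i) ≤ laguerreMass (β i / 2 + 1 / 4) w := by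
  obtain ⟨i₀, hlow, hhigh⟩ := hβ'
  obtain ⟨η₀, A₀, B₀, hη₀, hA₀, hAB₀, hmass₀⟩ :=
    exists_Icc_lt_laguerreMass (a := β i₀ / 2 + 1 / 4) (by linarith) (by linarith)
  have hlim : Tendsto (fun ε : ℝ => ∏ i, if i = i₀ then η₀ else 1 - ε) (𝓝[>] 0) (𝓝 η₀) := by
    have hcont : Continuous fun ε : ℝ => ∏ i, if i = i₀ then η₀ else 1 - ε :=
      continuous_finsetProd _ fun i _ => by split_ifs <;> fun_prop
    simpa using (hcont.tendsto 0).mono_left nhdsWithin_le_nhds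
  obtain ⟨ε, hprod, hε0, hε1⟩ := ((hlim.eventually_const_lt hη₀).and
    (Ioo_mem_nhdsGT (zero_lt_one (α := ℝ)))).exists
  have hbox (i : Fin d) : ∃ A B : ℝ, 0 < A ∧ A < B ∧ ∀ w ∈ Icc A B,
      ENNReal.ofReal (if i = i₀ then η₀ else 1 - ε) ≤ laguerreMass (β i / 2 + 1 / 4) w := by
    rcases eq_or_ne i i₀ with rfl | hi
    · exact ⟨A₀, B₀, hA₀, hAB₀, by simpa using hmass₀⟩
    · simp only [hi, if_false]
      exact exists_Icc_le_laguerreMass (by linarith [hβ i]) hε0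
  choose A B hA hAB hmass using hbox
  refine ⟨A, B, _, hA, hAB, fun i => ?_, hprod, hmass⟩
  split_ifs <;> linarith

lemma tendsto_exp_mul_prod_cosh_rpow_mul_exp (B η : Fin d → ℝ) :
    Tendsto (fun t => Real.exp (-2 * t) * ∏ i, (Real.cosh (2 * t) ^ (-1 / 2 : ℝ) *
        Real.exp (-(Real.sinh (2 * t) ^ 2 * B i)) * η i)) (𝓝[>] 0) (𝓝 (∏ i, η i)) := by
  have hcosh : Continuous fun t : ℝ => Real.cosh (2 * t) ^ (-1 / 2 : ℝ) :=
    (by fun_prop : Continuous fun t : ℝ => Real.cosh (2 * t)).rpow_const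
      fun t => Or.inl (Real.cosh_pos _).ne'
  have hcont : Continuous fun t : ℝ => Real.exp (-2 * t) *
      ∏ i, (Real.cosh (2 * t) ^ (-1 / 2 : ℝ) *
        Real.exp (-(Real.sinh (2 * t) ^ 2 * B i)) * η i) := by
    fun_prop
  simpa using (hcont.tendsto 0).mono_left (nhdsWithin_le_nhds (s := Ioi 0))

lemma exists_measurableSet_orthant_sq_div_mem_Icc {r : ℝ} (hr : 0 < r) {A B : Fin d → ℝ}
    (hA : ∀ i, 0 < A i) (hAB : ∀ i, A i < B i) :
    ∃ E : Set (Fin d → ℝ), MeasurableSet E ∧ orthantMeasure d E ≠ 0 ∧ orthantMeasure d E ≠ ∞ ∧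
      ∀ x ∈ E, x ∈ orthant d ∧ ∀ i, x i ^ 2 / r ∈ Icc (A i) (B i) := by
  set E : Set (Fin d → ℝ) := Icc (fun i => √(r * A i)) (fun i => √(r * B i)) with hE
  have hrA (i : Fin d) : 0 < r * A i := mul_pos hr (hA i)
  have hrAB (i : Fin d) : r * A i < r * B i := mul_lt_mul_of_pos_left (hAB i) hr
  have hmem (x : Fin d → ℝ) (hx : x ∈ E) :
      x ∈ orthant d ∧ ∀ i, x i ^ 2 / r ∈ Icc (A i) (B i) := by
    have hpos (i : Fin d) : 0 < x i := (Real.sqrt_pos.2 (hrA i)).trans_le (hx.1 i)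
    refine ⟨hpos, fun i => ⟨?_, ?_⟩⟩
    · rw [le_div_iff₀' hr]
      exact (Real.sqrt_le_left (hpos i).le).1 (hx.1 i)
    · rw [div_le_iff₀' hr]
      exact (Real.le_sqrt (hpos i).le ((hrA i).trans (hrAB i)).le).1 (hx.2 i)
  have hvol : orthantMeasure d E = ∏ i, ENNReal.ofReal (√(r * B i) - √(r * A i)) := by
    rw [orthantMeasure, Measure.restrict_apply measurableSet_Icc,
      inter_eq_left.2 fun x hx => (hmem x hx).1, hE, Real.volume_Icc_pi]
  refine ⟨E, measurableSet_Icc, ?_, ?_, hmem⟩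
  · rw [hvol, Finset.prod_ne_zero_iff]
    intro i _
    rw [Ne, ENNReal.ofReal_eq_zero, not_le, sub_pos]
    exact Real.sqrt_lt_sqrt (hrA i).le (hrAB i)
  · rw [hvol]
    exact ENNReal.prod_ne_top fun i _ => ENNReal.ofReal_ne_top

lemma exists_one_lt_lintegral_modifiedKernel {β : Fin d → ℝ} (hβ : ∀ i, -1 / 2 ≤ β i)
    (hβ' : ∃ i, -1 / 2 < β i ∧ β i < 1 / 2) :
    ∃ t, 0 < t ∧ ∃ E, MeasurableSet E ∧ orthantMeasure d E ≠ 0 ∧ orthantMeasure d E ≠ ∞ ∧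
      ∃ c, 1 < c ∧
        ∀ x ∈ E, c ≤ ∫⁻ y, ENNReal.ofReal (modifiedKernel β t x y) ∂(orthantMeasure d) := by
  obtain ⟨A, B, η, hA, hAB, hη0, hprod, hη⟩ := exists_Icc_le_laguerreMass_one_lt_prod hβ hβ'
  obtain ⟨t, hlt, ht : 0 < t⟩ :=
    (((tendsto_exp_mul_prod_cosh_rpow_mul_exp B η).eventually_const_lt hprod).and
      self_mem_nhdsWithin).exists
  have hr : 0 < 2 * Real.sinh (2 * t) * Real.cosh (2 * t) :=
    mul_pos (mul_pos two_pos (sinh_two_mul_pos ht)) (Real.cosh_pos _)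
  obtain ⟨E, hE, hE0, hE_top, hmem⟩ := exists_measurableSet_orthant_sq_div_mem_Icc hr hA hAB
  exact ⟨t, ht, E, hE, hE0, hE_top, _, ENNReal.one_lt_ofReal.2 hlt, fun x hx =>
    le_lintegral_modifiedKernel (fun i => by linarith [hβ i]) hη0 hη ht (hmem x hx).1
      (hmem x hx).2⟩

theorem not_isLpContractive_modifiedHermiteHeat {𝕜 : Type*} [RCLike 𝕜] {α : Fin d → ℝ} {j : Fin d}
    (hβ : ∀ i, -1 / 2 ≤ (α + Pi.single j 1 : Fin d → ℝ) i)
    (hβ' : ∃ i, -1 / 2 < (α + Pi.single j 1 : Fin d → ℝ) i ∧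
      (α + Pi.single j 1 : Fin d → ℝ) i < 1 / 2) :
    ¬ IsLpContractive (𝕜 := 𝕜) (orthantMeasure d) (modifiedHermiteHeat α j) := by
  intro hcontr
  obtain ⟨t, ht, E, hE, hE0, hE_top, c, hc, hmass⟩ := exists_one_lt_lintegral_modifiedKernel hβ hβ'
  obtain ⟨C, -, hC⟩ := exists_isSchurKernel_modifiedKernel hβ
  have hf (p : ℝ≥0∞) : MemLp (E.indicator fun _ => (1 : 𝕜)) p (orthantMeasure d) :=
    memLp_indicator_const p hE 1 (Or.inr hE_top)
  have hle := hcontr 1 le_rfl t ht.le (hf 2).toLp ((memLp_congr_ae (hf 2).coeFn_toLp).2 (hf 1))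
  rw [eLpNorm_congr_ae (modifiedHermiteHeat_toLp_ae_eq hβ ht (hf 2)),
    eLpNorm_congr_ae (hf 2).coeFn_toLp] at hle
  exact hle.not_gt ((hC t ht).eLpNorm_one_indicator_lt_kernelOp hE hE0 hE_top hc hmass)

/-! ### The parameter `α + e_j` -/

lemma neg_half_le_add_single {j : Fin d} {α : Fin d → ℝ} (hα : α ∈ hermiteAdmissible j)
    (i : Fin d) : -1 / 2 ≤ (α + Pi.single j 1 : Fin d → ℝ) i := by
  rcases eq_or_ne i j with rfl | hij
  · simp only [Pi.add_apply, Pi.single_eq_same]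
    linarith [hα.1]
  · simpa [hij] using hα.2 i hij

lemma forall_add_single_eq_or_le_iff (j : Fin d) (α : Fin d → ℝ) :
    (∀ i, (α + Pi.single j 1 : Fin d → ℝ) i = -1 / 2 ∨
      1 / 2 ≤ (α + Pi.single j 1 : Fin d → ℝ) i) ↔
      (α j = -3 / 2 ∨ -1 / 2 ≤ α j) ∧ ∀ i, i ≠ j → α i = -1 / 2 ∨ 1 / 2 ≤ α i := by
  have hj : ((α + Pi.single j 1 : Fin d → ℝ) j = -1 / 2 ∨
      1 / 2 ≤ (α + Pi.single j 1 : Fin d → ℝ) j) ↔ α j = -3 / 2 ∨ -1 / 2 ≤ α j := by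
    rw [Pi.add_apply, Pi.single_eq_same]
    refine or_congr ⟨fun h => ?_, fun h => ?_⟩ ⟨fun h => ?_, fun h => ?_⟩ <;> linarith
  refine ⟨fun h => ⟨hj.1 (h j), fun i hij => by simpa [hij] using h i⟩, fun h i => ?_⟩
  rcases eq_or_ne i j with rfl | hij
  · exact hj.2 h.1
  · simpa [hij] using h.2 i hij

lemma exists_mem_Ioo_of_not_forall_eq_or_le {β : Fin d → ℝ} (hβ : ∀ i, -1 / 2 ≤ β i)
    (h : ¬ ∀ i, β i = -1 / 2 ∨ 1 / 2 ≤ β i) : ∃ i, -1 / 2 < β i ∧ β i < 1 / 2 := by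
  push Not at h
  exact h.imp fun i hi => ⟨(hβ i).lt_of_ne' hi.1, hi.2⟩

end

theorem mainTheorem6 {𝕜 : Type*} [RCLike 𝕜] {d : ℕ} (j : Fin d) (α : Fin d → ℝ)
    (hα : α ∈ hermiteAdmissible j) :
    -- the kernel series and the integrals converge, and the integral operators extend the semigroup
    -- given on `L²` by the spectral theorem
    ((∀ t : ℝ, 0 < t → ∀ x ∈ orthant d, ∀ y ∈ orthant d,
        Summable (hermiteKernelTerm (α + Pi.single j 1) t x y)) ∧
      (∀ t : ℝ, 0 < t → ∀ f : (Fin d → ℝ) → 𝕜, MemL1AddLinfty (orthantMeasure d) f →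
        ∀ x ∈ orthant d, Integrable
          (fun y => (hermiteKernel (α + Pi.single j 1) t x y : 𝕜) * f y) (orthantMeasure d)) ∧
      (∀ t : ℝ, 0 ≤ t → ∀ f : Lp 𝕜 2 (orthantMeasure d),
        modifiedHermiteHeat α j t f =ᵐ[orthantMeasure d] modifiedHermiteSemigroup α j t f)) ∧
    -- the contractive case
    ((α j = -3 / 2 ∨ -1 / 2 ≤ α j) ∧ (∀ i, i ≠ j → α i = -1 / 2 ∨ 1 / 2 ≤ α i) →
      IsSubmarkovian (𝕜 := 𝕜) (orthantMeasure d) (modifiedHermiteSemigroup α j) ∧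
      ¬ IsMarkovian (𝕜 := 𝕜) (orthantMeasure d) (modifiedHermiteSemigroup α j) ∧
      ∀ p : ℝ≥0∞, 1 ≤ p → ∀ t : ℝ, 0 < t →
        LpOpNormLE (𝕜 := 𝕜) (orthantMeasure d) p (modifiedHermiteSemigroup α j t)
          (Real.exp (-2 * t) * Real.cosh (2 * t) ^ (-(d : ℝ) / 2))) ∧
    -- the remaining case
    (¬ (α j = -3 / 2 ∨ -1 / 2 ≤ α j) ∨ (∃ i, i ≠ j ∧ ¬ (α i = -1 / 2 ∨ 1 / 2 ≤ α i)) →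
      ¬ IsLpContractive (𝕜 := 𝕜) (orthantMeasure d) (modifiedHermiteHeat α j) ∧
      ∃ c : ℝ, 1 < c ∧ ∀ p : ℝ≥0∞, 1 ≤ p → ∀ t : ℝ, 0 < t →
        LpOpNormLE (𝕜 := 𝕜) (orthantMeasure d) p (modifiedHermiteSemigroup α j t)
          (c * (Real.exp (-2 * t) * Real.cosh (2 * t) ^ (-(d : ℝ) / 2)))) := by
  have hβ := neg_half_le_add_single hα
  have hβ' (i : Fin d) : -1 < (α + Pi.single j 1 : Fin d → ℝ) i := by linarith [hβ i]
  have hnorm {C : ℝ} {t : ℝ} (ht : 0 < t)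
      (hK : IsSchurKernel (orthantMeasure d) (modifiedKernel (α + Pi.single j 1) t) C) (p : ℝ≥0∞)
      (hp : 1 ≤ p) : LpOpNormLE (𝕜 := 𝕜) (orthantMeasure d) p (modifiedHermiteSemigroup α j t) C :=
    hK.lpOpNormLE hp (modifiedHermiteSemigroup_ae_eq hβ' ht)
  refine ⟨⟨fun t ht x _ y _ => (hasSum_hermiteKernelTerm hβ' ht x y).summable,
    fun t ht f hf x hx => integrable_hermiteKernel_mul hβ ht hf hx,
    fun t ht f => modifiedHermiteHeat_ae_eq hβ ht f⟩, fun hcontr => ?_, fun hrest => ?_⟩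
  · have hγ := (forall_add_single_eq_or_le_iff j α).2 hcontr
    exact ⟨isSubmarkovian_modifiedHermiteSemigroup hγ, not_isMarkovian_modifiedHermiteSemigroup hγ,
      fun p hp t ht => hnorm ht (isSchurKernel_modifiedKernel_of_eq_or_le hγ ht) p hp⟩
  · have hγ := mt (forall_add_single_eq_or_le_iff j α).1 (by
      simpa only [not_and_or, not_forall, exists_prop] using hrest)
    obtain ⟨c, hc, hK⟩ := exists_isSchurKernel_modifiedKernel hβ
    exact ⟨not_isLpContractive_modifiedHermiteHeat hβ (exists_mem_Ioo_of_not_forall_eq_or_le hβ hγ),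
      c, hc, fun p hp t ht => hnorm ht (hK t ht) p hp⟩
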